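/- Let $\mathfrak g$ be a finite-dimensional complex reductive Lie algebra, $\mathfrak h$ a Cartan subalgebra, $\Delta\subset\mathfrak h^*$ the root system of $(\mathfrak g,\mathfrak h)$, $\Delta^+$ a positive system, $\Pi$ its set of simple roots and $W\subset GL(\mathfrak h^*)$ the Weyl group. Let $\Theta\subsetneq\Pi$. Let $\langle\Theta\rangle$ be the set of roots in $\mathbb Z\Theta$, and put $$\mathfrak a_\Theta=\{X\in\mathfrak h\mid \alpha(X)=0\ \ \forall\alpha\in\Theta\},\qquad \mathfrak l_\Theta=\mathfrak h+\sum_{\alpha\in\langle\Theta\rangle}\mathfrak g_\alpha .$$ For $\alpha\in\Delta$ let $\Delta(\alpha)=\{\beta\in\Delta\mid \beta|_{\mathfrak a_\Theta}\in\mathbb R\,\alpha|_{\mathfrak a_\Theta}\}$, a root subsystem with positive system $\Delta(\alpha)\cap\Delta^+$ and simple roots $\Pi(\alpha)$. Let $w^\alpha$ and $w_\Theta$ be the longest elements of the Weyl groups of $\Delta(\alpha)$ and of $\langle\Theta\rangle$ (with respect to the positive systems induced by $\Delta^+$), and put $\sigma_\alpha=w^\alpha w_\Theta$. Call $\alpha\in\Delta$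 *$\Theta$-useful* if $\sigma_\alpha$ has order two, and *$\Theta$-reduced* if $\alpha|_{\mathfrak a_\Theta}\ne0$ and $\Pi(\alpha)=\Theta\cup\{\alpha\}$. Let ${}^u\Delta_\Theta$ be the set of $\Theta$-useful roots and ${}^u\Delta^+_\Theta={}^u\Delta_\Theta\cap\Delta^+$. Put $$\Sigma_\Theta=\{\alpha|_{\mathfrak a_\Theta}\mid\alpha\in\Delta\}\setminus\{0\},\qquad {}^u\Sigma_\Theta=\{\alpha|_{\mathfrak a_\Theta}\mid\alpha\in{}^u\Delta_\Theta\},$$ $$K(\Theta)=\{w\in W\mid w\Theta\subseteq\Pi\},\qquad W(\Theta)=\{w\in W\mid w\Theta=\Theta\},$$ and let $W(\Theta)'$ be the subgroup of $W$ generated by the $\sigma_\alpha$ for $\alpha\in\Delta^+$ that are both $\Theta$-useful and $\Theta$-reduced. Call $\Theta$ *normal* if $\Pi\setminus\Theta\subseteq{}^u\Delta_\Theta^+$. Then the following conditions are equivalent: 1. $\Theta$ is normal; 2. $K(\Theta)=W(\Theta)'$; 3. $K(\Theta)=W(\Theta)$; 4. ${}^u\Sigma_\Theta=\Sigma_\Theta$.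 Moreover, $\Theta$ is normal if and only if any two parabolic subalgebras of $\mathfrak g$ with Levi part $\mathfrak l_\Theta$ are conjugate under an inner automorphism of $\mathfrak g$. Here a parabolic subalgebra is one containing a Borel (that is, maximal solvable) subalgebra; $\mathfrak p$ has Levi part $\mathfrak l$ if $\mathfrak p=\mathfrak l\oplus\mathfrak n$ as vector spaces, where $\mathfrak n=[\mathfrak p,\operatorname{rad}\mathfrak p]$ is the nilpotent radical of $\mathfrak p$; and inner automorphisms are the elements of the group generated by the $\exp(\operatorname{ad}x)$, $x\in\mathfrak g$. -/

import Mathlib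

namespace ReductivePair

noncomputable section

/- Throughout, `g` is a complex Lie algebra, `H` a Cartan subalgebra of `g`, `P` a positive system
of the set of roots of `(g, H)`, and `Θ` a set of simple roots. -/

section Roots

variable {g : Type*} [LieRing g] [LieAlgebra ℂ g] (H : LieSubalgebra ℂ g)

/-- The space `g_α = {X ∈ g | [h, X] = α(h) X for all h ∈ H}`. -/
def rootSubspace (α : Module.Dual ℂ H) : Submodule ℂ g :=
  (LieModule.weightSpace g (α : H → ℂ)).toSubmodule

/-- The set `Δ ⊆ H*` of roots of `(g, H)`. -/
def roots : Set (Module.Dual ℂ H) := {α | α ≠ 0 ∧ rootSubspace H α ≠ ⊥}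

/-- `c` is the coroot of `α`, as an element of `H`: a bracket of an element of `g_α` with an
element of `g_{-α}` on which `α` takes the value `2`. -/
def IsCorootOf (α : Module.Dual ℂ H) (c : H) : Prop :=
  α c = 2 ∧ ∃ x ∈ rootSubspace H α, ∃ y ∈ rootSubspace H (-α), (c : g) = ⁅x, y⁆

/-- `s` is the reflection `s_α : μ ↦ μ - ⟨μ, α^∨⟩ α` of `H*`. -/
def IsReflectionOf (α : Module.Dual ℂ H) (s : Module.Dual ℂ H ≃ₗ[ℂ] Module.Dual ℂ H) : Prop :=
  ∃ c : H, IsCorootOf H α c ∧ ∀ μ : Module.Dual ℂ H, s μ = μ - μ c • α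

/-- The set of the reflections `s_α`, `α ∈ R`. -/
def reflections (R : Set (Module.Dual ℂ H)) :
    Set (Module.Dual ℂ H ≃ₗ[ℂ] Module.Dual ℂ H) :=
  {s | ∃ α ∈ R, IsReflectionOf H α s}

/-- The group generated by the reflections `s_α`, `α ∈ R`: the Weyl group of `R` when `R` is a root
subsystem. -/
def weylGroup (R : Set (Module.Dual ℂ H)) :
    Subgroup (Module.Dual ℂ H ≃ₗ[ℂ] Module.Dual ℂ H) :=
  Subgroup.closure (reflections H R)

variable {H} in
/-- `P` is a positive system of `R`: the set of the roots that are positive on some element of `H`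
at which all roots take nonzero real values. -/
def IsPositiveSystem (R P : Set (Module.Dual ℂ H)) : Prop :=
  ∃ x : H, (∀ α ∈ R, (α x).im = 0 ∧ (α x).re ≠ 0) ∧ P = {α ∈ R | 0 < (α x).re}

variable {H} in
/-- The simple roots of a positive system: the elements that are not sums of two elements of it. -/
def simpleRoots (P : Set (Module.Dual ℂ H)) : Set (Module.Dual ℂ H) :=
  {α ∈ P | ∀ β ∈ P, ∀ γ ∈ P, α ≠ β + γ}

/-- The word length of an element of a group with respect to a set `S` of generators. -/
def wordLength {G : Type*} [Group G] (S : Set G) (w : G) : ℕ :=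
  sInf {n | ∃ l : List G, (∀ s ∈ l, s ∈ S) ∧ l.prod = w ∧ l.length = n}

/-- For a root subsystem `R`: the longest element of the Weyl group of `R`, the length being taken
with respect to the simple reflections of the positive system `R ∩ P` of `R`. -/
def longestElement (P R : Set (Module.Dual ℂ H)) : Module.Dual ℂ H ≃ₗ[ℂ] Module.Dual ℂ H :=
  Classical.epsilon fun w => w ∈ weylGroup H R ∧ ∀ v ∈ weylGroup H R,
    wordLength (reflections H (simpleRoots (R ∩ P))) v ≤
      wordLength (reflections H (simpleRoots (R ∩ P))) w

variable {H} in
/-- `a_Θ = {h ∈ H | α(h) = 0 for all α ∈ Θ}`. -/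
def centerLevi (Θ : Set (Module.Dual ℂ H)) : Submodule ℂ H :=
  ⨅ α ∈ Θ, LinearMap.ker α

variable {H} in
/-- The restriction of `α ∈ H*` to `a_Θ`. -/
def restrict (Θ : Set (Module.Dual ℂ H)) (α : Module.Dual ℂ H) :
    Module.Dual ℂ (centerLevi Θ) :=
  α ∘ₗ (centerLevi Θ).subtype

/-- `⟨Θ⟩`: the roots that are integral linear combinations of elements of `Θ`. -/
def rootsOf (Θ : Set (Module.Dual ℂ H)) : Set (Module.Dual ℂ H) :=
  {α ∈ roots H | α ∈ AddSubgroup.closure Θ}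

/-- `Δ(α)`: the roots whose restriction to `a_Θ` is a real multiple of that of `α`. -/
def rootsAlong (Θ : Set (Module.Dual ℂ H)) (α : Module.Dual ℂ H) : Set (Module.Dual ℂ H) :=
  {β ∈ roots H | ∃ c : ℝ, restrict Θ β = (c : ℂ) • restrict Θ α}

/-- `σ_α = w^α w_Θ`, where `w^α` and `w_Θ` are the longest elements of the Weyl groups of `Δ(α)`
and of `⟨Θ⟩`. -/
def sigma (P Θ : Set (Module.Dual ℂ H)) (α : Module.Dual ℂ H) :
    Module.Dual ℂ H ≃ₗ[ℂ] Module.Dual ℂ H :=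
  longestElement H P (rootsAlong H Θ α) * longestElement H P (rootsOf H Θ)

/-- The set `ᵘΔ_Θ` of `Θ`-useful roots. -/
def usefulRoots (P Θ : Set (Module.Dual ℂ H)) : Set (Module.Dual ℂ H) :=
  {α ∈ roots H | orderOf (sigma H P Θ α) = 2}

/-- `α` is `Θ`-reduced: it does not vanish on `a_Θ`, and it is the element of the set of
simple roots of `Δ(α) ∩ P` that is not in `Θ`. -/
def IsReducedRoot (P Θ : Set (Module.Dual ℂ H)) (α : Module.Dual ℂ H) : Prop :=
  restrict Θ α ≠ 0 ∧ simpleRoots (rootsAlong H Θ α ∩ P) = insert α Θ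

/-- The set of positive, `Θ`-useful, `Θ`-reduced roots. -/
def usefulReducedPosRoots (P Θ : Set (Module.Dual ℂ H)) : Set (Module.Dual ℂ H) :=
  {α ∈ usefulRoots H P Θ ∩ P | IsReducedRoot H P Θ α}

/-- `W(Θ)'`: the group generated by the `σ_α`, for `α` positive, `Θ`-useful and `Θ`-reduced. -/
def reflectionPart (P Θ : Set (Module.Dual ℂ H)) :
    Subgroup (Module.Dual ℂ H ≃ₗ[ℂ] Module.Dual ℂ H) :=
  Subgroup.closure (sigma H P Θ '' usefulReducedPosRoots H P Θ)

/-- `W(Θ) = {w ∈ W | wΘ = Θ}`. -/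
def stabilizerSet (Θ : Set (Module.Dual ℂ H)) :
    Set (Module.Dual ℂ H ≃ₗ[ℂ] Module.Dual ℂ H) :=
  {w | w ∈ weylGroup H (roots H) ∧ w '' Θ = Θ}

/-- `K(Θ) = {w ∈ W | wΘ ⊆ Π}`, where `Π` is the set of simple roots. -/
def simpleTransporter (P Θ : Set (Module.Dual ℂ H)) :
    Set (Module.Dual ℂ H ≃ₗ[ℂ] Module.Dual ℂ H) :=
  {w | w ∈ weylGroup H (roots H) ∧ w '' Θ ⊆ simpleRoots P}

/-- `Σ_Θ`: the nonzero restrictions of roots to `a_Θ`. -/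
def restrictedRoots (Θ : Set (Module.Dual ℂ H)) : Set (Module.Dual ℂ (centerLevi Θ)) :=
  restrict Θ '' roots H \ {0}

/-- `ᵘΣ_Θ`: the restrictions of `Θ`-useful roots to `a_Θ`. -/
def usefulRestrictedRoots (P Θ : Set (Module.Dual ℂ H)) :
    Set (Module.Dual ℂ (centerLevi Θ)) :=
  restrict Θ '' usefulRoots H P Θ

/-- `Θ` is normal: every simple root outside `Θ` is a (positive) `Θ`-useful root. -/
def IsNormal (P Θ : Set (Module.Dual ℂ H)) : Prop :=
  simpleRoots P \ Θ ⊆ usefulRoots H P Θ ∩ P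

/-- `l_Θ = H + ∑_{α ∈ ⟨Θ⟩} g_α`. -/
def leviPart (Θ : Set (Module.Dual ℂ H)) : Submodule ℂ g :=
  H.toSubmodule ⊔ ⨆ α ∈ rootsOf H Θ, rootSubspace H α

end Roots

section Parabolic

variable {g : Type*} [LieRing g] [LieAlgebra ℂ g]

/-- A parabolic subalgebra: a subalgebra that contains a Borel subalgebra, that is, a maximal
solvable subalgebra. -/
def IsParabolic (p : LieSubalgebra ℂ g) : Prop :=
  ∃ b : LieSubalgebra ℂ g,
    Maximal (fun s : LieSubalgebra ℂ g => LieAlgebra.IsSolvable s) b ∧ b ≤ p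

/-- The nilpotent radical `[p, rad p]` of `p`, as a subspace of `g`. -/
def nilpotentRadical (p : LieSubalgebra ℂ g) : Submodule ℂ g :=
  (⁅(⊤ : LieIdeal ℂ p), LieAlgebra.radical ℂ p⁆ : LieIdeal ℂ p).toSubmodule.map
    p.toSubmodule.subtype

/-- `l` is a Levi part of `p`: `p` is the direct sum of `l` and the nilpotent radical of `p`. -/
def HasLeviPart (p : LieSubalgebra ℂ g) (l : Submodule ℂ g) : Prop :=
  l ⊔ nilpotentRadical p = p.toSubmodule ∧ Disjoint l (nilpotentRadical p)

/-- `φ = exp (ad x) = ∑ (ad x)ⁿ / n!`; the convergence is tested on all linear forms, which for a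
finite-dimensional `g` is convergence in `g`. -/
def IsExpAd (x : g) (φ : g ≃ₗ[ℂ] g) : Prop :=
  ∀ (y : g) (f : Module.Dual ℂ g),
    HasSum (fun n : ℕ => (n.factorial : ℂ)⁻¹ * f (((LieAlgebra.ad ℂ g x) ^ n) y)) (f (φ y))

variable (g) in
/-- The group of inner automorphisms of `g`: the subgroup of `GL(g)` generated by the `exp (ad x)`,
`x ∈ g`. -/
def innerAutomorphisms : Subgroup (g ≃ₗ[ℂ] g) :=
  Subgroup.closure {φ | ∃ x : g, IsExpAd x φ}

end Parabolic

end

end ReductivePair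

open ReductivePair

/-! Combinatorial part. If `α` is a root outside the span of `Θ`, the simple roots of `Δ(α)` are `Θ`
and one further root `γ`. Each longest element sends the simple roots of its subsystem to negatives
of simple roots, so `σ_α` maps `Θ` into `Θ ∪ {γ}`, and it is an involution exactly when it preserves
`Θ` (`orderOf_sig_eq_two_iff`). For `α` simple outside `Θ`, `γ = α` and `σ_α` lies in `K(Θ)`; hence
`K(Θ) = W(Θ)` implies normality.

Conversely, let `Θ` be normal and `w ≠ 1` in `K(Θ)`. Some simple `α` has `wα` negative, necessarily
`α ∉ Θ`, and `wσ_α` lies in `K(Θ)` again with fewer inversions. Induction writes `w` as a product of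
the `σ_α` (`mem_closure_sig`), so `K(Θ) = W(Θ)' = W(Θ)`. For an arbitrary root `β` outside the span
of `Θ`, some Weyl element moves the simple roots of `Δ(β)` into the simple roots
(`exists_map_simple_along`). It lies in `K(Θ)`, so it stabilizes `Θ` and conjugates `σ_β` to some
`σ_α` with `α` simple: all such `β` are useful. In the other direction, `σ_α` depends only on the
restriction of `α`, so equality of restricted root sets gives normality.

Lie-theoretic part. The root system is that of `g` modulo its centre, pulled back to `H`; this works
because the centre meets `[g, g]` trivially. A parabolic subalgebra containing `H` is determined by
a parabolic set of roots `S`, and its Levi part is `l_Θ` exactly when `S ∩ -S = ⟨Θ⟩`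
(`hasLeviPart_iff`). If `Θ` is normal, every such `S` is a Weyl translate of the standard one
(`IsParabolicSet.exists_eq_map_std`), and Weyl elements lift to inner automorphisms, so the
parabolics are conjugate.

For the converse, take `α` simple outside `Θ` and `σ = σ_α`. The standard parabolic of `Θ` and the
`σ⁻¹`-translate of the standard parabolic of `σΘ` have the same Levi part. If they are conjugate,
two standard parabolics are conjugate and therefore equal (`eq_of_map_eq`), whence `σΘ = Θ`. The
equality comes from a highest weight argument: a subspace of codimension `d` is encoded by the
determinant of `d` linear forms that cut it out; for a standard parabolic this multilinear form is
an eigenvector of the Borel subalgebra, and in the `g`-stable space that it generates every other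
eigenvalue of the defining element `x` has larger real part. Conjugate standard parabolics give
forms that generate each other, hence are proportional. -/

namespace ReductivePair

open Module

/-! ### Indecomposable elements and abstract root data -/

section Indecomposable

variable {V : Type*} [AddCommGroup V]

/-- The elements of `P` that are not sums of two elements of `P`. -/
def indecomposables (P : Set V) : Set V := {α ∈ P | ∀ β ∈ P, ∀ γ ∈ P, α ≠ β + γ}

lemma mem_indecomposables_of_subset {P Q : Set V} (h : Q ⊆ P) {α : V}
    (hα : α ∈ indecomposables P) (hQ : α ∈ Q) : α ∈ indecomposables Q :=
  ⟨hQ, fun β hβ γ hγ => hα.2 β (h hβ) γ (h hγ)⟩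

end Indecomposable

/-- A finite reduced crystallographic root system in a complex vector space, possibly not spanning
it, with a real linear form that does not vanish on any root. -/
structure RootData (V : Type*) [AddCommGroup V] [Module ℂ V] where
  /-- the set of roots -/
  Φ : Set V
  finite : Φ.Finite
  /-- the coroot of a root, as a linear form -/
  co : V → Dual ℂ V
  co_self : ∀ α ∈ Φ, co α α = 2
  exists_int : ∀ α ∈ Φ, ∀ β ∈ Φ, ∃ n : ℤ, co α β = n
  sub_smul_mem : ∀ α ∈ Φ, ∀ β ∈ Φ, β - co α β • α ∈ Φ
  eq_one_or_neg_one : ∀ α ∈ Φ, ∀ c : ℂ, c • α ∈ Φ → c = 1 ∨ c = -1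
  sub_mem : ∀ α ∈ Φ, ∀ β ∈ Φ, α ≠ β → ∀ n : ℤ, co α β = n → 0 < n → β - α ∈ Φ
  separating : ∀ v ∈ Submodule.span ℂ Φ, (∀ γ ∈ Φ, co γ v = 0) → v = 0
  -- With `(u, v) = ∑ ⟨u, γ^∨⟩⟨v, γ^∨⟩`, this says that the coroot of `α` is `2(α, ·)/(α, α)`; it
  -- makes the reflections isometries.
  co_mul_form : ∀ α ∈ Φ, ∀ v, co α v * ∑ γ ∈ finite.toFinset, co γ α * co γ α =
    2 * ∑ γ ∈ finite.toFinset, co γ α * co γ v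
  /-- the real form that defines the positive roots -/
  ht : V →ₗ[ℝ] ℝ
  ht_ne_zero : ∀ α ∈ Φ, ht α ≠ 0

namespace RootData

variable {V : Type*} [AddCommGroup V] [Module ℂ V] (D : RootData V)

/-! ### Reflections and the canonical invariant form -/

section Reflections

open Classical in
/-- The reflection in a root. -/
noncomputable def refl (α : V) : V ≃ₗ[ℂ] V :=
  if h : D.co α α = 2 then Module.reflection h else 1

variable {D}

lemma refl_apply {α : V} (hα : α ∈ D.Φ) (v : V) : D.refl α v = v - D.co α v • α := by
  rw [refl, dif_pos (D.co_self α hα), Module.reflection_apply]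

lemma refl_self {α : V} (hα : α ∈ D.Φ) : D.refl α α = -α := by
  rw [refl_apply hα, D.co_self α hα, two_smul]; abel

lemma refl_refl {α : V} (hα : α ∈ D.Φ) (v : V) : D.refl α (D.refl α v) = v := by
  simp only [refl_apply hα, map_sub, map_smul, D.co_self α hα, smul_eq_mul]
  module

lemma refl_mul_self {α : V} (hα : α ∈ D.Φ) : D.refl α * D.refl α = 1 :=
  LinearEquiv.ext (refl_refl hα)

lemma refl_inv {α : V} (hα : α ∈ D.Φ) : (D.refl α)⁻¹ = D.refl α :=
  inv_eq_of_mul_eq_one_left (refl_mul_self hα)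

lemma refl_mem {α β : V} (hα : α ∈ D.Φ) (hβ : β ∈ D.Φ) : D.refl α β ∈ D.Φ := by
  rw [refl_apply hα]; exact D.sub_smul_mem α hα β hβ

lemma neg_mem {α : V} (hα : α ∈ D.Φ) : -α ∈ D.Φ := by
  rw [← refl_self hα]; exact refl_mem hα hα

lemma neg_mem_iff {α : V} : -α ∈ D.Φ ↔ α ∈ D.Φ :=
  ⟨fun h => by simpa using neg_mem h, neg_mem⟩

variable (D) in
open Classical in
/-- The integral pairing of two roots. -/
noncomputable def n (α β : V) : ℤ := if h : ∃ n : ℤ, D.co α β = n then h.choose else 0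

lemma co_eq {α β : V} (hα : α ∈ D.Φ) (hβ : β ∈ D.Φ) : D.co α β = D.n α β := by
  have h := D.exists_int α hα β hβ
  rw [n, dif_pos h]; exact h.choose_spec

variable (D) in
/-- The canonical invariant form. -/
noncomputable def form : V →ₗ[ℂ] V →ₗ[ℂ] ℂ :=
  ∑ γ ∈ D.finite.toFinset, (D.co γ).smulRight (D.co γ)

lemma form_apply (u v : V) :
    D.form u v = ∑ γ ∈ D.finite.toFinset, D.co γ u * D.co γ v := by
  simp [form]

lemma form_comm (u v : V) : D.form u v = D.form v u := by
  simp [form_apply, mul_comm]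

lemma co_mul {α : V} (hα : α ∈ D.Φ) (v : V) : D.co α v * D.form α α = 2 * D.form α v := by
  simpa [form_apply] using D.co_mul_form α hα v

lemma form_refl {α : V} (hα : α ∈ D.Φ) (u v : V) :
    D.form (D.refl α u) (D.refl α v) = D.form u v := by
  have h1 := co_mul hα u
  have h2 := co_mul hα v
  simp only [refl_apply hα, map_sub, map_smul, LinearMap.sub_apply, LinearMap.smul_apply,
    smul_eq_mul, form_comm u α]
  linear_combination (-(D.co α v) / 2) * h1 * (-1) + (D.co α u / 2) * h2

variable (D) in
/-- The canonical form on roots. -/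
noncomputable def intForm (α β : V) : ℤ := ∑ γ ∈ D.finite.toFinset, D.n γ α * D.n γ β

lemma form_eq {α β : V} (hα : α ∈ D.Φ) (hβ : β ∈ D.Φ) : D.form α β = D.intForm α β := by
  rw [form_apply, intForm, Int.cast_sum]
  refine Finset.sum_congr rfl fun γ hγ => ?_
  have hγ' : γ ∈ D.Φ := by simpa using hγ
  rw [co_eq hγ' hα, co_eq hγ' hβ, Int.cast_mul]

/-- The form is a sum of squares of integers, and the term of `α` itself is 4. -/
lemma intForm_self_pos {α : V} (hα : α ∈ D.Φ) : 0 < D.intForm α α := by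
  refine Finset.sum_pos' (fun γ _ => mul_self_nonneg _) ⟨α, by simpa using hα, ?_⟩
  have : (D.n α α : ℂ) = 2 := by rw [← co_eq hα hα, D.co_self α hα]
  have : D.n α α = 2 := by exact_mod_cast this
  rw [this]; norm_num

lemma n_mul {α β : V} (hα : α ∈ D.Φ) (hβ : β ∈ D.Φ) :
    D.n α β * D.intForm α α = 2 * D.intForm α β := by
  have := co_mul hα β
  rw [co_eq hα hβ, form_eq hα hα, form_eq hα hβ] at this
  exact_mod_cast this

lemma intForm_nonpos {α β : V} (hα : α ∈ D.Φ) (hβ : β ∈ D.Φ) (h : D.n α β ≤ 0) :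
    D.intForm α β ≤ 0 := by
  have h1 := n_mul hα hβ
  have h2 := intForm_self_pos hα
  nlinarith

end Reflections

/-! ### Weyl groups of subsystems -/

section WeylGroup

variable (A B : AddSubgroup V)

/-- The Weyl group of the subsystem `Φ ∩ A`. -/
def W : Subgroup (V ≃ₗ[ℂ] V) := Subgroup.closure (D.refl '' (D.Φ ∩ A))

variable {D A B}

lemma W_mono (h : A ≤ B) : D.W A ≤ D.W B :=
  Subgroup.closure_mono (Set.image_mono fun _ hx => ⟨hx.1, h hx.2⟩)

lemma W_le_top : D.W A ≤ D.W ⊤ := W_mono le_top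

lemma refl_mem_W {α : V} (hα : α ∈ D.Φ) (hA : α ∈ A) : D.refl α ∈ D.W A :=
  Subgroup.subset_closure ⟨α, ⟨hα, hA⟩, rfl⟩

/-- A property of elements that is multiplicative and holds for the reflections in the roots of a
set holds in the group that they generate. -/
lemma closure_refl_induction {R : Set V} (hR : R ⊆ D.Φ) {p : (V ≃ₗ[ℂ] V) → Prop} (one : p 1)
    (mul : ∀ α ∈ R, ∀ w, p w → p (D.refl α * w)) {w : V ≃ₗ[ℂ] V}
    (hw : w ∈ Subgroup.closure (D.refl '' R)) : p w := by
  induction hw using Subgroup.closure_induction_left with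
  | one => exact one
  | mul_left x hx y _ hy =>
    obtain ⟨α, hα, rfl⟩ := hx
    exact mul α hα _ hy
  | inv_mul_cancel x hx y _ hy =>
    obtain ⟨α, hα, rfl⟩ := hx
    rw [refl_inv (hR hα)]
    exact mul α hα _ hy

lemma W_induction {p : (V ≃ₗ[ℂ] V) → Prop} (one : p 1)
    (mul : ∀ α ∈ D.Φ, α ∈ A → ∀ w, p w → p (D.refl α * w)) {w : V ≃ₗ[ℂ] V} (hw : w ∈ D.W A) :
    p w :=
  closure_refl_induction Set.inter_subset_left one (fun α hα => mul α hα.1 hα.2) hw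

lemma map_mem {w : V ≃ₗ[ℂ] V} (hw : w ∈ D.W A) {β : V} (hβ : β ∈ D.Φ) : w β ∈ D.Φ := by
  exact W_induction (p := fun w => w β ∈ D.Φ) hβ (fun α hα _ w hw => refl_mem hα hw) hw

lemma map_mem_iff {w : V ≃ₗ[ℂ] V} (hw : w ∈ D.W A) {β : V} : w β ∈ D.Φ ↔ β ∈ D.Φ :=
  ⟨fun h => by simpa using map_mem ((D.W A).inv_mem hw) h, map_mem hw⟩

lemma map_sub_mem {w : V ≃ₗ[ℂ] V} (hw : w ∈ D.W A) {β : V} (hβ : β ∈ D.Φ) : w β - β ∈ A := by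
  suffices h : w β ∈ D.Φ ∧ w β - β ∈ A from h.2
  refine W_induction (p := fun w => w β ∈ D.Φ ∧ w β - β ∈ A) (by simpa using hβ) ?_ hw
  intro α hα hA w hw
  refine ⟨refl_mem hα hw.1, ?_⟩
  have : (D.refl α * w) β - β = w β - β - D.n α (w β) • α := by
    rw [LinearEquiv.mul_apply, refl_apply hα, co_eq hα hw.1, Int.cast_smul_eq_zsmul]
    abel
  rw [this]
  exact A.sub_mem hw.2 (A.zsmul_mem hA _)

lemma map_mem_sub {w : V ≃ₗ[ℂ] V} (hw : w ∈ D.W A) {β : V} (hβ : β ∈ D.Φ) (hAB : A ≤ B) :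
    w β ∈ B ↔ β ∈ B := by
  have h := hAB (map_sub_mem hw hβ)
  constructor
  · intro h'; simpa using B.sub_mem h' h
  · intro h'; simpa using B.add_mem h h'

lemma form_map {w : V ≃ₗ[ℂ] V} (hw : w ∈ D.W A) (u v : V) : D.form (w u) (w v) = D.form u v := by
  exact W_induction (p := fun w => D.form (w u) (w v) = D.form u v) rfl
    (fun α hα _ w hw => (form_refl hα _ _).trans hw) hw

lemma form_self_ne_zero {α : V} (hα : α ∈ D.Φ) : D.form α α ≠ 0 := by
  rw [form_eq hα hα]; exact_mod_cast (intForm_self_pos hα).ne'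

/-- The coroot is determined by the invariant form, which the Weyl group preserves; equivariance of
coroots is therefore not an axiom of `RootData`. -/
lemma co_map {w : V ≃ₗ[ℂ] V} (hw : w ∈ D.W A) {α : V} (hα : α ∈ D.Φ) (v : V) :
    D.co (w α) (w v) = D.co α v := by
  have h1 := co_mul (map_mem hw hα) (w v)
  rw [form_map hw, form_map hw, ← co_mul hα] at h1
  exact mul_right_cancel₀ (form_self_ne_zero hα) h1

lemma refl_conj {w : V ≃ₗ[ℂ] V} (hw : w ∈ D.W A) {α : V} (hα : α ∈ D.Φ) :
    w * D.refl α = D.refl (w α) * w := by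
  ext v
  rw [LinearEquiv.mul_apply, LinearEquiv.mul_apply, refl_apply hα, refl_apply (map_mem hw hα),
    co_map hw hα, map_sub, map_smul]

end WeylGroup

/-! ### Positive systems and simple roots -/

section Positive

variable (A B : AddSubgroup V)

/-- The positive roots of the subsystem `Φ ∩ A`. -/
def pos : Set V := {α ∈ D.Φ ∩ A | 0 < D.ht α}

/-- The simple roots of the subsystem `Φ ∩ A`. -/
def simple : Set V := indecomposables (D.pos A)

variable {D A B}

lemma simple_subset_pos : D.simple A ⊆ D.pos A := fun _ h => h.1

lemma pos_mono (h : A ≤ B) : D.pos A ⊆ D.pos B := fun _ hx => ⟨⟨hx.1.1, h hx.1.2⟩, hx.2⟩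

lemma pos_finite : (D.pos A).Finite := D.finite.subset fun _ h => h.1.1

lemma simple_finite : (D.simple A).Finite := pos_finite.subset simple_subset_pos

lemma simple_subset_Φ : D.simple A ⊆ D.Φ := fun _ h => h.1.1.1

lemma mem_pos_of_mem {α : V} (h : α ∈ D.pos B) (hA : α ∈ A) : α ∈ D.pos A := ⟨⟨h.1.1, hA⟩, h.2⟩

lemma neg_notMem_pos {α : V} (h : α ∈ D.pos A) : -α ∉ D.pos B := by
  intro h'
  have h1 := h'.2
  rw [map_neg] at h1
  linarith [h.2]

lemma mem_pos_or {α : V} (hα : α ∈ D.Φ) (hA : α ∈ A) : α ∈ D.pos A ∨ -α ∈ D.pos A := by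
  rcases (D.ht_ne_zero α hα).lt_or_gt with h | h
  · exact Or.inr ⟨⟨neg_mem hα, A.neg_mem hA⟩, by simpa using h⟩
  · exact Or.inl ⟨⟨hα, hA⟩, h⟩

lemma pos_induction {p : V → Prop} (simple : ∀ α ∈ D.simple A, p α)
    (add : ∀ β ∈ D.pos A, ∀ γ ∈ D.pos A, β + γ ∈ D.pos A → p β → p γ → p (β + γ))
    {α : V} (hα : α ∈ D.pos A) : p α := by
  -- Heights are real numbers, so the induction runs over the number of positive roots of smaller
  -- height.
  have key : ∀ k : ℕ, ∀ α ∈ D.pos A, {β ∈ D.pos A | D.ht β < D.ht α}.ncard = k → p α := by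
    intro k
    induction k using Nat.strong_induction_on with
    | _ k ih =>
      intro α hα hk
      by_cases hs : α ∈ D.simple A
      · exact simple α hs
      · have : ∃ β ∈ D.pos A, ∃ γ ∈ D.pos A, α = β + γ := by
          by_contra! h
          exact hs ⟨hα, h⟩
        obtain ⟨β, hβ, γ, hγ, rfl⟩ := this
        have lt : ∀ δ ∈ D.pos A, D.ht δ < D.ht (β + γ) → p δ := by
          intro δ hδ hlt
          refine ih _ ?_ δ hδ rfl
          rw [← hk]
          refine Set.ncard_lt_ncard ?_ (pos_finite.subset fun _ h => h.1)
          refine ⟨fun x hx => ⟨hx.1, hx.2.trans hlt⟩, fun h => ?_⟩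
          exact lt_irrefl _ (h ⟨hδ, hlt⟩).2
        refine add β hβ γ hγ hα (lt β hβ ?_) (lt γ hγ ?_)
        · rw [map_add]; linarith [hγ.2]
        · rw [map_add]; linarith [hβ.2]
  exact key _ α hα rfl

lemma mem_closure_simple {α : V} (hα : α ∈ D.pos A) : α ∈ AddSubmonoid.closure (D.simple A) := by
  exact pos_induction (p := (· ∈ AddSubmonoid.closure (D.simple A)))
    (fun _ h => AddSubmonoid.subset_closure h)
    (fun β _ γ _ _ h1 h2 => add_mem h1 h2) hα

/-- Otherwise `β - α` would be a root; whichever of it and its negative is positive decomposes `β`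
or `α`. -/
lemma n_nonpos {α β : V} (hα : α ∈ D.simple A) (hβ : β ∈ D.simple A) (hne : α ≠ β) :
    D.n α β ≤ 0 := by
  by_contra! h
  have hα' := simple_subset_Φ hα
  have hβ' := simple_subset_Φ hβ
  have hm := D.sub_mem α hα' β hβ' hne _ (co_eq hα' hβ') h
  rcases mem_pos_or (A := A) hm (A.sub_mem hβ.1.1.2 hα.1.1.2) with h1 | h1
  · exact hβ.2 _ hα.1 _ h1 (by abel)
  · exact hα.2 _ hβ.1 _ h1 (by abel)

/-- Split `a = p - q` into positive and negative parts. The vectors `∑ p i • i` and `∑ q i • i` have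
the same pairings with all coroots, so the squared norm of the first is `∑ p i q j (i, j)`, which is
at most 0 because distinct simple roots have nonpositive product. Hence the first vector vanishes,
and its height, a sum of nonnegative terms, forces `p = 0`. Applied also to `-a`, this gives `a =
0`. -/
lemma eq_zero_of_forall_sum_eq_zero (a : V → ℝ)
    (h : ∀ γ ∈ D.Φ, ∑ i ∈ (simple_finite (D := D) (A := A)).toFinset, a i * D.n γ i = 0) :
    ∀ i ∈ D.simple A, a i ≤ 0 := by
  set S := (simple_finite (D := D) (A := A)).toFinset with hS
  have memS : ∀ i, i ∈ S ↔ i ∈ D.simple A := fun i => by simp [hS]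
  let F := D.finite.toFinset
  have memF : ∀ i, i ∈ F ↔ i ∈ D.Φ := fun i => by simp [F]
  let p : V → ℝ := fun i => max (a i) 0
  let q : V → ℝ := fun i => max (-a i) 0
  have hpq : ∀ i, p i - q i = a i := fun i => by
    simp only [p, q]
    rcases le_total (a i) 0 with h | h
    · rw [max_eq_right h, max_eq_left (by linarith)]; ring
    · rw [max_eq_left h, max_eq_right (by linarith)]; ring
  have hpq0 : ∀ i, p i * q i = 0 := fun i => by
    simp only [p, q]
    rcases le_total (a i) 0 with h | h
    · rw [max_eq_right h]; ring
    · rw [max_eq_right (a := -a i) (by linarith)]; ring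
  have hp0 : ∀ i, 0 ≤ p i := fun i => le_max_right _ _
  have hq0 : ∀ i, 0 ≤ q i := fun i => le_max_right _ _
  have heq : ∀ γ ∈ F, ∑ i ∈ S, p i * D.n γ i = ∑ i ∈ S, q i * D.n γ i := by
    intro γ hγ
    rw [← sub_eq_zero, ← Finset.sum_sub_distrib, ← h γ ((memF γ).1 hγ)]
    exact Finset.sum_congr rfl fun i _ => by rw [← hpq i]; ring
  have hsq : ∑ γ ∈ F, (∑ i ∈ S, p i * D.n γ i) ^ 2 ≤ 0 := by
    have h1 : ∑ γ ∈ F, (∑ i ∈ S, p i * (D.n γ i : ℝ)) ^ 2 =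
        ∑ i ∈ S, ∑ j ∈ S, p i * q j * (D.intForm i j : ℝ) := by
      calc _ = ∑ γ ∈ F, ∑ i ∈ S, ∑ j ∈ S, (p i * (D.n γ i : ℝ)) * (q j * (D.n γ j : ℝ)) := by
            refine Finset.sum_congr rfl fun γ hγ => ?_
            rw [sq]
            nth_rewrite 2 [heq γ hγ]
            rw [Finset.sum_mul_sum]
        _ = _ := by
            rw [Finset.sum_comm]
            refine Finset.sum_congr rfl fun i _ => ?_
            rw [Finset.sum_comm]
            refine Finset.sum_congr rfl fun j _ => ?_
            rw [intForm, Int.cast_sum, Finset.mul_sum]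
            refine Finset.sum_congr rfl fun γ _ => ?_
            push_cast; ring
    rw [h1]
    refine Finset.sum_nonpos fun i hi => Finset.sum_nonpos fun j hj => ?_
    by_cases hij : i = j
    · subst hij; rw [hpq0, zero_mul]
    · have hi' := (memS i).1 hi
      have hj' := (memS j).1 hj
      have := intForm_nonpos (simple_subset_Φ hi') (simple_subset_Φ hj') (n_nonpos hi' hj' hij)
      exact mul_nonpos_of_nonneg_of_nonpos (mul_nonneg (hp0 i) (hq0 j)) (by exact_mod_cast this)
  have hzero : ∀ γ ∈ F, ∑ i ∈ S, p i * (D.n γ i : ℝ) = 0 := by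
    have := (Finset.sum_eq_zero_iff_of_nonneg fun γ _ => sq_nonneg _).1
      (le_antisymm hsq (Finset.sum_nonneg fun γ _ => sq_nonneg _))
    exact fun γ hγ => by simpa using this γ hγ
  have hv : ∑ i ∈ S, (p i : ℂ) • i = 0 := by
    refine D.separating _ (Submodule.sum_mem _ fun i hi => Submodule.smul_mem _ _
      (Submodule.subset_span (simple_subset_Φ ((memS i).1 hi)))) fun γ hγ => ?_
    have := hzero γ ((memF γ).2 hγ)
    rw [map_sum]
    calc _ = ((∑ i ∈ S, p i * (D.n γ i : ℝ) : ℝ) : ℂ) := by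
          push_cast
          refine Finset.sum_congr rfl fun i hi => ?_
          rw [map_smul, smul_eq_mul, co_eq hγ (simple_subset_Φ ((memS i).1 hi))]
      _ = 0 := by rw [this]; simp
  have hht : ∑ i ∈ S, p i * D.ht i = 0 := by
    have := congrArg D.ht hv
    rw [map_sum, map_zero] at this
    rw [← this]
    exact Finset.sum_congr rfl fun i _ => by
      rw [Complex.coe_smul, map_smul, smul_eq_mul]
  have h0 := (Finset.sum_eq_zero_iff_of_nonneg fun i hi =>
    mul_nonneg (hp0 i) ((memS i).1 hi).1.2.le).1 hht
  intro i hi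
  have h1 := h0 i ((memS i).2 hi)
  have h2 : p i = 0 := (mul_eq_zero.1 h1).resolve_right hi.1.2.ne'
  exact max_eq_right_iff.1 h2

/-- The pairings of roots are integers, so the real and imaginary parts of a linear relation can be
treated separately. -/
lemma simple_linearIndepOn : LinearIndepOn ℂ id (D.simple A) := by
  have hS : D.simple A = ((simple_finite (D := D) (A := A)).toFinset : Set V) := by simp
  rw [hS, linearIndepOn_finset_iff]
  intro g hg i hi
  have hi' : i ∈ D.simple A := by simpa using hi
  have key : ∀ γ ∈ D.Φ, ∑ i ∈ (simple_finite (D := D) (A := A)).toFinset, g i * D.n γ i = 0 := by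
    intro γ hγ
    have := congrArg (D.co γ) hg
    rw [map_sum, map_zero] at this
    rw [← this]
    refine Finset.sum_congr rfl fun i hi => ?_
    rw [map_smul, smul_eq_mul, id, co_eq hγ (simple_subset_Φ (by simpa using hi))]
  have hre : ∀ γ ∈ D.Φ, ∑ i ∈ (simple_finite (D := D) (A := A)).toFinset,
      (g i).re * D.n γ i = 0 := fun γ hγ => by
    simpa using congrArg Complex.re (key γ hγ)
  have him : ∀ γ ∈ D.Φ, ∑ i ∈ (simple_finite (D := D) (A := A)).toFinset,
      (g i).im * D.n γ i = 0 := fun γ hγ => by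
    simpa using congrArg Complex.im (key γ hγ)
  have h1 := eq_zero_of_forall_sum_eq_zero _ hre i hi'
  have h2 := eq_zero_of_forall_sum_eq_zero _ him i hi'
  have h3 := eq_zero_of_forall_sum_eq_zero (fun i => -(g i).re)
    (fun γ hγ => by simpa using hre γ hγ) i hi'
  have h4 := eq_zero_of_forall_sum_eq_zero (fun i => -(g i).im)
    (fun γ hγ => by simpa using him γ hγ) i hi'
  exact Complex.ext (by simp; linarith) (by simp; linarith)

lemma exists_functional (c : V → ℂ) : ∃ f : Dual ℂ V, ∀ α ∈ D.simple A, f α = c α := by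
  have h := (simple_linearIndepOn (D := D) (A := A))
  let b := Basis.extend h
  refine ⟨b.constr ℂ fun i => c i, fun α hα => ?_⟩
  have : b ⟨α, h.subset_extend _ hα⟩ = α := Basis.extend_apply_self h _
  conv_lhs => rw [← this]
  rw [Basis.constr_basis]

/-- The level with respect to a set `T` of simple roots: the sum of the coefficients at the simple
roots outside `T`. -/
lemma exists_level {T : Set V} (hT : T ⊆ D.simple A) :
    ∃ f : Dual ℂ V, (∀ t ∈ Submodule.span ℂ T, f t = 0) ∧ (∀ α ∈ D.simple A, α ∉ T → f α = 1) ∧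
      ∀ z ∈ AddSubmonoid.closure (D.simple A),
        ∃ k : ℕ, f z = k ∧ (k = 0 → z ∈ AddSubmonoid.closure T) := by
  classical
  obtain ⟨f, hf⟩ := exists_functional (D := D) (A := A) fun α => if α ∈ T then 0 else 1
  refine ⟨f, ?_, fun α hα hαT => by simp [hf α hα, hαT], ?_⟩
  · have : Submodule.span ℂ T ≤ LinearMap.ker f :=
      Submodule.span_le.2 fun t ht => by simp [hf t (hT ht), ht]
    exact fun t ht => this ht
  · intro z hz
    induction hz using AddSubmonoid.closure_induction with
    | mem z hz =>
      by_cases hzT : z ∈ T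
      · exact ⟨0, by simp [hf z hz, hzT], fun _ => AddSubmonoid.subset_closure hzT⟩
      · exact ⟨1, by simp [hf z hz, hzT], by simp⟩
    | zero => exact ⟨0, by simp, fun _ => zero_mem _⟩
    | add z w _ _ hz hw =>
      obtain ⟨k, hk, hk'⟩ := hz
      obtain ⟨l, hl, hl'⟩ := hw
      refine ⟨k + l, by simp [hk, hl], fun h0 => ?_⟩
      exact add_mem (hk' (by omega)) (hl' (by omega))

/-- If a sum of two nonnegative combinations of simple roots lies in the span of a set of simple
roots, then so does each summand. -/
lemma mem_closure_of_add_mem_span {T : Set V} (hT : T ⊆ D.simple A) {x y : V}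
    (hx : x ∈ AddSubmonoid.closure (D.simple A)) (hy : y ∈ AddSubmonoid.closure (D.simple A))
    (h : x + y ∈ Submodule.span ℂ T) : x ∈ AddSubmonoid.closure T := by
  obtain ⟨f, hf0, -, key⟩ := exists_level hT
  have h0 := hf0 _ h
  obtain ⟨k, hk, hk'⟩ := key x hx
  obtain ⟨l, hl, -⟩ := key y hy
  rw [map_add, hk, hl] at h0
  have : k + l = 0 := by exact_mod_cast h0
  exact hk' (by omega)

lemma closure_le_span {T : Set V} {x : V} (hx : x ∈ AddSubmonoid.closure T) :
    x ∈ Submodule.span ℂ T := by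
  induction hx using AddSubmonoid.closure_induction with
  | mem z hz => exact Submodule.subset_span hz
  | zero => exact zero_mem _
  | add z w _ _ hz hw => exact add_mem hz hw

lemma mem_of_mem_span {T : Set V} (hT : T ⊆ D.simple A) {α : V} (hα : α ∈ D.simple A)
    (h : α ∈ Submodule.span ℂ T) : α ∈ T := by
  by_contra hT'
  obtain ⟨f, hf0, hf1, -⟩ := exists_level hT
  simpa [hf1 α hα hT'] using hf0 α h

lemma refl_mem_pos {α β : V} (hα : α ∈ D.simple A) (hβ : β ∈ D.pos A) (hne : β ≠ α) :
    D.refl α β ∈ D.pos A := by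
  have hα' := simple_subset_Φ hα
  have hm : D.refl α β ∈ D.Φ := refl_mem hα' hβ.1.1
  have hmA : D.refl α β ∈ A := (map_mem_sub (refl_mem_W hα' hα.1.1.2) hβ.1.1 le_rfl).2 hβ.1.2
  refine (mem_pos_or hm hmA).resolve_right fun h => ?_
  -- If `s_α β` were negative, `β` and `-s_α β` would be nonnegative combinations of simple roots
  -- with sum a multiple of `α`; then `β` is itself a multiple of `α`.
  have h1 := mem_closure_of_add_mem_span (T := {α}) (by simpa using hα) (mem_closure_simple hβ)
    (mem_closure_simple h) (by
      rw [refl_apply hα', Submodule.mem_span_singleton]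
      exact ⟨D.co α β, by abel⟩)
  obtain ⟨c, rfl⟩ := Submodule.mem_span_singleton.1 (closure_le_span h1)
  rcases D.eq_one_or_neg_one α hα' c hβ.1.1 with rfl | rfl
  · simp at hne
  · rw [neg_one_smul] at hβ
    exact neg_notMem_pos hα.1 hβ

/-- An abstract positive system of `Φ ∩ A` is conjugate to the standard one, by a product of simple
reflections. -/
lemma exists_conj (Q : Set V) (hQ : Q ⊆ D.Φ ∩ A)
    (hadd : ∀ β ∈ Q, ∀ γ ∈ Q, β + γ ∈ D.Φ → β + γ ∈ Q)
    (htot : ∀ α ∈ D.Φ, α ∈ A → α ∈ Q ∨ -α ∈ Q) (hneg : ∀ α ∈ Q, -α ∉ Q) :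
    ∃ w ∈ Subgroup.closure (D.refl '' D.simple A), w '' D.pos A = Q := by
  generalize hk : (D.pos A \ Q).ncard = k
  induction k using Nat.strong_induction_on generalizing Q with
  | _ k ih =>
    by_cases hs : D.simple A ⊆ Q
    · refine ⟨1, one_mem _, ?_⟩
      have hsub : D.pos A ⊆ Q := by
        intro α hα
        exact pos_induction (p := (· ∈ Q)) (fun _ h => hs h)
          (fun β _ γ _ h h1 h2 => hadd _ h1 _ h2 h.1.1) hα
      have : D.pos A = Q := hsub.antisymm fun α hα =>
        (mem_pos_or (hQ hα).1 (hQ hα).2).resolve_right fun h => hneg α hα (hsub h)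
      simp [this]
    -- Since `s_α` permutes the positive roots other than `α`, and `-α ∈ Q`, the set `s_α Q` misses
    -- fewer positive roots than `Q`.
    · obtain ⟨α, hα, hαQ⟩ := Set.not_subset.1 hs
      have hα' := simple_subset_Φ hα
      have hnα : -α ∈ Q := (htot α hα' hα.1.1.2).resolve_left hαQ
      have hmem : ∀ β, β ∈ D.refl α '' Q ↔ D.refl α β ∈ Q := fun β =>
        ⟨by rintro ⟨γ, hγ, rfl⟩; rwa [refl_refl hα'], fun h => ⟨_, h, refl_refl hα' β⟩⟩
      have hA : ∀ β ∈ D.Φ, D.refl α β ∈ A ↔ β ∈ A := fun β hβ =>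
        map_mem_sub (refl_mem_W hα' hα.1.1.2) hβ le_rfl
      have key : ∃ w ∈ Subgroup.closure (D.refl '' D.simple A), w '' D.pos A = D.refl α '' Q := by
        refine ih (D.pos A \ (D.refl α '' Q)).ncard ?_ (D.refl α '' Q) ?_ ?_ ?_ ?_ rfl
        · rw [← hk, ← Set.ncard_image_of_injective _ (D.refl α).injective]
          refine Set.ncard_lt_ncard ⟨?_, ?_⟩ (pos_finite.subset Set.sdiff_subset)
          · rintro - ⟨β, ⟨hβ, hβ'⟩, rfl⟩
            rw [hmem] at hβ'
            refine ⟨refl_mem_pos hα hβ ?_, hβ'⟩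
            rintro rfl
            rw [refl_self hα'] at hβ'
            exact hβ' hnα
          · intro h
            obtain ⟨β, ⟨hβ, -⟩, hβα⟩ := h ⟨hα.1, hαQ⟩
            have : β = -α := by rw [← refl_refl hα' β, hβα, refl_self hα']
            rw [this] at hβ
            exact neg_notMem_pos hα.1 hβ
        · rintro - ⟨β, hβ, rfl⟩
          exact ⟨refl_mem hα' (hQ hβ).1, (hA β (hQ hβ).1).2 (hQ hβ).2⟩
        · intro β hβ γ hγ h
          rw [hmem] at hβ hγ ⊢
          rw [map_add]
          exact hadd _ hβ _ hγ (by rw [← map_add]; exact refl_mem hα' h)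
        · intro β hβ hβA
          rw [hmem, hmem, map_neg]
          exact htot _ (refl_mem hα' hβ) ((hA β hβ).2 hβA)
        · intro β hβ hβ'
          rw [hmem] at hβ hβ'
          rw [map_neg] at hβ'
          exact hneg _ hβ hβ'
      obtain ⟨w, hw, hwQ⟩ := key
      refine ⟨D.refl α * w, mul_mem (Subgroup.subset_closure ⟨α, hα, rfl⟩) hw, ?_⟩
      have : (⇑(D.refl α * w) : V → V) = D.refl α ∘ w := rfl
      rw [this, Set.image_comp, hwQ, ← Set.image_comp]
      have hid : (D.refl α : V → V) ∘ D.refl α = id := funext (refl_refl hα')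
      rw [hid, Set.image_id]

/-- Otherwise `(x, α) ≤ 0` for every nonnegative combination `x` of simple roots, in particular for
`x = α`. -/
lemma exists_simple_n_pos {α : V} (hα : α ∈ D.pos A) : ∃ β ∈ D.simple A, 0 < D.n β α := by
  by_contra! h
  have key : ∀ x ∈ AddSubmonoid.closure (D.simple A), ∃ r : ℝ, r ≤ 0 ∧ D.form x α = r := by
    intro x hx
    induction hx using AddSubmonoid.closure_induction with
    | mem β hβ =>
      have := intForm_nonpos (simple_subset_Φ hβ) hα.1.1 (h β hβ)
      exact ⟨D.intForm β α, by exact_mod_cast this, by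
        rw [form_eq (simple_subset_Φ hβ) hα.1.1]; simp⟩
    | zero => exact ⟨0, le_rfl, by simp⟩
    | add x y _ _ hx hy =>
      obtain ⟨r, hr, hr'⟩ := hx
      obtain ⟨s, hs, hs'⟩ := hy
      exact ⟨r + s, by linarith, by simp [hr', hs']⟩
  obtain ⟨r, hr, hr'⟩ := key α (mem_closure_simple hα)
  rw [form_eq hα.1.1 hα.1.1] at hr'
  have h1 : (D.intForm α α : ℝ) = r := by exact_mod_cast hr'
  have h2 : (0 : ℝ) < D.intForm α α := by exact_mod_cast intForm_self_pos hα.1.1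
  linarith

lemma closure_simple_le : Subgroup.closure (D.refl '' D.simple A) ≤ D.W A :=
  Subgroup.closure_mono (Set.image_mono fun _ h => h.1.1)

/-- A simple `β` with positive pairing lowers the height of `α`, and `s_α` is conjugate under `s_β`
to the reflection in the lower root. -/
lemma refl_mem_closure_simple {α : V} (hα : α ∈ D.pos A) :
    D.refl α ∈ Subgroup.closure (D.refl '' D.simple A) := by
  have key : ∀ k : ℕ, ∀ α ∈ D.pos A, {β ∈ D.pos A | D.ht β < D.ht α}.ncard = k →
      D.refl α ∈ Subgroup.closure (D.refl '' D.simple A) := by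
    intro k
    induction k using Nat.strong_induction_on with
    | _ k ih =>
      intro α hα hk
      by_cases hs : α ∈ D.simple A
      · exact Subgroup.subset_closure ⟨α, hs, rfl⟩
      obtain ⟨β, hβ, hn⟩ := exists_simple_n_pos hα
      have hβ' := simple_subset_Φ hβ
      have hp := refl_mem_pos hβ hα (by rintro rfl; exact hs hβ)
      have hlt : D.ht (D.refl β α) < D.ht α := by
        rw [refl_apply hβ', co_eq hβ' hα.1.1, Int.cast_smul_eq_zsmul, map_sub, map_zsmul,
          zsmul_eq_mul]
        have : (0 : ℝ) < D.n β α := by exact_mod_cast hn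
        nlinarith [hβ.1.2]
      have hmem : D.refl β ∈ Subgroup.closure (D.refl '' D.simple A) :=
        Subgroup.subset_closure ⟨β, hβ, rfl⟩
      have := ih _ ?_ _ hp rfl
      · have h1 := refl_conj (closure_simple_le hmem) hp.1.1
        rw [refl_refl hβ'] at h1
        have h2 : D.refl α = D.refl β * D.refl (D.refl β α) * (D.refl β)⁻¹ :=
          eq_mul_inv_of_mul_eq h1.symm
        rw [h2]
        exact mul_mem (mul_mem hmem this) (inv_mem hmem)
      · rw [← hk]
        refine Set.ncard_lt_ncard ?_ (pos_finite.subset fun _ h => h.1)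
        exact ⟨fun x hx => ⟨hx.1, hx.2.trans hlt⟩, fun h => lt_irrefl _ (h ⟨hp, hlt⟩).2⟩
  exact key _ α hα rfl

lemma refl_neg {α : V} (hα : α ∈ D.Φ) : D.refl (-α) = D.refl α := by
  have h := refl_conj (refl_mem_W (A := ⊤) hα trivial) hα
  rw [refl_self hα] at h
  exact (mul_right_cancel h).symm

lemma closure_simple_eq : Subgroup.closure (D.refl '' D.simple A) = D.W A := by
  refine le_antisymm closure_simple_le ((Subgroup.closure_le _).2 ?_)
  rintro - ⟨α, ⟨hα, hA⟩, rfl⟩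
  rcases mem_pos_or hα hA with h | h
  · exact refl_mem_closure_simple h
  · rw [← refl_neg hα]; exact refl_mem_closure_simple h

lemma W_simple_induction {p : (V ≃ₗ[ℂ] V) → Prop} (one : p 1)
    (mul : ∀ α ∈ D.simple A, ∀ w, p w → p (D.refl α * w)) {w : V ≃ₗ[ℂ] V} (hw : w ∈ D.W A) :
    p w := by
  rw [← closure_simple_eq] at hw
  exact closure_refl_induction simple_subset_Φ one mul hw

end Positive

end RootData

end ReductivePair


namespace ReductivePair

open Module

namespace RootData

variable {V : Type*} [AddCommGroup V] [Module ℂ V] {D : RootData V}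

/-! ### Length, inversions and longest elements -/

section Length

variable {A B : AddSubgroup V}

lemma map_mem_pos_or {w : V ≃ₗ[ℂ] V} (hw : w ∈ D.W A) {α : V} (hα : α ∈ D.pos A) :
    w α ∈ D.pos A ∨ -w α ∈ D.pos A :=
  mem_pos_or (map_mem hw hα.1.1) ((map_mem_sub hw hα.1.1 le_rfl).2 hα.1.2)

/-- The exchange condition. -/
lemma exchange (l : List V) (hl : ∀ β ∈ l, β ∈ D.simple A) {α : V} (hα : α ∈ D.simple A)
    (h : -(l.map D.refl).prod α ∈ D.pos A) :
    ∃ l' : List V, (∀ β ∈ l', β ∈ D.simple A) ∧ l'.length + 1 = l.length ∧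
      (l.map D.refl).prod * D.refl α = (l'.map D.refl).prod := by
  induction l with
  | nil => exact absurd h (neg_notMem_pos hα.1)
  | cons β t ih =>
    have ht : ∀ γ ∈ t, γ ∈ D.simple A := fun γ hγ => hl γ (List.mem_cons_of_mem _ hγ)
    have hβ : β ∈ D.simple A := hl β List.mem_cons_self
    have hu : (t.map D.refl).prod ∈ D.W A := by
      refine Subgroup.list_prod_mem _ fun x hx => ?_
      obtain ⟨γ, hγ, rfl⟩ := List.mem_map.1 hx
      exact refl_mem_W (simple_subset_Φ (ht γ hγ)) (ht γ hγ).1.1.2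
    set u := (t.map D.refl).prod
    rw [List.map_cons, List.prod_cons] at h ⊢
    -- If `uα` is positive while `s_β uα` is negative, then `uα = β`, so `u s_α = s_β u` and the
    -- letter `β` cancels. Otherwise the sign already changes inside `u`.
    rcases map_mem_pos_or hu hα.1 with h1 | h1
    · refine ⟨t, ht, rfl, ?_⟩
      have : u α = β := by
        by_contra hne
        exact neg_notMem_pos (refl_mem_pos hβ h1 hne) h
      rw [mul_assoc, refl_conj hu (simple_subset_Φ hα), this, ← mul_assoc,
        refl_mul_self (simple_subset_Φ hβ), one_mul]
    · obtain ⟨l', hl', hlen, heq⟩ := ih ht h1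
      refine ⟨β :: l', ?_, by simp [hlen], ?_⟩
      · intro γ hγ
        rcases List.mem_cons.1 hγ with rfl | hγ
        exacts [hβ, hl' γ hγ]
      · rw [mul_assoc, heq, List.map_cons, List.prod_cons]

lemma exists_word {w : V ≃ₗ[ℂ] V} (hw : w ∈ D.W A) :
    ∃ l : List V, (∀ β ∈ l, β ∈ D.simple A) ∧ (l.map D.refl).prod = w := by
  refine W_simple_induction (p := fun w => ∃ l : List V, (∀ β ∈ l, β ∈ D.simple A) ∧
    (l.map D.refl).prod = w) ⟨[], by simp, rfl⟩ ?_ hw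
  rintro α hα w ⟨l, hl, rfl⟩
  exact ⟨α :: l, by simpa using ⟨hα, hl⟩, by simp⟩

/-- An element of the Weyl group that preserves positivity is trivial. -/
lemma eq_one_of_map_pos {w : V ≃ₗ[ℂ] V} (hw : w ∈ D.W A)
    (h : ∀ α ∈ D.simple A, w α ∈ D.pos A) : w = 1 := by
  classical
  have hex : ∃ k, ∃ l : List V, (∀ β ∈ l, β ∈ D.simple A) ∧ (l.map D.refl).prod = w ∧
      l.length = k := by
    obtain ⟨l, hl, hlw⟩ := exists_word hw
    exact ⟨_, l, hl, hlw, rfl⟩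
  -- A shortest word cannot end in a letter `α`: as `wα` is positive, the rest of the word makes `α`
  -- negative, and the exchange condition yields a shorter word.
  obtain ⟨l, hl, hlw, hlen⟩ := Nat.find_spec hex
  rcases List.eq_nil_or_concat l with rfl | ⟨t, α, rfl⟩
  · simpa using hlw.symm
  · exfalso
    have hα : α ∈ D.simple A := hl α (by simp)
    have ht : ∀ β ∈ t, β ∈ D.simple A := fun β hβ => hl β (by simp [hβ])
    have hw' : (t.map D.refl).prod * D.refl α = w := by rw [← hlw]; simp
    have h1 := h α hα
    rw [← hw', LinearEquiv.mul_apply, refl_self (simple_subset_Φ hα), map_neg] at h1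
    obtain ⟨l', hl', hlen', heq⟩ := exchange t ht hα h1
    have := Nat.find_min' hex ⟨l', hl', heq.symm.trans hw', rfl⟩
    rw [← hlen] at this
    simp at this
    omega

variable (D A) in
/-- The positive roots that `w` makes negative. -/
def inv (w : V ≃ₗ[ℂ] V) : Set V := {β ∈ D.pos A | -w β ∈ D.pos A}

lemma inv_finite (w : V ≃ₗ[ℂ] V) : (D.inv A w).Finite := pos_finite.subset fun _ h => h.1

/-- The reflection `s_α` maps the inversions of `w` other than `α` bijectively onto those of `w
s_α`. -/
lemma ncard_inv_mul_refl {w : V ≃ₗ[ℂ] V} {α : V} (hα : α ∈ D.simple A)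
    (h : -w α ∈ D.pos A) : (D.inv A (w * D.refl α)).ncard + 1 = (D.inv A w).ncard := by
  have hα' := simple_subset_Φ hα
  have h1 : D.inv A (w * D.refl α) = D.refl α '' (D.inv A w \ {α}) := by
    ext β
    constructor
    · rintro ⟨hβ, hβ'⟩
      have hne : β ≠ α := by
        rintro rfl
        rw [LinearEquiv.mul_apply, refl_self hα', map_neg, neg_neg] at hβ'
        exact neg_notMem_pos hβ' h
      refine ⟨D.refl α β, ⟨⟨refl_mem_pos hα hβ hne, hβ'⟩, ?_⟩, refl_refl hα' β⟩
      intro (h2 : D.refl α β = α)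
      have : β = -α := by rw [← refl_refl hα' β, h2, refl_self hα']
      rw [this] at hβ
      exact neg_notMem_pos hα.1 hβ
    · rintro ⟨γ, ⟨⟨hγ, hγ'⟩, hne⟩, rfl⟩
      exact ⟨refl_mem_pos hα hγ hne, by rwa [LinearEquiv.mul_apply, refl_refl hα']⟩
  rw [h1, Set.ncard_image_of_injective _ (D.refl α).injective]
  exact Set.ncard_sdiff_singleton_add_one ⟨hα.1, h⟩ (inv_finite w)

lemma ncard_inv_mul_refl_of_pos {w : V ≃ₗ[ℂ] V} {α : V} (hα : α ∈ D.simple A)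
    (h : w α ∈ D.pos A) : (D.inv A (w * D.refl α)).ncard = (D.inv A w).ncard + 1 := by
  have hα' := simple_subset_Φ hα
  have := ncard_inv_mul_refl (w := w * D.refl α) hα (by
    rwa [LinearEquiv.mul_apply, refl_self hα', map_neg, neg_neg])
  rw [mul_assoc, refl_mul_self hα', mul_one] at this
  exact this.symm

lemma exists_simple_neg {w : V ≃ₗ[ℂ] V} (hw : w ∈ D.W A) (h : w ≠ 1) :
    ∃ α ∈ D.simple A, -w α ∈ D.pos A := by
  by_contra! h'
  exact h (eq_one_of_map_pos hw fun α hα => (map_mem_pos_or hw hα.1).resolve_right (h' α hα))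

lemma exists_word_length {w : V ≃ₗ[ℂ] V} (hw : w ∈ D.W A) :
    ∃ l : List V, (∀ β ∈ l, β ∈ D.simple A) ∧ (l.map D.refl).prod = w ∧
      l.length = (D.inv A w).ncard := by
  generalize hk : (D.inv A w).ncard = k
  induction k generalizing w with
  | zero =>
    have : w = 1 := by
      by_contra h
      obtain ⟨α, hα, h1⟩ := exists_simple_neg hw h
      rw [Set.ncard_eq_zero (inv_finite w)] at hk
      have : α ∈ D.inv A w := ⟨hα.1, h1⟩
      rw [hk] at this
      exact this
    exact ⟨[], by simp, by simp [this], rfl⟩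
  | succ k ih =>
    have hne : w ≠ 1 := by
      rintro rfl
      have : D.inv A (1 : V ≃ₗ[ℂ] V) = ∅ :=
        Set.eq_empty_of_forall_notMem fun β hβ => neg_notMem_pos hβ.1 hβ.2
      rw [this, Set.ncard_empty] at hk
      omega
    obtain ⟨α, hα, h1⟩ := exists_simple_neg hw hne
    have hα' := simple_subset_Φ hα
    obtain ⟨l, hl, hlw, hlen⟩ := ih (w := w * D.refl α)
      (mul_mem hw (refl_mem_W hα' hα.1.1.2)) (by have := ncard_inv_mul_refl hα h1; omega)
    refine ⟨l ++ [α], ?_, ?_, by simp [hlen]⟩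
    · intro β hβ
      rcases List.mem_append.1 hβ with h | h
      · exact hl β h
      · rw [List.mem_singleton.1 h]; exact hα
    · rw [List.map_append, List.prod_append, hlw]
      simp [mul_assoc, refl_mul_self hα']

lemma ncard_inv_le_length (l : List V) (hl : ∀ β ∈ l, β ∈ D.simple A) :
    (l.map D.refl).prod ∈ D.W A ∧ (D.inv A (l.map D.refl).prod).ncard ≤ l.length := by
  induction l using List.reverseRecOn with
  | nil =>
    have : D.inv A (1 : V ≃ₗ[ℂ] V) = ∅ :=
      Set.eq_empty_of_forall_notMem fun β hβ => neg_notMem_pos hβ.1 hβ.2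
    simp [this, one_mem]
  | append_singleton t α ih =>
    have hα : α ∈ D.simple A := hl α (by simp)
    obtain ⟨h1, h2⟩ := ih fun β hβ => hl β (by simp [hβ])
    rw [List.map_append, List.prod_append, List.map_singleton, List.prod_singleton,
      List.length_append, List.length_singleton]
    refine ⟨mul_mem h1 (refl_mem_W (simple_subset_Φ hα) hα.1.1.2), ?_⟩
    rcases map_mem_pos_or h1 hα.1 with h | h
    · rw [ncard_inv_mul_refl_of_pos hα h]; omega
    · have := ncard_inv_mul_refl hα h; omega

lemma wordLength_eq {w : V ≃ₗ[ℂ] V} (hw : w ∈ D.W A) :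
    wordLength (D.refl '' D.simple A) w = (D.inv A w).ncard := by
  refine le_antisymm ?_ ?_
  · obtain ⟨l, hl, hlw, hlen⟩ := exists_word_length hw
    refine Nat.sInf_le ⟨l.map D.refl, ?_, hlw, by simpa using hlen⟩
    intro s hs
    obtain ⟨γ, hγ, rfl⟩ := List.mem_map.1 hs
    exact ⟨γ, hl γ hγ, rfl⟩
  -- Since `sInf ∅ = 0`, a word that realizes the infimum is available only once the set of lengths
  -- is known to be nonempty.
  · have hne : {n | ∃ l : List (V ≃ₗ[ℂ] V), (∀ s ∈ l, s ∈ D.refl '' D.simple A) ∧ l.prod = w ∧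
        l.length = n}.Nonempty := by
      obtain ⟨l, hl, hlw⟩ := exists_word hw
      refine ⟨_, l.map D.refl, ?_, hlw, rfl⟩
      intro s hs
      obtain ⟨γ, hγ, rfl⟩ := List.mem_map.1 hs
      exact ⟨γ, hl γ hγ, rfl⟩
    obtain ⟨l, hl, hlw, hlen⟩ := Nat.sInf_mem hne
    have : ∃ l' : List V, (∀ β ∈ l', β ∈ D.simple A) ∧ l'.map D.refl = l := by
      clear hlw hlen
      induction l with
      | nil => exact ⟨[], by simp, rfl⟩
      | cons s t ih =>
        obtain ⟨α, hα, rfl⟩ := hl s List.mem_cons_self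
        obtain ⟨t', ht', rfl⟩ := ih fun s hs => hl s (List.mem_cons_of_mem _ hs)
        exact ⟨α :: t', by simpa using ⟨hα, ht'⟩, rfl⟩
    obtain ⟨l', hl', rfl⟩ := this
    rw [← hlw]
    have h := (ncard_inv_le_length l' hl').2
    rw [hlw] at h ⊢
    rw [wordLength, ← hlen, List.length_map]
    exact h

variable (D A) in
/-- `w` is the element of the Weyl group of `Φ ∩ A` that makes all positive roots negative. -/
def IsLongest (w : V ≃ₗ[ℂ] V) : Prop := w ∈ D.W A ∧ ∀ α ∈ D.pos A, -w α ∈ D.pos A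

/-- The negatives of the positive roots form an abstract positive system, hence a Weyl translate of
the standard one. -/
lemma exists_isLongest : ∃ w, D.IsLongest A w := by
  suffices key : ∃ w ∈ Subgroup.closure (D.refl '' D.simple A),
      w '' D.pos A = {α | -α ∈ D.pos A} by
    obtain ⟨w, hw, h⟩ := key
    refine ⟨w, closure_simple_le hw, fun α hα => ?_⟩
    have : w α ∈ w '' D.pos A := ⟨α, hα, rfl⟩
    rwa [h] at this
  refine exists_conj _ ?_ ?_ ?_ ?_
  · exact fun α hα => ⟨neg_mem_iff.1 hα.1.1, by simpa using A.neg_mem hα.1.2⟩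
  · intro β hβ γ hγ h
    refine ⟨⟨neg_mem h, ?_⟩, ?_⟩
    · have := A.add_mem hβ.1.2 hγ.1.2
      rwa [neg_add]
    · rw [neg_add, map_add]; exact add_pos hβ.2 hγ.2
  · intro α hα hA
    have := mem_pos_or hα hA
    simpa [or_comm] using this
  · intro α hα h
    exact neg_notMem_pos hα h

lemma IsLongest.mul_eq_one {w v : V ≃ₗ[ℂ] V} (h : D.IsLongest A w) (h' : D.IsLongest A v) :
    w * v = 1 := by
  refine eq_one_of_map_pos (mul_mem h.1 h'.1) fun α hα => ?_
  have := h.2 _ (h'.2 _ hα.1)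
  rwa [map_neg, neg_neg] at this

lemma IsLongest.mul_self {w : V ≃ₗ[ℂ] V} (h : D.IsLongest A w) : w * w = 1 := h.mul_eq_one h

lemma IsLongest.unique {w v : V ≃ₗ[ℂ] V} (h : D.IsLongest A w) (h' : D.IsLongest A v) : w = v := by
  rw [← mul_left_inj v, h.mul_eq_one h', h'.mul_self]

lemma IsLongest.apply_apply {w : V ≃ₗ[ℂ] V} (h : D.IsLongest A w) (v : V) : w (w v) = v :=
  congrArg (fun u : V ≃ₗ[ℂ] V => u v) h.mul_self

lemma IsLongest.neg_mem_simple {w : V ≃ₗ[ℂ] V} (h : D.IsLongest A w) {α : V}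
    (hα : α ∈ D.simple A) : -w α ∈ D.simple A := by
  refine ⟨h.2 α hα.1, fun β hβ γ hγ heq => ?_⟩
  refine hα.2 _ (h.2 β hβ) _ (h.2 γ hγ) ?_
  rw [← neg_add, ← map_add, ← heq, map_neg, neg_neg, h.apply_apply]

/-- The elements of maximal length are the longest elements. -/
lemma isLongest_iff {w : V ≃ₗ[ℂ] V} : D.IsLongest A w ↔ w ∈ D.W A ∧ ∀ v ∈ D.W A,
    wordLength (D.refl '' D.simple A) v ≤ wordLength (D.refl '' D.simple A) w := by
  have hle : ∀ v : V ≃ₗ[ℂ] V, (D.inv A v).ncard ≤ (D.pos A).ncard := fun v =>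
    Set.ncard_le_ncard (fun _ h => h.1) pos_finite
  have heq : ∀ v, D.IsLongest A v → D.inv A v = D.pos A := fun v hv =>
    Set.Subset.antisymm (fun _ h => h.1) fun α hα => ⟨hα, hv.2 α hα⟩
  constructor
  · intro h
    refine ⟨h.1, fun v hv => ?_⟩
    rw [wordLength_eq hv, wordLength_eq h.1, heq w h]
    exact hle v
  · rintro ⟨hw, h⟩
    obtain ⟨v, hv⟩ := exists_isLongest (D := D) (A := A)
    have h1 := h v hv.1
    rw [wordLength_eq hv.1, wordLength_eq hw, heq v hv] at h1
    have : D.inv A w = D.pos A := Set.eq_of_subset_of_ncard_le (fun _ h => h.1) h1 pos_finite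
    exact ⟨hw, fun α hα => by rw [← this] at hα; exact hα.2⟩

end Length

end RootData

end ReductivePair


namespace ReductivePair

open Module

namespace RootData

variable {V : Type*} [AddCommGroup V] [Module ℂ V] {D : RootData V}

/-! ### The subsystems `⟨Θ⟩` and `Δ(α)` -/

section Subsystems

/-- The lattice spanned by `Θ`. -/
def levi (Θ : Set V) : AddSubgroup V := AddSubgroup.closure Θ

/-- The vectors that are real multiples of `α` modulo the span of `Θ`. -/
def along (Θ : Set V) (α : V) : AddSubgroup V where
  carrier := {v | ∃ c : ℝ, v - (c : ℂ) • α ∈ Submodule.span ℂ Θ}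
  add_mem' := by
    rintro v w ⟨c, hc⟩ ⟨d, hd⟩
    refine ⟨c + d, ?_⟩
    have : v + w - ((c + d : ℝ) : ℂ) • α = (v - (c : ℂ) • α) + (w - (d : ℂ) • α) := by
      push_cast; module
    rw [this]; exact add_mem hc hd
  zero_mem' := ⟨0, by simp⟩
  neg_mem' := by
    rintro v ⟨c, hc⟩
    refine ⟨-c, ?_⟩
    have : -v - ((-c : ℝ) : ℂ) • α = -(v - (c : ℂ) • α) := by push_cast; module
    rw [this]; exact Submodule.neg_mem _ hc

variable {Θ : Set V} {A B : AddSubgroup V}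

lemma levi_le_span {v : V} (h : v ∈ levi Θ) : v ∈ Submodule.span ℂ Θ := by
  have : levi Θ ≤ (Submodule.span ℂ Θ).toAddSubgroup :=
    (AddSubgroup.closure_le _).2 Submodule.subset_span
  exact this h

lemma mem_along_of_mem_span {α v : V} (h : v ∈ Submodule.span ℂ Θ) : v ∈ along Θ α :=
  ⟨0, by simpa using h⟩

lemma levi_le_along (α : V) : levi Θ ≤ along Θ α :=
  fun _ h => mem_along_of_mem_span (levi_le_span h)

lemma self_mem_along (α : V) : α ∈ along Θ α := ⟨1, by simp⟩

lemma mem_span_insert_of_mem_along {α v : V} (h : v ∈ along Θ α) :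
    v ∈ Submodule.span ℂ (insert α Θ) := by
  obtain ⟨c, hc⟩ := h
  rw [Submodule.mem_span_insert]
  exact ⟨c, _, hc, by abel⟩

lemma along_eq {α γ : V} (h : γ ∈ along Θ α) (hγ : γ ∉ Submodule.span ℂ Θ) :
    along Θ γ = along Θ α := by
  obtain ⟨c, hc⟩ := h
  have hc0 : (c : ℂ) ≠ 0 := by
    intro h0; rw [h0, zero_smul, sub_zero] at hc; exact hγ hc
  ext v
  constructor
  · rintro ⟨d, hd⟩
    refine ⟨d * c, ?_⟩
    have : v - ((d * c : ℝ) : ℂ) • α = (v - (d : ℂ) • γ) + (d : ℂ) • (γ - (c : ℂ) • α) := by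
      push_cast; module
    rw [this]; exact add_mem hd (Submodule.smul_mem _ _ hc)
  · rintro ⟨d, hd⟩
    refine ⟨d * c⁻¹, ?_⟩
    have : v - ((d * c⁻¹ : ℝ) : ℂ) • γ =
        (v - (d : ℂ) • α) - (d * (c : ℂ)⁻¹ : ℂ) • (γ - (c : ℂ) • α) := by
      rw [smul_sub, smul_smul, mul_assoc, inv_mul_cancel₀ hc0, mul_one]
      push_cast; abel
    rw [this]; exact Submodule.sub_mem _ hd (Submodule.smul_mem _ _ hc)

lemma along_eq_of_sub_mem {α β : V} (h : α - β ∈ Submodule.span ℂ Θ)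
    (hα : α ∉ Submodule.span ℂ Θ) : along Θ α = along Θ β :=
  along_eq ⟨1, by simpa using h⟩ hα

lemma mem_simple_of_le (h : A ≤ B) {α : V} (hα : α ∈ D.simple B) (hA : α ∈ A) : α ∈ D.simple A :=
  mem_indecomposables_of_subset (pos_mono h) hα (mem_pos_of_mem hα.1 hA)

/-- The level of `exists_level`, read on roots: it is natural on positive roots, and a root of level
zero is, up to sign, a nonnegative combination of `Θ`, hence in its lattice. -/
lemma exists_level_int (hΘ : Θ ⊆ D.simple A) :
    ∃ f : Dual ℂ V, (∀ t ∈ Submodule.span ℂ Θ, f t = 0) ∧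
      (∀ β ∈ D.pos A, ∃ k : ℕ, f β = k) ∧
      (∀ β ∈ D.Φ, β ∈ A → ∃ k : ℤ, f β = k) ∧
      ∀ β ∈ D.Φ, β ∈ A → f β = 0 → β ∈ levi Θ := by
  obtain ⟨f, hf0, -, hf⟩ := exists_level hΘ
  have hle : ∀ x ∈ AddSubmonoid.closure Θ, x ∈ levi Θ := fun x hx =>
    (AddSubmonoid.closure_le.2 (AddSubgroup.subset_closure (k := Θ)) :
      AddSubmonoid.closure Θ ≤ (levi Θ).toAddSubmonoid) hx
  refine ⟨f, hf0, fun β hβ => ?_, fun β hβ hA => ?_, fun β hβ hA h0 => ?_⟩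
  · obtain ⟨k, hk, -⟩ := hf β (mem_closure_simple hβ)
    exact ⟨k, hk⟩
  · rcases mem_pos_or hβ hA with h | h
    · obtain ⟨k, hk, -⟩ := hf β (mem_closure_simple h)
      exact ⟨k, by simpa using hk⟩
    · obtain ⟨k, hk, -⟩ := hf _ (mem_closure_simple h)
      exact ⟨-k, by rw [map_neg, neg_eq_iff_eq_neg] at hk; simpa using hk⟩
  · rcases mem_pos_or hβ hA with h | h
    · obtain ⟨k, hk, hk'⟩ := hf β (mem_closure_simple h)
      exact hle _ (hk' (by rw [h0] at hk; exact_mod_cast hk.symm))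
    · obtain ⟨k, hk, hk'⟩ := hf _ (mem_closure_simple h)
      have := hle _ (hk' (by rw [map_neg, h0, neg_zero] at hk; exact_mod_cast hk.symm))
      simpa using (levi Θ).neg_mem this

lemma mem_levi_of_mem_span (hΘ : Θ ⊆ D.simple ⊤) {β : V} (hβ : β ∈ D.Φ)
    (h : β ∈ Submodule.span ℂ Θ) : β ∈ levi Θ := by
  obtain ⟨f, hf0, -, -, hf⟩ := exists_level_int hΘ
  exact hf β hβ trivial (hf0 β h)

lemma subset_simple (hΘ : Θ ⊆ D.simple ⊤) (hA : levi Θ ≤ A) : Θ ⊆ D.simple A :=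
  fun _ h => mem_simple_of_le le_top (hΘ h) (hA (AddSubgroup.subset_closure h))

lemma simple_levi (hΘ : Θ ⊆ D.simple ⊤) : D.simple (levi Θ) = Θ :=
  Set.Subset.antisymm (fun _ h => mem_of_mem_span (subset_simple hΘ le_rfl) h
    (levi_le_span h.1.1.2)) (subset_simple hΘ le_rfl)

/-- Modulo the span of `Θ`, the subsystem `Δ(α)` lies on a single line, so by linear independence at
most one of its simple roots is outside `Θ`. -/
lemma simple_along (hΘ : Θ ⊆ D.simple ⊤) {α γ : V} (hγ : γ ∈ D.simple (along Θ α))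
    (hγΘ : γ ∉ Θ) : D.simple (along Θ α) = insert γ Θ ∧ γ ∉ Submodule.span ℂ Θ ∧
      along Θ γ = along Θ α := by
  have hsub := subset_simple hΘ (levi_le_along α)
  have hγs : γ ∉ Submodule.span ℂ Θ := fun h => hγΘ (mem_of_mem_span hsub hγ h)
  have heq := along_eq hγ.1.1.2 hγs
  have hins : insert γ Θ ⊆ D.simple (along Θ α) := Set.insert_subset hγ hsub
  refine ⟨Set.Subset.antisymm (fun δ hδ => ?_) hins, hγs, heq⟩
  refine mem_of_mem_span hins hδ (mem_span_insert_of_mem_along ?_)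
  rw [heq]; exact hδ.1.1.2

/-- Without a simple root outside `Θ`, all of `Δ(α)`, including `α`, would lie in the span of `Θ`.
-/
lemma exists_simple_along (hΘ : Θ ⊆ D.simple ⊤) {α : V} (hα : α ∈ D.Φ)
    (hαΘ : α ∉ Submodule.span ℂ Θ) : ∃ γ ∈ D.simple (along Θ α),
      D.simple (along Θ α) = insert γ Θ ∧ γ ∉ Submodule.span ℂ Θ ∧ along Θ γ = along Θ α := by
  by_contra! h
  have hsub : D.simple (along Θ α) ⊆ Θ := fun γ hγ => by
    by_contra hγΘ
    obtain ⟨h1, h2, h3⟩ := simple_along hΘ hγ hγΘ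
    exact h γ hγ h1 h2 h3
  have hspan : ∀ β ∈ D.pos (along Θ α), β ∈ Submodule.span ℂ Θ := fun β hβ =>
    Submodule.span_mono hsub (closure_le_span (mem_closure_simple hβ))
  rcases mem_pos_or hα (self_mem_along (Θ := Θ) α) with h1 | h1
  · exact hαΘ (hspan _ h1)
  · exact hαΘ (by simpa using Submodule.neg_mem _ (hspan _ h1))

lemma notMem_span_of_simple (hΘ : Θ ⊆ D.simple ⊤) {α : V} (hα : α ∈ D.simple ⊤) (hαΘ : α ∉ Θ) :
    α ∉ Submodule.span ℂ Θ := fun h => hαΘ (mem_of_mem_span hΘ hα h)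

lemma simple_along_of_simple (hΘ : Θ ⊆ D.simple ⊤) {α : V} (hα : α ∈ D.simple ⊤) (hαΘ : α ∉ Θ) :
    D.simple (along Θ α) = insert α Θ :=
  (simple_along hΘ (mem_simple_of_le le_top hα (self_mem_along α)) hαΘ).1

/-- The Weyl group of a subsystem spanned by simple roots permutes the other positive roots. -/
lemma map_mem_pos_of_notMem (hs : D.simple A ⊆ D.simple B) {w : V ≃ₗ[ℂ] V}
    (hw : w ∈ D.W A) {β : V} (hβ : β ∈ D.pos B) (hβA : β ∉ A) : w β ∈ D.pos B := by
  refine (W_simple_induction (p := fun w => w β ∈ D.pos B ∧ w β ∉ A) ⟨hβ, hβA⟩ ?_ hw).1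
  rintro α hα w ⟨h1, h2⟩
  refine ⟨refl_mem_pos (hs hα) h1 ?_, fun h => h2 ?_⟩
  · rintro h; exact h2 (h ▸ hα.1.1.2)
  · exact (map_mem_sub (refl_mem_W hα.1.1.1 hα.1.1.2) h1.1.1 le_rfl).1 h

lemma map_mem_pos_of_simple {w : V ≃ₗ[ℂ] V} (hw : w ∈ D.W ⊤)
    (h : ∀ α ∈ D.simple A, w α ∈ D.pos B) {β : V} (hβ : β ∈ D.pos A) : w β ∈ D.pos B := by
  refine pos_induction (p := fun β => w β ∈ D.pos B) h ?_ hβ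
  intro β _ γ _ hβγ h1 h2
  rw [map_add]
  refine ⟨⟨?_, B.add_mem h1.1.2 h2.1.2⟩, ?_⟩
  · rw [← map_add]; exact map_mem hw hβγ.1.1
  · rw [map_add]; exact add_pos h1.2 h2.2

lemma IsLongest.conj {w u : V ≃ₗ[ℂ] V} (hw : w ∈ D.W ⊤) (h : w '' D.simple A = D.simple B)
    (hu : D.IsLongest A u) : D.IsLongest B (w * u * w⁻¹) := by
  have hAB : ∀ α ∈ D.simple A, w α ∈ D.pos B := fun α hα => by
    have : w α ∈ w '' D.simple A := ⟨α, hα, rfl⟩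
    rw [h] at this; exact this.1
  have hBA : ∀ β ∈ D.simple B, w⁻¹ β ∈ D.pos A := fun β hβ => by
    rw [← h] at hβ
    obtain ⟨α, hα, rfl⟩ := hβ
    have : w⁻¹ (w α) = α := w.symm_apply_apply α
    rw [this]; exact hα.1
  refine ⟨?_, fun β hβ => ?_⟩
  · refine W_simple_induction (p := fun u => w * u * w⁻¹ ∈ D.W B) (by simp [one_mem]) ?_ hu.1
    intro α hα v hv
    have h1 := hAB α hα
    have : w * (D.refl α * v) * w⁻¹ = D.refl (w α) * (w * v * w⁻¹) := by
      rw [← mul_assoc, refl_conj hw hα.1.1.1]; simp only [mul_assoc]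
    rw [this]
    exact mul_mem (refl_mem_W h1.1.1 h1.1.2) hv
  · have h1 := hu.2 _ (map_mem_pos_of_simple (inv_mem hw) hBA hβ)
    have h2 := map_mem_pos_of_simple hw hAB h1
    rwa [map_neg] at h2

lemma IsLongest.congr {u : V ≃ₗ[ℂ] V} (h : D.Φ ∩ A = D.Φ ∩ B) (hu : D.IsLongest A u) :
    D.IsLongest B u := by
  simpa only [IsLongest, W, pos, h] using hu

end Subsystems

/-! ### The elements `σ_α` -/

section Sigma

variable (D) in
/-- The longest element of the Weyl group of `Φ ∩ A`. -/
noncomputable def longest (A : AddSubgroup V) : V ≃ₗ[ℂ] V :=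
  (exists_isLongest (D := D) (A := A)).choose

lemma isLongest_longest (A : AddSubgroup V) : D.IsLongest A (D.longest A) :=
  (exists_isLongest (D := D) (A := A)).choose_spec

variable (D) in
/-- The element `σ_α`. -/
noncomputable def sig (Θ : Set V) (α : V) : V ≃ₗ[ℂ] V :=
  D.longest (along Θ α) * D.longest (levi Θ)

variable {Θ : Set V} (hΘ : Θ ⊆ D.simple ⊤)

lemma sig_congr {α β : V} (h : along Θ α = along Θ β) : D.sig Θ α = D.sig Θ β := by
  rw [sig, sig, h]

lemma sig_mem (α : V) : D.sig Θ α ∈ D.W (along Θ α) :=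
  mul_mem (isLongest_longest _).1 (W_mono (levi_le_along α) (isLongest_longest _).1)

include hΘ in
-- Here `Δ(α) = ⟨Θ⟩`, so the two longest elements coincide. Consequently a root that vanishes on
-- `a_Θ` is never useful.
lemma sig_eq_one {α : V} (hα : α ∈ Submodule.span ℂ Θ) : D.sig Θ α = 1 := by
  refine ((isLongest_longest (along Θ α)).congr ?_).mul_eq_one (isLongest_longest (levi Θ))
  ext β
  refine ⟨fun h => ⟨h.1, mem_levi_of_mem_span hΘ h.1 ?_⟩, fun h => ⟨h.1, levi_le_along α h.2⟩⟩
  have := mem_span_insert_of_mem_along h.2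
  rwa [Submodule.span_insert_eq_span hα] at this

include hΘ in
-- Both longest elements carry simple roots of their subsystems to negatives of simple roots, and
-- `Θ` is simple in both.
lemma sig_mem_simple {α θ : V} (hθ : θ ∈ Θ) : D.sig Θ α θ ∈ D.simple (along Θ α) := by
  have h1 := (isLongest_longest (D := D) (levi Θ)).neg_mem_simple (α := θ)
    (by rwa [simple_levi hΘ])
  rw [simple_levi hΘ] at h1
  have h2 := (isLongest_longest (D := D) (along Θ α)).neg_mem_simple
    (subset_simple hΘ (levi_le_along α) h1)
  rwa [map_neg, neg_neg] at h2

include hΘ in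
lemma longest_levi_mem_pos {α γ : V} (hγ : γ ∈ D.pos (along Θ α))
    (hγΘ : γ ∉ Submodule.span ℂ Θ) : D.longest (levi Θ) γ ∈ D.pos (along Θ α) :=
  map_mem_pos_of_notMem
    ((simple_levi hΘ).trans_subset (subset_simple hΘ (levi_le_along α)))
    (isLongest_longest _).1 hγ fun h => hγΘ (levi_le_span h)

include hΘ in
-- The element `w_Θ` keeps a positive root outside `⟨Θ⟩` positive; then `w^α` makes it negative.
lemma neg_sig_mem_pos {α γ : V} (hγ : γ ∈ D.pos (along Θ α))
    (hγΘ : γ ∉ Submodule.span ℂ Θ) : -D.sig Θ α γ ∈ D.pos (along Θ α) :=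
  (isLongest_longest _).2 _ (longest_levi_mem_pos hΘ hγ hγΘ)

include hΘ in
lemma sig_ne_one {α : V} (hα : α ∈ D.Φ) (hαΘ : α ∉ Submodule.span ℂ Θ) : D.sig Θ α ≠ 1 := by
  intro h
  obtain ⟨γ, hγ, -, hγΘ, -⟩ := exists_simple_along hΘ hα hαΘ
  have := neg_sig_mem_pos hΘ hγ.1 hγΘ
  rw [h] at this
  exact neg_notMem_pos hγ.1 this

include hΘ in
/-- `σ_α` is an involution if and only if it preserves `Θ`. -/
lemma orderOf_sig_eq_two_iff {α : V} (hα : α ∈ D.Φ) (hαΘ : α ∉ Submodule.span ℂ Θ) :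
    orderOf (D.sig Θ α) = 2 ↔ D.sig Θ α '' Θ = Θ := by
  have hfin : Θ.Finite := simple_finite.subset hΘ
  have ha := isLongest_longest (D := D) (along Θ α)
  have hb := isLongest_longest (D := D) (levi Θ)
  have hne := sig_ne_one hΘ hα hαΘ
  have hmem := fun θ (hθ : θ ∈ Θ) => sig_mem_simple hΘ (α := α) hθ
  obtain ⟨γ, hγ, hs, hγΘ, -⟩ := exists_simple_along hΘ hα hαΘ
  have hbγ := longest_levi_mem_pos hΘ hγ.1 hγΘ
  rw [sig] at *
  set a := D.longest (along Θ α)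
  set b := D.longest (levi Θ)
  have hnb : ∀ θ ∈ Θ, -b θ ∈ Θ := fun θ hθ => by
    have := hb.neg_mem_simple (α := θ) (by rwa [simple_levi hΘ])
    rwa [simple_levi hΘ] at this
  constructor
  · intro h
    have hsq : (a * b) * (a * b) = 1 := by rw [← sq, ← h]; exact pow_orderOf_eq_one _
    have hcomm : a * b = b * a := by
      have h1 : a * b = (a * b)⁻¹ := eq_inv_of_mul_eq_one_left hsq
      rw [h1, mul_inv_rev, inv_eq_of_mul_eq_one_left ha.mul_self,
        inv_eq_of_mul_eq_one_left hb.mul_self]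
    have hsub : (a * b) '' Θ ⊆ Θ := by
      rintro - ⟨θ, hθ, rfl⟩
      have h1 := hmem θ hθ
      rw [hs] at h1
      -- An involution `ab` means that `a` and `b` commute. If `σθ` were the extra simple root `γ`,
      -- then `aθ = bγ` would be positive, although `a` makes `θ` negative.
      refine h1.resolve_left fun h2 => ?_
      rw [hcomm] at h2
      have h3 : a θ = b γ := by rw [← h2]; exact (hb.apply_apply _).symm
      rw [← h3] at hbγ
      exact neg_notMem_pos hbγ (ha.2 θ (subset_simple hΘ (levi_le_along α) hθ).1)
    exact Set.eq_of_subset_of_ncard_le hsub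
      (Set.ncard_image_of_injective _ (a * b).injective).ge hfin
  · intro h
    have haΘ : ∀ θ ∈ Θ, -a θ ∈ Θ := fun θ hθ => by
      have h1 : (a * b) (-b θ) ∈ (a * b) '' Θ := ⟨_, hnb θ hθ, rfl⟩
      rw [h] at h1
      have h2 : (a * b) (-b θ) = -a θ := by
        rw [map_neg, LinearEquiv.mul_apply, hb.apply_apply]
      rwa [h2] at h1
    have hlev : ∀ θ ∈ D.simple (levi Θ), -a θ ∈ D.pos (levi Θ) := fun θ hθ => by
      rw [simple_levi hΘ] at hθ
      have := haΘ θ hθ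
      rw [← simple_levi (D := D) hΘ] at this
      exact this.1
    have haW := W_le_top ha.1
    have hpos : ∀ β ∈ D.pos (levi Θ), -a β ∈ D.pos (levi Θ) := fun β hβ => by
      refine pos_induction (p := fun β => -a β ∈ D.pos (levi Θ)) hlev ?_ hβ
      intro β _ γ _ hβγ h1 h2
      rw [map_add, neg_add]
      refine ⟨⟨?_, (levi Θ).add_mem h1.1.2 h2.1.2⟩, ?_⟩
      · rw [← neg_add, ← map_add]; exact neg_mem (map_mem haW hβγ.1.1)
      · rw [map_add]; exact add_pos h1.2 h2.2
    -- Since `-a` permutes the positive roots of `⟨Θ⟩`, conjugation by `a` preserves its Weyl group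
    -- and its longest element; thus `aba = b` and `(ab)² = 1`.
    have haba : D.IsLongest (levi Θ) (a * b * a) := by
      refine ⟨?_, fun β hβ => ?_⟩
      · have hinv : a⁻¹ = a := inv_eq_of_mul_eq_one_left ha.mul_self
        refine W_simple_induction (p := fun u => a * u * a ∈ D.W (levi Θ))
          (by rw [mul_one, ha.mul_self]; exact one_mem _) ?_ hb.1
        intro θ hθ v hv
        have h1 := hlev θ hθ
        have : a * (D.refl θ * v) * a = D.refl (-a θ) * (a * v * a) := by
          rw [← mul_assoc, refl_conj haW hθ.1.1.1, refl_neg (neg_mem_iff.1 h1.1.1)]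
          simp only [mul_assoc]
        rw [this]
        exact mul_mem (refl_mem_W h1.1.1 h1.1.2) hv
      · have h1 := hpos _ (hb.2 _ (hpos β hβ))
        simpa using h1
    have hsq : (a * b) * (a * b) = 1 := by
      rw [← mul_assoc, haba.unique hb, hb.mul_self]
    exact orderOf_eq_prime (by rw [sq, hsq]) hne

end Sigma

/-! ### Normality, transporters and useful roots -/

section Normal

variable {Θ : Set V} (hΘ : Θ ⊆ D.simple ⊤)

variable (D) in
/-- The reflections `σ_α` of the positive, useful, reduced roots. -/
def IsUsefulReduced (Θ : Set V) (α : V) : Prop :=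
  α ∈ D.pos ⊤ ∧ orderOf (D.sig Θ α) = 2 ∧ α ∉ Submodule.span ℂ Θ ∧
    D.simple (along Θ α) = insert α Θ

include hΘ in
lemma closure_sig_le {w : V ≃ₗ[ℂ] V}
    (hw : w ∈ Subgroup.closure (D.sig Θ '' {α | D.IsUsefulReduced Θ α})) :
    w ∈ D.W ⊤ ∧ w '' Θ = Θ := by
  have himg : ∀ u v : V ≃ₗ[ℂ] V, (u * v) '' Θ = u '' (v '' Θ) := fun u v =>
    Set.image_comp u v Θ
  induction hw using Subgroup.closure_induction with
  | mem w hw =>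
    obtain ⟨α, ⟨hα, h2, hαΘ, -⟩, rfl⟩ := hw
    exact ⟨W_le_top (sig_mem α), (orderOf_sig_eq_two_iff hΘ hα.1.1 hαΘ).1 h2⟩
  | one => exact ⟨one_mem _, Set.image_id Θ⟩
  | mul u v _ _ hu hv => exact ⟨mul_mem hu.1 hv.1, by rw [himg, hv.2, hu.2]⟩
  | inv u _ hu =>
    refine ⟨inv_mem hu.1, ?_⟩
    nth_rewrite 1 [← hu.2]
    rw [← himg, inv_mul_cancel]
    exact Set.image_id Θ

lemma closure_map {w : V ≃ₗ[ℂ] V} {S T : Set V} (h : ∀ s ∈ S, w s ∈ T) {x : V}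
    (hx : x ∈ AddSubmonoid.closure S) : w x ∈ AddSubmonoid.closure T := by
  induction hx using AddSubmonoid.closure_induction with
  | mem x hx => exact AddSubmonoid.subset_closure (h x hx)
  | zero => rw [map_zero]; exact zero_mem _
  | add x y _ _ hx hy => rw [map_add]; exact add_mem hx hy

include hΘ in
/-- If `w` maps `Θ` into the simple roots and a simple root `α` outside `Θ` to a negative root,
then it maps no positive root of `Δ(α)` outside `⟨Θ⟩` to a positive root. -/
lemma map_notMem_pos {w : V ≃ₗ[ℂ] V} (hwΘ : w '' Θ ⊆ D.simple ⊤) {α : V}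
    (hα : α ∈ D.simple ⊤) (hαΘ : α ∉ Θ) (hneg : -w α ∈ D.pos ⊤) {δ : V}
    (hδ : δ ∈ D.pos (along Θ α)) (hδΘ : δ ∉ levi Θ) : w δ ∉ D.pos ⊤ := by
  intro hwδ
  have hmem := mem_closure_simple hδ
  rw [simple_along_of_simple hΘ hα hαΘ] at hmem
  -- The simple roots of `Δ(α)` are `Θ ∪ {α}`; the coefficient `k` of `α` is nonzero because `δ` is
  -- outside `⟨Θ⟩`.
  have hdec : ∃ k : ℕ, ∃ θ ∈ AddSubmonoid.closure Θ, δ = k • α + θ := by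
    clear hδ hδΘ hwδ
    induction hmem using AddSubmonoid.closure_induction with
    | mem x hx =>
      rcases hx with rfl | hx
      · exact ⟨1, 0, zero_mem _, by simp⟩
      · exact ⟨0, x, AddSubmonoid.subset_closure hx, by simp⟩
    | zero => exact ⟨0, 0, zero_mem _, by simp⟩
    | add x y _ _ hx hy =>
      obtain ⟨k, θ, hθ, rfl⟩ := hx
      obtain ⟨l, η, hη, rfl⟩ := hy
      exact ⟨k + l, θ + η, add_mem hθ hη, by rw [add_nsmul]; abel⟩
  obtain ⟨k, θ, hθ, rfl⟩ := hdec
  have hk : k ≠ 0 := by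
    rintro rfl
    refine hδΘ ?_
    rw [zero_nsmul, zero_add]
    exact (AddSubmonoid.closure_le.2 (AddSubgroup.subset_closure (k := Θ)) :
      AddSubmonoid.closure Θ ≤ (levi Θ).toAddSubmonoid) hθ
  -- If `wδ` were positive, `k(-wα)` and `wδ` would be nonnegative combinations of simple roots with
  -- sum `wθ` in the span of `wΘ`. Then `wα` lies in that span, and `α` in the span of `Θ`.
  have h1 := mem_closure_of_add_mem_span hwΘ
    (x := k • (-w α)) (nsmul_mem (mem_closure_simple hneg) k) (mem_closure_simple hwδ) (by
      have : k • (-w α) + w (k • α + θ) = w θ := by rw [map_add, map_nsmul]; simp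
      rw [this]
      exact closure_le_span (closure_map (T := w '' Θ) (fun s hs => ⟨s, hs, rfl⟩) hθ))
  have h2 : (k : ℂ) • w α ∈ Submodule.span ℂ (w '' Θ) := by
    have := Submodule.neg_mem _ (closure_le_span h1)
    rwa [smul_neg, neg_neg, ← Nat.cast_smul_eq_nsmul ℂ] at this
  have h3 : w α ∈ Submodule.span ℂ (w '' Θ) :=
    (Submodule.smul_mem_iff _ (by exact_mod_cast hk)).1 h2
  have h4 : α ∈ Submodule.span ℂ Θ := by
    have : Submodule.span ℂ (w '' Θ) = (Submodule.span ℂ Θ).map (w : V →ₗ[ℂ] V) :=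
      (Submodule.map_span (w : V →ₗ[ℂ] V) Θ).symm
    rw [this] at h3
    obtain ⟨x, hx, hxα⟩ := h3
    rwa [← w.injective hxα]
  exact notMem_span_of_simple hΘ hα hαΘ h4

include hΘ in
/-- If `Θ` is normal, every element of the Weyl group that maps `Θ` into the simple roots is a
product of the `σ_α`. -/
lemma mem_closure_sig (hn : ∀ α ∈ D.simple ⊤, α ∉ Θ → orderOf (D.sig Θ α) = 2)
    {w : V ≃ₗ[ℂ] V} (hw : w ∈ D.W ⊤) (hwΘ : w '' Θ ⊆ D.simple ⊤) :
    w ∈ Subgroup.closure (D.sig Θ '' {α | D.IsUsefulReduced Θ α}) := by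
  generalize hk : (D.inv ⊤ w).ncard = k
  induction k using Nat.strong_induction_on generalizing w with
  | _ k ih =>
    by_cases h1 : w = 1
    · rw [h1]; exact one_mem _
    obtain ⟨α, hα, hneg⟩ := exists_simple_neg hw h1
    have hαΘ : α ∉ Θ := fun h => neg_notMem_pos (hwΘ ⟨α, h, rfl⟩).1 hneg
    have hαs := notMem_span_of_simple hΘ hα hαΘ
    have h2 := hn α hα hαΘ
    have hσΘ := (orderOf_sig_eq_two_iff hΘ hα.1.1.1 hαs).1 h2
    have hmem : D.sig Θ α ∈ Subgroup.closure (D.sig Θ '' {α | D.IsUsefulReduced Θ α}) :=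
      Subgroup.subset_closure ⟨α, ⟨hα.1, h2, hαs, simple_along_of_simple hΘ hα hαΘ⟩, rfl⟩
    have hσW := sig_mem (D := D) (Θ := Θ) α
    have hαpos : α ∈ D.pos (along Θ α) := mem_pos_of_mem hα.1 (self_mem_along α)
    set σ := D.sig Θ α
    -- It is shown that `σ` embeds the inversions of `wσ` into those of `w` and misses `α`. For an
    -- inversion `β` of `wσ`, positivity of `σβ` is checked in three cases: `β` in `⟨Θ⟩`, in the
    -- rest of `Δ(α)`, and outside `Δ(α)`.
    have key : w * σ ∈ Subgroup.closure (D.sig Θ '' {α | D.IsUsefulReduced Θ α}) := by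
      refine ih _ ?_ (mul_mem hw (W_le_top hσW)) ?_ rfl
      · rw [← hk, ← Set.ncard_image_of_injective _ σ.injective]
        refine Set.ncard_lt_ncard ⟨?_, fun hsub => ?_⟩ (inv_finite w)
        · rintro - ⟨β, ⟨hβ, hβ'⟩, rfl⟩
          refine ⟨?_, hβ'⟩
          by_cases hβA : β ∈ along Θ α
          · refine (mem_pos_or (A := ⊤) (map_mem hσW hβ.1.1) trivial).resolve_right fun hσβ => ?_
            have hσβA : -σ β ∈ along Θ α :=
              (along Θ α).neg_mem ((map_mem_sub hσW hβ.1.1 le_rfl).2 hβA)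
            by_cases hβΘ : β ∈ levi Θ
            · have h5 := mem_closure_simple (mem_pos_of_mem hβ hβΘ)
              rw [simple_levi hΘ] at h5
              have h6 := closure_map (w := σ) (T := Θ) (fun s hs => by
                have : σ s ∈ σ '' Θ := ⟨s, hs, rfl⟩
                rwa [hσΘ] at this) h5
              have h7 : 0 ≤ D.ht (σ β) := by
                clear h5 hσβA hσβ hβA hβ' hβ hβΘ
                generalize σ β = x at h6
                induction h6 using AddSubmonoid.closure_induction with
                | mem x hx => exact (hΘ hx).1.2.le
                | zero => simp
                | add x y _ _ hx hy => rw [map_add]; exact add_nonneg hx hy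
              have h8 := hσβ.2
              rw [map_neg] at h8
              linarith
            · refine map_notMem_pos hΘ hwΘ hα hαΘ hneg (mem_pos_of_mem hσβ hσβA) ?_
                (by rw [map_neg]; exact hβ')
              intro h
              have h9 : σ β ∈ Submodule.span ℂ Θ := by
                simpa using Submodule.neg_mem _ (levi_le_span h)
              refine hβΘ (mem_levi_of_mem_span hΘ hβ.1.1 ?_)
              have : Submodule.span ℂ Θ = (Submodule.span ℂ Θ).map (σ : V →ₗ[ℂ] V) := by
                rw [Submodule.map_span]
                exact congrArg _ hσΘ.symm
              rw [this] at h9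
              obtain ⟨x, hx, hxβ⟩ := h9
              rwa [← σ.injective hxβ]
          · exact map_mem_pos_of_notMem
              ((simple_along_of_simple hΘ hα hαΘ).trans_subset (Set.insert_subset hα hΘ))
              hσW hβ hβA
        -- If `σβ = α`, then `β = σα` because `σ² = 1`; but `σα` is negative.
        · obtain ⟨β, ⟨hβ, -⟩, hβα⟩ := hsub ⟨hα.1, hneg⟩
          have h3 := neg_sig_mem_pos hΘ hαpos hαs
          have h4 : β = σ α := by
            have : σ * σ = 1 := by rw [← sq, ← h2]; exact pow_orderOf_eq_one _
            rw [← hβα]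
            exact (congrArg (fun u : V ≃ₗ[ℂ] V => u β) this).symm
          rw [h4] at hβ
          exact neg_notMem_pos hβ h3
      · have : (w * σ) '' Θ = w '' (σ '' Θ) := Set.image_comp w σ Θ
        rw [this, hσΘ]
        exact hwΘ
    have := mul_mem key (inv_mem hmem)
    rwa [mul_inv_cancel_right] at this

include hΘ in
-- For `α` simple, `σ_α` maps `Θ` into `Θ ∪ {α}`, so it is itself a transporter and the hypothesis
-- applies to it.
lemma orderOf_sig_of_transporter
    (hK : ∀ w ∈ D.W ⊤, w '' Θ ⊆ D.simple ⊤ → w '' Θ = Θ) {α : V} (hα : α ∈ D.simple ⊤)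
    (hαΘ : α ∉ Θ) : orderOf (D.sig Θ α) = 2 := by
  refine (orderOf_sig_eq_two_iff hΘ hα.1.1.1 (notMem_span_of_simple hΘ hα hαΘ)).2
    (hK _ (W_le_top (sig_mem α)) ?_)
  rintro - ⟨θ, hθ, rfl⟩
  have := sig_mem_simple hΘ (α := α) hθ
  rw [simple_along_of_simple hΘ hα hαΘ] at this
  exact Set.insert_subset hα hΘ this

lemma map_inv_mem_simple {w : V ≃ₗ[ℂ] V} {Q : Set V} (hwQ : w '' D.pos ⊤ = Q) {δ : V}
    (hδ : δ ∈ indecomposables Q) : w⁻¹ δ ∈ D.simple ⊤ := by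
  subst hwQ
  obtain ⟨⟨α, hα, rfl⟩, h⟩ := hδ
  have : w⁻¹ (w α) = α := w.symm_apply_apply α
  rw [this]
  exact ⟨hα, fun β hβ γ hγ heq => h _ ⟨β, hβ, rfl⟩ _ ⟨γ, hγ, rfl⟩ (by rw [heq, map_add])⟩

/-- Positivity for the lexicographic order of `ℂ`. -/
def LexPos (z : ℂ) : Prop := 0 < z.re ∨ z.re = 0 ∧ 0 < z.im

lemma LexPos.add {z w : ℂ} (hz : LexPos z) (hw : LexPos w) : LexPos (z + w) := by
  rcases hz with hz | ⟨hz, hz'⟩ <;> rcases hw with hw | ⟨hw, hw'⟩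
  · exact Or.inl (add_pos hz hw)
  · exact Or.inl (by simpa [hw] using hz)
  · exact Or.inl (by simpa [hz] using hw)
  · exact Or.inr ⟨by simp [hz, hw], add_pos hz' hw'⟩

lemma LexPos.ne_zero {z : ℂ} (hz : LexPos z) : z ≠ 0 := by
  rintro rfl; simp [LexPos] at hz

lemma lexPos_or {z : ℂ} (hz : z ≠ 0) : LexPos z ∨ LexPos (-z) := by
  rcases lt_trichotomy z.re 0 with h | h | h
  · exact Or.inr (Or.inl (by simpa using h))
  · rcases lt_trichotomy z.im 0 with h' | h' | h'
    · exact Or.inr (Or.inr ⟨by simpa using h, by simpa using h'⟩)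
    · exact absurd (Complex.ext h h') hz
    · exact Or.inl (Or.inr ⟨h, h'⟩)
  · exact Or.inl (Or.inl h)

include hΘ in
/-- A root of the form `z γ + (element of the span of Θ)` has `z` real. -/
lemma mem_along_of_mem_span_insert {γ δ : V} (hγ : γ ∈ D.Φ) (hγΘ : γ ∉ Submodule.span ℂ Θ)
    (hδ : δ ∈ D.Φ) (h : δ ∈ Submodule.span ℂ (insert γ Θ)) : δ ∈ along Θ γ := by
  obtain ⟨z, t, ht, rfl⟩ := Submodule.mem_span_insert.1 h
  obtain ⟨f, hf0, -, hfint, hf⟩ := exists_level_int hΘ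
  obtain ⟨k, hk⟩ := hfint γ hγ trivial
  obtain ⟨l, hl⟩ := hfint _ hδ trivial
  rw [map_add, map_smul, hf0 t ht, add_zero, smul_eq_mul, hk] at hl
  have hk0 : (k : ℂ) ≠ 0 := fun h0 => hγΘ (levi_le_span (hf γ hγ trivial (by rw [hk, h0])))
  refine ⟨l / k, ?_⟩
  have : z = ((l / k : ℝ) : ℂ) := by push_cast; rw [← hl, mul_div_cancel_right₀ _ hk0]
  rw [← this, add_sub_cancel_left]
  exact ht

include hΘ in
/-- The subsystem `Δ(γ)` is conjugate to one spanned by simple roots. -/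
lemma exists_map_simple_along {γ : V} (hγ : γ ∈ D.Φ) (hγΘ : γ ∉ Submodule.span ℂ Θ) :
    ∃ w ∈ D.W ⊤, w '' D.simple (along Θ γ) ⊆ D.simple ⊤ := by
  let U := Submodule.span ℂ (insert γ Θ)
  have : Finite ↥(D.Φ \ (along Θ γ : Set V)) := D.finite.subset Set.sdiff_subset
  -- A linear form that kills `γ` and `Θ` but no root outside `Δ(γ)`. Its values are complex, so
  -- signs are read off lexicographically.
  obtain ⟨f', hf'⟩ := Module.exists_dual_forall_apply_ne_zero (K := ℂ)
    (fun δ : ↥(D.Φ \ (along Θ γ : Set V)) => U.mkQ δ) fun δ h => by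
      rw [Submodule.mkQ_apply, Submodule.Quotient.mk_eq_zero] at h
      exact δ.2.2 (mem_along_of_mem_span_insert hΘ hγ hγΘ δ.2.1 h)
  let f : Dual ℂ V := f' ∘ₗ U.mkQ
  have hf0 : ∀ v ∈ along Θ γ, f v = 0 := fun v hv => by
    have : U.mkQ v = 0 := by
      rw [Submodule.mkQ_apply, Submodule.Quotient.mk_eq_zero]
      exact mem_span_insert_of_mem_along hv
    simp only [f, LinearMap.comp_apply, this, map_zero]
  have hf1 : ∀ δ ∈ D.Φ, f δ = 0 → δ ∈ along Θ γ := fun δ hδ h => by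
    by_contra hn
    exact hf' ⟨δ, hδ, hn⟩ h
  -- Order the roots by `f` first and by `ht` on the kernel of `f`.
  let Q : Set V := {δ ∈ D.Φ | LexPos (f δ) ∨ f δ = 0 ∧ 0 < D.ht δ}
  have hadd : ∀ β ∈ Q, ∀ δ ∈ Q, f (β + δ) = 0 → f β = 0 ∧ f δ = 0 := by
    rintro β ⟨-, h1⟩ δ ⟨-, h2⟩ h
    rw [map_add] at h
    rcases h1 with h1 | ⟨h1, -⟩
    · rcases h2 with h2 | ⟨h2, -⟩
      · exact absurd h (h1.add h2).ne_zero
      · rw [h2, add_zero] at h; exact absurd h h1.ne_zero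
    · rw [h1, zero_add] at h; exact ⟨h1, h⟩
  have key : ∃ v ∈ Subgroup.closure (D.refl '' D.simple ⊤), v '' D.pos ⊤ = Q := by
    refine exists_conj Q (fun δ h => ⟨h.1, trivial⟩) ?_ ?_ ?_
    · rintro β ⟨hβ, h1⟩ δ ⟨hδ, h2⟩ h
      refine ⟨h, ?_⟩
      rw [map_add, map_add]
      rcases h1 with h1 | ⟨h1, h1'⟩ <;> rcases h2 with h2 | ⟨h2, h2'⟩
      · exact Or.inl (h1.add h2)
      · exact Or.inl (by rwa [h2, add_zero])
      · exact Or.inl (by rwa [h1, zero_add])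
      · exact Or.inr ⟨by rw [h1, h2, add_zero], add_pos h1' h2'⟩
    · intro δ hδ _
      by_cases h0 : f δ = 0
      · rcases (D.ht_ne_zero δ hδ).lt_or_gt with h | h
        · exact Or.inr ⟨neg_mem hδ, Or.inr ⟨by simp [h0], by simpa using h⟩⟩
        · exact Or.inl ⟨hδ, Or.inr ⟨h0, h⟩⟩
      · rcases lexPos_or h0 with h | h
        · exact Or.inl ⟨hδ, Or.inl h⟩
        · exact Or.inr ⟨neg_mem hδ, Or.inl (by simpa using h)⟩
    · intro δ hδ hδ'
      obtain ⟨h0, -⟩ := hadd δ hδ _ hδ' (by simp)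
      have h1 := hδ.2.resolve_left fun h => h.ne_zero h0
      have h2 := hδ'.2.resolve_left fun h => h.ne_zero (by simp [h0])
      have h3 := h2.2
      rw [map_neg] at h3
      linarith [h1.2]
  obtain ⟨v, hv, hvQ⟩ := key
  refine ⟨v⁻¹, inv_mem (closure_simple_le hv), ?_⟩
  rintro - ⟨δ, hδ, rfl⟩
  refine map_inv_mem_simple hvQ ⟨⟨hδ.1.1.1, Or.inr ⟨hf0 δ hδ.1.1.2, hδ.1.2⟩⟩, ?_⟩
  -- A decomposition in `Q` of a root of `Δ(γ)` has both terms in the kernel of `f`, hence in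
  -- `Δ(γ)`; so simple roots of `Δ(γ)` stay indecomposable in `Q`.
  rintro β hβ ε hε rfl
  obtain ⟨h1, h2⟩ := hadd β hβ ε hε (hf0 _ hδ.1.1.2)
  exact hδ.2 β ⟨⟨hβ.1, hf1 β hβ.1 h1⟩, (hβ.2.resolve_left fun h => h.ne_zero h1).2⟩
    ε ⟨⟨hε.1, hf1 ε hε.1 h2⟩, (hε.2.resolve_left fun h => h.ne_zero h2).2⟩ rfl

include hΘ in
-- Move the simple roots `Θ ∪ {γ}` of `Δ(β)` into the simple roots by some `w`. By normality `w` is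
-- a product of elements `σ_α`, so it stabilizes `Θ`, and it conjugates `σ_β` to `σ_{wγ}` with `wγ`
-- simple outside `Θ`.
lemma orderOf_sig_of_normal (hn : ∀ α ∈ D.simple ⊤, α ∉ Θ → orderOf (D.sig Θ α) = 2)
    {β : V} (hβ : β ∈ D.Φ) (hβΘ : β ∉ Submodule.span ℂ Θ) : orderOf (D.sig Θ β) = 2 := by
  obtain ⟨γ, hγ, hs, hγΘ, heq⟩ := exists_simple_along hΘ hβ hβΘ
  rw [← sig_congr heq]
  rw [← heq] at hs
  obtain ⟨w, hw, hws⟩ := exists_map_simple_along hΘ hγ.1.1.1 hγΘ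
  rw [hs] at hws
  have hwΘ := (closure_sig_le hΘ (mem_closure_sig hΘ hn hw
    ((Set.image_mono (Set.subset_insert γ Θ)).trans hws))).2
  have hα : w γ ∈ D.simple ⊤ := hws ⟨γ, Set.mem_insert _ _, rfl⟩
  have hαΘ : w γ ∉ Θ := by
    intro h
    rw [← hwΘ] at h
    obtain ⟨θ, hθ, hθγ⟩ := h
    rw [w.injective hθγ] at hθ
    exact hγΘ (Submodule.subset_span hθ)
  have hconj : D.sig Θ (w γ) = w * D.sig Θ γ * w⁻¹ := by
    have h1 := (isLongest_longest (D := D) (along Θ γ)).conj (B := along Θ (w γ)) hw (by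
      rw [simple_along_of_simple hΘ hα hαΘ, hs, Set.image_insert_eq, hwΘ])
    have h2 := (isLongest_longest (D := D) (levi Θ)).conj (B := levi Θ) hw (by
      rw [simple_levi hΘ, hwΘ])
    have e1 := (isLongest_longest _).unique h1
    have e2 := (isLongest_longest _).unique h2
    calc D.sig Θ (w γ) = (w * D.longest (along Θ γ) * w⁻¹) * (w * D.longest (levi Θ) * w⁻¹) := by
          rw [sig, e1, ← e2]
      _ = _ := by rw [sig]; group
  rw [← hn _ hα hαΘ, hconj]
  exact (orderOf_injective (MulAut.conj w).toMonoidHom (MulAut.conj w).injective _).symm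

end Normal

/-! ### Parabolic sets of roots -/

section Parabolic

variable {Θ : Set V} (hΘ : Θ ⊆ D.simple ⊤)

variable (D) in
/-- `S` is a parabolic set of roots. -/
structure IsParabolicSet (S : Set V) : Prop where
  subset : S ⊆ D.Φ
  add_mem : ∀ β ∈ S, ∀ γ ∈ S, β + γ ∈ D.Φ → β + γ ∈ S
  mem_or : ∀ α ∈ D.Φ, α ∈ S ∨ -α ∈ S

variable (D) in
/-- The roots of the standard parabolic subalgebra attached to `Θ`. -/
def std (Θ : Set V) : Set V := {α ∈ D.Φ | α ∈ D.pos ⊤ ∨ α ∈ levi Θ}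

lemma pos_subset_std : D.pos ⊤ ⊆ D.std Θ := fun _ h => ⟨h.1.1, Or.inl h⟩

include hΘ in
lemma isParabolicSet_std : D.IsParabolicSet (D.std Θ) where
  subset := fun _ h => h.1
  mem_or α hα := (mem_pos_or hα (A := ⊤) trivial).imp (fun h => pos_subset_std h)
    fun h => pos_subset_std h
  add_mem := by
    obtain ⟨f, hf0, hfpos, -, hf⟩ := exists_level_int hΘ
    have key : ∀ β ∈ D.pos ⊤, ∀ γ ∈ levi Θ, β + γ ∈ D.Φ → β + γ ∈ D.std Θ := by
      intro β hβ γ hγ h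
      rcases mem_pos_or h (A := ⊤) trivial with h1 | h1
      -- Adding an element of `⟨Θ⟩` does not change the level. If the sum is negative, its level is
      -- both nonnegative and nonpositive, so everything takes place in `⟨Θ⟩`.
      · exact pos_subset_std h1
      · obtain ⟨k, hk⟩ := hfpos β hβ
        obtain ⟨l, hl⟩ := hfpos _ h1
        rw [map_neg, map_add, hf0 γ (levi_le_span hγ), add_zero, hk] at hl
        have : (k : ℂ) + l = 0 := by rw [← hl]; ring
        have hk0 : k + l = 0 := by exact_mod_cast this
        have : k = 0 := by omega
        refine ⟨h, Or.inr ((levi Θ).add_mem (hf β hβ.1.1 trivial ?_) hγ)⟩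
        rw [hk, this, Nat.cast_zero]
    rintro β ⟨hβ, h1⟩ γ ⟨hγ, h2⟩ h
    rcases h1 with h1 | h1 <;> rcases h2 with h2 | h2
    · refine pos_subset_std ⟨⟨h, trivial⟩, ?_⟩
      rw [map_add]; exact add_pos h1.2 h2.2
    · exact key β h1 γ h2 h
    · rw [add_comm] at h ⊢; exact key γ h2 β h1 h
    · exact ⟨h, Or.inr ((levi Θ).add_mem h1 h2)⟩

lemma mem_std_and_neg_mem_iff {α : V} (hα : α ∈ D.Φ) :
    α ∈ D.std Θ ∧ -α ∈ D.std Θ ↔ α ∈ levi Θ := by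
  constructor
  · rintro ⟨⟨-, h1⟩, ⟨-, h2⟩⟩
    rcases h1 with h1 | h1
    · rcases h2 with h2 | h2
      · exact absurd h2 (neg_notMem_pos h1)
      · simpa using (levi Θ).neg_mem h2
    · exact h1
  · exact fun h => ⟨⟨hα, Or.inr h⟩, ⟨neg_mem hα, Or.inr ((levi Θ).neg_mem h)⟩⟩

lemma IsParabolicSet.map {S : Set V} (hS : D.IsParabolicSet S) {w : V ≃ₗ[ℂ] V} (hw : w ∈ D.W ⊤) :
    D.IsParabolicSet (w '' S) where
  subset := by rintro - ⟨β, hβ, rfl⟩; exact map_mem hw (hS.subset hβ)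
  add_mem := by
    rintro - ⟨β, hβ, rfl⟩ - ⟨γ, hγ, rfl⟩ h
    rw [← map_add] at h ⊢
    exact ⟨_, hS.add_mem β hβ γ hγ ((map_mem_iff hw).1 h), rfl⟩
  mem_or α hα := by
    have hα' : w⁻¹ α ∈ D.Φ := map_mem (inv_mem hw) hα
    have h1 : w (w⁻¹ α) = α := w.apply_symm_apply α
    rcases hS.mem_or _ hα' with h | h
    · exact Or.inl ⟨_, h, h1⟩
    · exact Or.inr ⟨_, h, by rw [map_neg, h1]⟩

/-- A parabolic set contains an abstract positive system. -/
lemma IsParabolicSet.exists_pos {S : Set V} (hS : D.IsParabolicSet S) :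
    D.IsParabolicSet ({β ∈ S | -β ∉ S} ∪ {β ∈ D.pos ⊤ | β ∈ S ∧ -β ∈ S}) ∧
    (∀ β ∈ {β ∈ S | -β ∉ S}, ∀ γ ∈ S, β + γ ∈ D.Φ → β + γ ∈ S ∧ -(β + γ) ∉ S) := by
  -- The roots of `S` whose negatives are not in `S` absorb addition: `-(β + γ) ∈ S` together with
  -- `γ ∈ S` would give `-β ∈ S`.
  have key : ∀ β ∈ {β ∈ S | -β ∉ S}, ∀ γ ∈ S, β + γ ∈ D.Φ → β + γ ∈ S ∧ -(β + γ) ∉ S := by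
    rintro β ⟨hβ, hβ'⟩ γ hγ h
    refine ⟨hS.add_mem β hβ γ hγ h, fun hn => hβ' ?_⟩
    have h1 : -(β + γ) + γ = -β := by abel
    rw [← h1]
    exact hS.add_mem _ hn _ hγ (by rw [h1]; exact neg_mem (hS.subset hβ))
  refine ⟨⟨?_, ?_, ?_⟩, key⟩
  · rintro β (h | h)
    exacts [hS.subset h.1, h.1.1.1]
  · rintro β hβ γ hγ h
    have hSβ : β ∈ S := hβ.elim (fun h => h.1) fun h => h.2.1
    have hSγ : γ ∈ S := hγ.elim (fun h => h.1) fun h => h.2.1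
    rcases hβ with hβ | hβ
    · exact Or.inl (key β hβ γ hSγ h)
    rcases hγ with hγ | hγ
    · rw [add_comm] at h ⊢; exact Or.inl (key γ hγ β hSβ h)
    refine Or.inr ⟨⟨⟨h, trivial⟩, ?_⟩, hS.add_mem β hSβ γ hSγ h, ?_⟩
    · rw [map_add]; exact add_pos hβ.1.2 hγ.1.2
    · rw [neg_add] at *
      exact hS.add_mem _ hβ.2.2 _ hγ.2.2 (by rw [← neg_add]; exact neg_mem h)
  · intro α hα
    by_cases h1 : α ∈ S <;> by_cases h2 : -α ∈ S
    · rcases mem_pos_or hα (A := ⊤) trivial with h | h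
      · exact Or.inl (Or.inr ⟨h, h1, h2⟩)
      · exact Or.inr (Or.inr ⟨h, h2, by rwa [neg_neg]⟩)
    · exact Or.inl (Or.inl ⟨h1, h2⟩)
    · exact Or.inr (Or.inl ⟨h2, by rwa [neg_neg]⟩)
    · exact absurd (hS.mem_or α hα) (by tauto)

lemma IsParabolicSet.exists_pos_subset {S : Set V} (hS : D.IsParabolicSet S) :
    ∃ w ∈ D.W ⊤, w '' D.pos ⊤ = {β ∈ S | -β ∉ S} ∪ {β ∈ D.pos ⊤ | β ∈ S ∧ -β ∈ S} := by
  obtain ⟨h1, -⟩ := hS.exists_pos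
  have key : ∃ w ∈ Subgroup.closure (D.refl '' D.simple ⊤), w '' D.pos ⊤ =
      {β ∈ S | -β ∉ S} ∪ {β ∈ D.pos ⊤ | β ∈ S ∧ -β ∈ S} := by
    refine exists_conj _ (fun β hβ => ⟨h1.subset hβ, trivial⟩) h1.add_mem
      (fun α hα _ => h1.mem_or α hα) ?_
    rintro α (h | h) (h' | h')
    · exact h.2 h'.1
    · exact h.2 h'.2.1
    · exact h'.2 (by rw [neg_neg]; exact h.2.1)
    · exact neg_notMem_pos h.1 h'.1
  obtain ⟨w, hw, h⟩ := key
  exact ⟨w, closure_simple_le hw, h⟩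

include hΘ in
/-- If every transporter of `Θ` into the simple roots stabilizes `Θ`, the parabolic sets with Levi
part `⟨Θ⟩` are conjugate to the standard one under the stabilizer of `Θ`. -/
lemma IsParabolicSet.exists_eq_map_std (hK : ∀ w ∈ D.W ⊤, w '' Θ ⊆ D.simple ⊤ → w '' Θ = Θ)
    {S : Set V} (hS : D.IsParabolicSet S)
    (hlevi : ∀ α ∈ D.Φ, α ∈ S ∧ -α ∈ S ↔ α ∈ levi Θ) :
    ∃ w ∈ D.W ⊤, S = w '' D.std Θ := by
  obtain ⟨-, hadd⟩ := hS.exists_pos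
  obtain ⟨w, hw, hwQ⟩ := hS.exists_pos_subset
  -- A simple root `θ` stays indecomposable in the positive system inside `S`: a summand `β` with
  -- `-β ∉ S` would force `-θ ∉ S`, and otherwise both summands are positive in the original sense.
  -- Thus `w⁻¹` is a transporter of `Θ`.
  have hsimple : ∀ θ ∈ Θ, w⁻¹ θ ∈ D.simple ⊤ := by
    intro θ hθ
    have hθΦ := (hΘ hθ).1.1.1
    obtain ⟨hθ1, hθ2⟩ := (hlevi θ hθΦ).2 (AddSubgroup.subset_closure hθ)
    refine map_inv_mem_simple hwQ ⟨Or.inr ⟨(hΘ hθ).1, hθ1, hθ2⟩, ?_⟩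
    rintro β hβ γ hγ rfl
    have hSβ : β ∈ S := hβ.elim (fun h => h.1) fun h => h.2.1
    have hSγ : γ ∈ S := hγ.elim (fun h => h.1) fun h => h.2.1
    rcases hβ with hβ | hβ
    · exact (hadd β hβ γ hSγ hθΦ).2 hθ2
    rcases hγ with hγ | hγ
    · rw [add_comm] at hθΦ hθ2
      exact (hadd γ hγ β hSβ hθΦ).2 hθ2
    exact (hΘ hθ).2 β hβ.1 γ hγ.1 rfl
  have hΘ' := hK w⁻¹ (inv_mem hw) (by rintro - ⟨θ, hθ, rfl⟩; exact hsimple θ hθ)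
  have hwΘ : w '' Θ = Θ := by
    nth_rewrite 1 [← hΘ']
    have := Set.image_comp w (w⁻¹ : V ≃ₗ[ℂ] V) Θ
    rw [← this]
    have hid : (w : V → V) ∘ (w⁻¹ : V ≃ₗ[ℂ] V) = id := funext fun v => w.apply_symm_apply v
    rw [hid, Set.image_id]
  have hlev : ∀ u : V ≃ₗ[ℂ] V, u '' Θ = Θ → ∀ v ∈ levi Θ, u v ∈ levi Θ := by
    intro u hu v hv
    induction hv using AddSubgroup.closure_induction with
    | mem x hx =>
      have : u x ∈ u '' Θ := ⟨x, hx, rfl⟩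
      rw [hu] at this
      exact AddSubgroup.subset_closure this
    | zero => rw [map_zero]; exact (levi Θ).zero_mem
    | add x y _ _ hx hy => rw [map_add]; exact (levi Θ).add_mem hx hy
    | neg x _ hx => rw [map_neg]; exact (levi Θ).neg_mem hx
  refine ⟨w, hw, Set.Subset.antisymm (fun β hβ => ?_) ?_⟩
  · by_cases hβ' : -β ∈ S
    · have h1 := hlev _ hΘ' β ((hlevi β (hS.subset hβ)).1 ⟨hβ, hβ'⟩)
      exact ⟨w⁻¹ β, ⟨map_mem (inv_mem hw) (hS.subset hβ), Or.inr h1⟩, w.apply_symm_apply β⟩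
    · have : β ∈ w '' D.pos ⊤ := by rw [hwQ]; exact Or.inl ⟨hβ, hβ'⟩
      obtain ⟨α, hα, rfl⟩ := this
      exact ⟨α, pos_subset_std hα, rfl⟩
  · rintro - ⟨α, ⟨hα, h | h⟩, rfl⟩
    · have : w α ∈ w '' D.pos ⊤ := ⟨α, h, rfl⟩
      rw [hwQ] at this
      exact this.elim (fun h => h.1) fun h => h.2.1
    · exact ((hlevi _ (map_mem hw hα)).2 (hlev w hwΘ α h)).1

end Parabolic

end RootData

end ReductivePair


namespace ReductivePair

open Module LieAlgebra LieModule

/-! ### Reductive Lie algebras modulo their centre -/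

section Quotient

variable {g : Type*} [LieRing g] [LieAlgebra ℂ g]

variable (g) in
/-- The projection to the quotient by the centre. -/
def modCenter : g →ₗ⁅ℂ⁆ (g ⧸ center ℂ g) :=
  { (LieSubmodule.Quotient.mk' (center ℂ g) : g →ₗ[ℂ] (g ⧸ center ℂ g)) with
    map_lie' := fun {x y} => LieSubmodule.Quotient.mk_bracket (I := center ℂ g) x y }

lemma modCenter_surjective : Function.Surjective (modCenter g) :=
  LieSubmodule.Quotient.surjective_mk' _

lemma modCenter_eq_zero_iff {x : g} : modCenter g x = 0 ↔ ∀ y : g, ⁅x, y⁆ = 0 := by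
  have h1 : modCenter g x = 0 ↔ x ∈ center ℂ g := LieSubmodule.Quotient.mk_eq_zero (N := center ℂ g)
  rw [h1, mem_maxTrivSubmodule]
  exact forall_congr' fun y => by rw [← lie_skew, neg_eq_zero]

/-- Let `J` be the preimage of an abelian ideal. Then `[J, J]` is central, so `J` is solvable and
lies in the radical, which is the centre. -/
instance [FiniteDimensional ℂ g] [HasCentralRadical ℂ g] :
    HasTrivialRadical ℂ (g ⧸ center ℂ g) := by
  rw [hasTrivialRadical_iff_no_abelian_ideals]
  intro I hI
  set J : LieIdeal ℂ g := I.comap (modCenter g)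
  have h1 : derivedSeriesOfIdeal ℂ g 1 J ≤ center ℂ g := by
    rw [derivedSeriesOfIdeal_succ, derivedSeriesOfIdeal_zero, LieSubmodule.lieIdeal_oper_eq_span,
      LieSubmodule.lieSpan_le]
    rintro - ⟨⟨x, hx⟩, ⟨y, hy⟩, rfl⟩
    refine (LieSubmodule.Quotient.mk_eq_zero (N := center ℂ g)).1 ?_
    have h2 := hI.trivial ⟨modCenter g x, hx⟩ ⟨modCenter g y, hy⟩
    have h3 : ⁅modCenter g x, modCenter g y⁆ = 0 := congrArg Subtype.val h2
    exact ((modCenter g).map_lie x y).trans h3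
  have h2 : derivedSeriesOfIdeal ℂ g 2 J = ⊥ := by
    rw [derivedSeriesOfIdeal_succ, eq_bot_iff]
    refine (LieSubmodule.mono_lie h1 h1).trans ?_
    rw [LieSubmodule.lieIdeal_oper_eq_span, LieSubmodule.lieSpan_le]
    rintro - ⟨⟨x, hx⟩, ⟨y, hy⟩, rfl⟩
    exact hy x
  have h3 : IsSolvable J := IsSolvable.mk (k := 2) ((LieIdeal.derivedSeries_eq_bot_iff J 2).2 h2)
  have h4 : J ≤ center ℂ g := by
    rw [← radical_eq_center]
    exact (LieIdeal.solvable_iff_le_radical ℂ g J).1 h3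
  rw [eq_bot_iff]
  intro y hy
  obtain ⟨x, rfl⟩ := modCenter_surjective y
  exact (LieSubmodule.mem_bot _).2 ((LieSubmodule.Quotient.mk_eq_zero (N := center ℂ g)).2 (h4 hy))

variable {L : Type*} [LieRing L] [LieAlgebra ℂ L] [FiniteDimensional ℂ L] [IsKilling ℂ L]
  {π : g →ₗ⁅ℂ⁆ L} (hπ : Function.Surjective π) (hker : ∀ x, π x = 0 ↔ ∀ y : g, ⁅x, y⁆ = 0)

include hπ hker in
-- The alternating form `l ⁅x, y⁆` descends to the quotient. The Killing form converts it into an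
-- endomorphism, which the Jacobi identity makes a derivation; derivations of `L` are inner. Hence
-- on brackets every linear form factors through `π`, and so the centre meets `[g, g]` trivially.
lemma exists_killingForm_eq (l : Dual ℂ g) :
    ∃ d : L, ∀ x y : g, l ⁅x, y⁆ = killingForm ℂ L d (π ⁅x, y⁆) := by
  obtain ⟨s, hs⟩ := (π : g →ₗ[ℂ] L).exists_rightInverse_of_surjective (LinearMap.range_eq_top.2 hπ)
  have hs' : ∀ a, π (s a) = a := fun a => LinearMap.congr_fun hs a
  let ω : L →ₗ[ℂ] L →ₗ[ℂ] ℂ :=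
    LinearMap.mk₂ ℂ (fun a b => l ⁅s a, s b⁆) (by simp) (by simp) (by simp) (by simp)
  have hc : ∀ x y z : g, π x = π y → ⁅x, z⁆ = ⁅y, z⁆ := fun x y z h => by
    rw [← sub_eq_zero, ← sub_lie]
    exact (hker (x - y)).1 (by rw [map_sub, h, sub_self]) z
  have hω : ∀ x y, ω (π x) (π y) = l ⁅x, y⁆ := fun x y => by
    change l ⁅s (π x), s (π y)⁆ = _
    rw [hc _ x _ (hs' _), ← lie_skew, hc _ y _ (hs' _), lie_skew]
  have hnd := IsKilling.killingForm_nondegenerate ℂ L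
  let D : L →ₗ[ℂ] L := (LinearMap.BilinForm.toDual (killingForm ℂ L) hnd).symm.toLinearMap ∘ₗ ω
  have hD : ∀ a b, killingForm ℂ L (D a) b = ω a b := fun a b =>
    LinearMap.congr_fun ((LinearMap.BilinForm.toDual (killingForm ℂ L) hnd).apply_symm_apply (ω a)) b
  have hinv : ∀ a b c : L, killingForm ℂ L ⁅a, b⁆ c = killingForm ℂ L a ⁅b, c⁆ :=
    fun a b c => traceForm_apply_lie_apply ℂ L L a b c
  let D' : LieDerivation ℂ L L :=
    { D with
      leibniz' := fun a b => by
        refine LinearMap.ker_eq_bot.1 (IsKilling.ker_killingForm_eq_bot ℂ L) ?_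
        ext c
        change killingForm ℂ L (D ⁅a, b⁆) c = killingForm ℂ L (⁅a, D b⁆ - ⁅b, D a⁆) c
        rw [map_sub, LinearMap.sub_apply, ← lie_skew a (D b), ← lie_skew b (D a), map_neg, map_neg,
          LinearMap.neg_apply, LinearMap.neg_apply, hinv, hinv, hD, hD, hD]
        obtain ⟨x, rfl⟩ := hπ a
        obtain ⟨y, rfl⟩ := hπ b
        obtain ⟨z, rfl⟩ := hπ c
        simp only [← LieHom.map_lie, hω]
        rw [lie_lie x y z, map_sub]
        ring }
  obtain ⟨d, hd⟩ := LieDerivation.IsKilling.exists_eq_ad D'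
  refine ⟨d, fun x y => ?_⟩
  have h1 : D (π x) = ⁅d, π x⁆ := by
    have := LieDerivation.congr_fun hd (π x)
    rw [LieDerivation.ad_apply_apply] at this
    exact this.symm
  rw [← hω, ← hD, h1, hinv, LieHom.map_lie]

include hπ hker in
/-- The centre meets the derived algebra trivially. -/
lemma eq_zero_of_mem_derived {u : g} (hu : u ∈ Submodule.span ℂ {u : g | ∃ x y : g, ⁅x, y⁆ = u})
    (h : π u = 0) : u = 0 := by
  by_contra hne
  obtain ⟨l, hl⟩ := Module.exists_dual_forall_apply_ne_zero (K := ℂ) (fun _ : Unit => u)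
    (fun _ => hne)
  obtain ⟨d, hd⟩ := exists_killingForm_eq hπ hker l
  have key : ∀ v ∈ Submodule.span ℂ {u : g | ∃ x y : g, ⁅x, y⁆ = u},
      l v = killingForm ℂ L d (π v) := by
    intro v hv
    induction hv using Submodule.span_induction with
    | mem u hu => obtain ⟨x, y, rfl⟩ := hu; exact hd x y
    | zero => simp
    | add u v _ _ h1 h2 => simp [h1, h2]
    | smul c u _ h1 => simp [h1]
  exact hl () ((key u hu).trans (by rw [h, map_zero]))

end Quotient

end ReductivePair


set_option linter.unusedSectionVars false

namespace ReductivePair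

open Module LieAlgebra LieModule

/-! ### Roots and root spaces of `g` and of its semisimple quotient -/

section Transfer

variable {g : Type*} [LieRing g] [LieAlgebra ℂ g] {H : LieSubalgebra ℂ g}

lemma mem_rootSubspace {α : Dual ℂ H} {x : g} :
    x ∈ rootSubspace H α ↔ ∀ h : H, ⁅(h : g), x⁆ = α h • x :=
  mem_weightSpace _ _

lemma lie_mem_rootSubspace {α β : Dual ℂ H} {x y : g} (hx : x ∈ rootSubspace H α)
    (hy : y ∈ rootSubspace H β) : ⁅x, y⁆ ∈ rootSubspace H (α + β) := by
  rw [mem_rootSubspace] at *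
  intro h
  rw [leibniz_lie, hx h, hy h, smul_lie, lie_smul, LinearMap.add_apply, add_smul]

variable [FiniteDimensional ℂ g] [H.IsCartanSubalgebra]
  {L : Type*} [LieRing L] [LieAlgebra ℂ L] [FiniteDimensional ℂ L] [IsKilling ℂ L]
  {π : g →ₗ⁅ℂ⁆ L} (hπ : Function.Surjective π) (hker : ∀ x, π x = 0 ↔ ∀ y : g, ⁅x, y⁆ = 0)

include hker in
lemma mem_of_map_eq_zero {x : g} (hx : π x = 0) : x ∈ H := by
  rw [← LieSubalgebra.IsCartanSubalgebra.self_normalizing (H := H), LieSubalgebra.mem_normalizer_iff]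
  intro y _
  rw [(hker x).1 hx y]
  exact H.zero_mem

include hker in
lemma mem_of_map_mem_map {x : g} (hx : π x ∈ H.map π) : x ∈ H := by
  obtain ⟨y, hy, hxy⟩ := (LieSubalgebra.mem_map _ _ _).1 hx
  have : x - y ∈ H := mem_of_map_eq_zero hker (by rw [map_sub, ← hxy, sub_self])
  simpa using H.add_mem this hy

include hπ hker in
lemma isCartanSubalgebra_map : (H.map π).IsCartanSubalgebra where
  nilpotent := by
    let f : H →ₗ⁅ℂ⁆ H.map π :=
      { toFun := fun x => ⟨π x, (LieSubalgebra.mem_map _ _ _).2 ⟨x, x.2, rfl⟩⟩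
        map_add' := fun x y => Subtype.ext (map_add π _ _)
        map_smul' := fun c x => Subtype.ext (map_smul π _ _)
        map_lie' := fun {x y} => Subtype.ext (π.map_lie x y) }
    refine Function.Surjective.lieAlgebra_isNilpotent (R := ℂ) (f := f) ?_
    rintro ⟨y, hy⟩
    obtain ⟨x, hx, rfl⟩ := (LieSubalgebra.mem_map _ _ _).1 hy
    exact ⟨⟨x, hx⟩, rfl⟩
  self_normalizing := by
    refine le_antisymm ?_ (LieSubalgebra.le_normalizer _)
    intro y hy
    obtain ⟨x, rfl⟩ := hπ y
    refine (LieSubalgebra.mem_map _ _ _).2 ⟨x, ?_, rfl⟩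
    rw [← LieSubalgebra.IsCartanSubalgebra.self_normalizing (H := H),
      LieSubalgebra.mem_normalizer_iff]
    intro z hz
    refine mem_of_map_mem_map hker ?_
    rw [LieHom.map_lie]
    exact (LieSubalgebra.mem_normalizer_iff _ _).1 hy _ ((LieSubalgebra.mem_map _ _ _).2 ⟨z, hz, rfl⟩)

variable [(H.map π).IsCartanSubalgebra]

variable (H π) in
/-- The restriction of `π` to a Cartan subalgebra. -/
def cartanMap : H →ₗ[ℂ] (H.map π) where
  toFun x := ⟨π x, (LieSubalgebra.mem_map _ _ _).2 ⟨x, x.2, rfl⟩⟩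
  map_add' _ _ := Subtype.ext (map_add π _ _)
  map_smul' _ _ := Subtype.ext (map_smul π _ _)

lemma cartanMap_surjective : Function.Surjective (cartanMap H π) := by
  rintro ⟨y, hy⟩
  obtain ⟨x, hx, rfl⟩ := (LieSubalgebra.mem_map _ _ _).1 hy
  exact ⟨⟨x, hx⟩, rfl⟩

include hπ hker in
-- Cartan subalgebras of the quotient are abelian, and `π` is injective on the derived algebra.
lemma lie_eq_zero_of_mem {x y : g} (hx : x ∈ H) (hy : y ∈ H) : ⁅x, y⁆ = 0 := by
  refine eq_zero_of_mem_derived hπ hker (Submodule.subset_span ⟨x, y, rfl⟩) ?_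
  rw [LieHom.map_lie]
  have h1 : ⁅cartanMap H π ⟨x, hx⟩, cartanMap H π ⟨y, hy⟩⁆ = 0 := trivial_lie_zero _ _ _ _
  exact congrArg Subtype.val h1

variable (H π) in
/-- The pullback of a weight of the quotient. -/
noncomputable def pull (χ : Weight ℂ (H.map π) L) : Dual ℂ H := χ.toLinear ∘ₗ cartanMap H π

lemma pull_apply (χ : Weight ℂ (H.map π) L) (h : H) : pull H π χ h = χ (cartanMap H π h) := rfl

lemma pull_eq_zero_iff {χ : Weight ℂ (H.map π) L} : pull H π χ = 0 ↔ χ.IsZero := by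
  constructor
  · intro h
    refine funext fun y => ?_
    obtain ⟨x, rfl⟩ := cartanMap_surjective y
    exact LinearMap.congr_fun h x
  · intro h
    ext x
    exact congrFun h _

include hker in
-- A root vanishes on the centre, and its root vectors are not central, so their images are weight
-- vectors of the quotient.
lemma exists_eq_pull {α : Dual ℂ H} (hα : α ∈ roots H) :
    ∃ χ : Weight ℂ (H.map π) L, χ.IsNonZero ∧ α = pull H π χ := by
  obtain ⟨h0, hne⟩ := hα
  obtain ⟨x, hx, hx0⟩ := Submodule.exists_mem_ne_zero_of_ne_bot hne
  rw [mem_rootSubspace] at hx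
  have hk : ∀ z : H, cartanMap H π z = 0 → α z = 0 := fun z hz => by
    have h1 : ⁅(z : g), x⁆ = 0 := (hker z).1 (congrArg Subtype.val hz) x
    rw [hx z] at h1
    exact (smul_eq_zero.1 h1).resolve_right hx0
  obtain ⟨s, hs⟩ := (cartanMap H π).exists_rightInverse_of_surjective
    (LinearMap.range_eq_top.2 cartanMap_surjective)
  have hs' : ∀ h, α (s (cartanMap H π h)) = α h := fun h => by
    rw [← sub_eq_zero, ← map_sub]
    exact hk _ (by rw [map_sub]; exact sub_eq_zero.2 (LinearMap.congr_fun hs _))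
  have hmem : π x ∈ weightSpace L (fun y => α (s y) : H.map π → ℂ) := by
    rw [mem_weightSpace]
    intro y
    obtain ⟨h, rfl⟩ := cartanMap_surjective y
    rw [hs']
    exact (π.map_lie h x).symm.trans (by rw [hx h, map_smul])
  have hx1 : π x ≠ 0 := by
    intro h
    refine h0 (LinearMap.ext fun z => ?_)
    have h1 : ⁅(z : g), x⁆ = 0 := by rw [← lie_skew, (hker x).1 h, neg_zero]
    rw [hx z] at h1
    exact (smul_eq_zero.1 h1).resolve_right hx0
  let χ : Weight ℂ (H.map π) L := ⟨fun y => α (s y), fun h => hx1 (by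
    have := weightSpace_le_genWeightSpace L _ hmem
    rw [h] at this
    exact (LieSubmodule.mem_bot _).1 this)⟩
  have hp : α = pull H π χ := by ext h; exact (hs' h).symm
  exact ⟨χ, fun h => h0 (hp.trans (pull_eq_zero_iff.2 h)), hp⟩

lemma map_mem_rootSpace {χ : Weight ℂ (H.map π) L} {x : g} (hx : x ∈ rootSubspace H (pull H π χ)) :
    π x ∈ rootSpace (H.map π) χ := by
  refine weightSpace_le_genWeightSpace L _ ?_
  rw [mem_weightSpace]
  intro y
  obtain ⟨h, rfl⟩ := cartanMap_surjective y
  exact (π.map_lie h x).symm.trans (by rw [mem_rootSubspace.1 hx h, map_smul]; rfl)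

include hπ hker in
-- An arbitrary preimage is a root vector up to a central error, which bracketing with some `h0`, `α
-- h0 = 1`, removes. The function `χ` is not required to be a `Weight`, so that opposite root spaces
-- are covered as well.
lemma exists_lift {χ : H.map π → ℂ} {α : Dual ℂ H} (h0 : α ≠ 0)
    (hχ : ∀ h, α h = χ (cartanMap H π h)) {y : L} (hy : y ∈ rootSpace (H.map π) χ) :
    ∃ x ∈ rootSubspace H α, π x = y := by
  obtain ⟨h0, hh0⟩ : ∃ h0 : H, α h0 = 1 := by
    obtain ⟨h, hh⟩ : ∃ h, α h ≠ 0 := by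
      by_contra! h; exact h0 (LinearMap.ext h)
    exact ⟨(α h)⁻¹ • h, by rw [map_smul, smul_eq_mul, inv_mul_cancel₀ hh]⟩
  obtain ⟨x, rfl⟩ := hπ y
  have hy' : ∀ h : H, π ⁅(h : g), x⁆ = α h • π x := fun h => by
    rw [LieHom.map_lie, hχ]
    exact IsKilling.lie_eq_smul_of_mem_rootSpace hy (cartanMap H π h)
  refine ⟨⁅(h0 : g), x⁆, ?_, by rw [hy', hh0, one_smul]⟩
  rw [mem_rootSubspace]
  intro h
  rw [leibniz_lie, lie_eq_zero_of_mem hπ hker h.2 h0.2, zero_lie, zero_add]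
  have h1 : π (⁅(h : g), x⁆ - α h • x) = 0 := by rw [map_sub, hy', map_smul, sub_self]
  have h2 := (hker _).1 h1 h0
  rw [← lie_skew, neg_eq_zero, lie_sub, lie_smul, sub_eq_zero] at h2
  exact h2

include hker in
lemma eq_zero_of_mem_rootSubspace {α : Dual ℂ H} (h0 : α ≠ 0) {x : g} (hx : x ∈ rootSubspace H α)
    (h : π x = 0) : x = 0 := by
  by_contra hx0
  refine h0 (LinearMap.ext fun z => ?_)
  have h1 : ⁅(z : g), x⁆ = 0 := by rw [← lie_skew, (hker x).1 h, neg_zero]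
  rw [mem_rootSubspace.1 hx z] at h1
  exact (smul_eq_zero.1 h1).resolve_right hx0

include hπ hker in
lemma pull_mem_roots {χ : Weight ℂ (H.map π) L} (hχ : χ.IsNonZero) : pull H π χ ∈ roots H := by
  have h0 : pull H π χ ≠ 0 := fun h => hχ (pull_eq_zero_iff.1 h)
  refine ⟨h0, fun hbot => ?_⟩
  obtain ⟨y, hy, hy0⟩ : ∃ y ∈ rootSpace (H.map π) χ, y ≠ 0 := by
    by_contra! h
    exact Weight.genWeightSpace_ne_bot L χ ((LieSubmodule.eq_bot_iff _).2 h)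
  obtain ⟨x, hx, rfl⟩ := exists_lift hπ hker h0 (fun _ => rfl) hy
  rw [hbot, Submodule.mem_bot] at hx
  exact hy0 (by rw [hx, map_zero])

include hker in
lemma exists_eq_smul_of_mem {α : Dual ℂ H} (hα : α ∈ roots H) {e f : g}
    (he : e ∈ rootSubspace H α) (he0 : e ≠ 0) (hf : f ∈ rootSubspace H α) : ∃ c : ℂ, f = c • e := by
  obtain ⟨χ, hχ, rfl⟩ := exists_eq_pull hker hα
  have h1 := IsKilling.finrank_rootSpace_eq_one χ hχ
  have he' : (⟨π e, map_mem_rootSpace he⟩ : rootSpace (H.map π) χ) ≠ 0 := fun h =>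
    he0 (eq_zero_of_mem_rootSubspace hker hα.1 he (congrArg Subtype.val h))
  obtain ⟨c, hc⟩ := (finrank_eq_one_iff_of_nonzero' _ he').1 h1 ⟨π f, map_mem_rootSpace hf⟩
  refine ⟨c, ?_⟩
  rw [← sub_eq_zero]
  refine eq_zero_of_mem_rootSubspace hker hα.1
    (Submodule.sub_mem _ hf (Submodule.smul_mem _ c he)) ?_
  rw [map_sub, map_smul, sub_eq_zero]
  exact (congrArg Subtype.val hc).symm

include hπ hker in
lemma iSup_rootSubspace_eq_top : H.toSubmodule ⊔ ⨆ α ∈ roots H, rootSubspace H α = ⊤ := by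
  rw [eq_top_iff]
  rintro x -
  have key : ∀ y : L, ∃ x ∈ H.toSubmodule ⊔ ⨆ α ∈ roots H, rootSubspace H α, π x = y := by
    intro y
    have hy : y ∈ ⨆ χ : Weight ℂ (H.map π) L, genWeightSpace L χ := by
      rw [iSup_genWeightSpace_eq_top']; trivial
    induction hy using LieSubmodule.iSup_induction' with
    | mem χ y hy =>
      by_cases hχ : χ.IsZero
      · have h1 : y ∈ rootSpace (H.map π) (0 : H.map π → ℂ) := by rw [← hχ.eq]; exact hy
        rw [rootSpace_zero_eq] at h1
        obtain ⟨x, hx, rfl⟩ := (LieSubalgebra.mem_map _ _ _).1 h1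
        exact ⟨x, Submodule.mem_sup_left hx, rfl⟩
      · have hr := pull_mem_roots hπ hker hχ
        obtain ⟨x, hx, rfl⟩ := exists_lift hπ hker hr.1 (fun _ => rfl) hy
        exact ⟨x, Submodule.mem_sup_right (Submodule.mem_iSup_of_mem _
          (Submodule.mem_iSup_of_mem hr hx)), rfl⟩
    | zero => exact ⟨0, Submodule.zero_mem _, map_zero _⟩
    | add y z _ _ h1 h2 =>
      obtain ⟨a, ha, rfl⟩ := h1
      obtain ⟨b, hb, rfl⟩ := h2
      exact ⟨a + b, Submodule.add_mem _ ha hb, map_add _ _ _⟩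
  obtain ⟨x', hx', h⟩ := key (π x)
  have : x - x' ∈ H := mem_of_map_eq_zero hker (by rw [map_sub, h, sub_self])
  simpa using Submodule.add_mem _ (Submodule.mem_sup_left this) hx'

include hπ hker in
lemma exists_isCorootOf {χ : Weight ℂ (H.map π) L} (hχ : χ.IsNonZero) :
    ∃ c : H, IsCorootOf H (pull H π χ) c ∧ cartanMap H π c = IsKilling.coroot χ := by
  obtain ⟨h, e, f, ht, he, hf⟩ := IsKilling.exists_isSl2Triple_of_weight_isNonZero hχ
  have hh := ht.h_eq_coroot hχ he hf
  have h0 : pull H π χ ≠ 0 := fun h => hχ (pull_eq_zero_iff.1 h)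
  obtain ⟨e, he', rfl⟩ := exists_lift hπ hker h0 (fun _ => rfl) he
  obtain ⟨f, hf', rfl⟩ := exists_lift (α := -pull H π χ) hπ hker (neg_ne_zero.2 h0) (fun _ => rfl) hf
  have hc : π ⁅e, f⁆ = IsKilling.coroot χ := by rw [LieHom.map_lie, ht.lie_e_f, hh]
  have hmem : ⁅e, f⁆ ∈ H := mem_of_map_mem_map hker (by rw [hc]; exact (IsKilling.coroot χ).2)
  have hcc : cartanMap H π ⟨⁅e, f⁆, hmem⟩ = IsKilling.coroot χ := Subtype.ext hc
  refine ⟨⟨⁅e, f⁆, hmem⟩, ⟨?_, e, he', f, hf', rfl⟩, hcc⟩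
  rw [pull_apply, hcc, IsKilling.root_apply_coroot hχ]

end Transfer

end ReductivePair


set_option linter.unusedSectionVars false

namespace ReductivePair

open Module LieAlgebra LieModule

section Transfer

variable {g : Type*} [LieRing g] [LieAlgebra ℂ g] {H : LieSubalgebra ℂ g}

variable [FiniteDimensional ℂ g] [H.IsCartanSubalgebra]
  {L : Type*} [LieRing L] [LieAlgebra ℂ L] [FiniteDimensional ℂ L] [IsKilling ℂ L]
  {π : g →ₗ⁅ℂ⁆ L} (hπ : Function.Surjective π) (hker : ∀ x, π x = 0 ↔ ∀ y : g, ⁅x, y⁆ = 0)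
  [(H.map π).IsCartanSubalgebra]

lemma IsCorootOf.cartanMap_eq {χ : Weight ℂ (H.map π) L} {c : H}
    (hc : IsCorootOf H (pull H π χ) c) : cartanMap H π c = IsKilling.coroot χ := by
  obtain ⟨h2, x, hx, y, hy, hxy⟩ := hc
  refine IsKilling.eq_coroot_of_mem_corootSpace_of_two χ ?_ h2
  rw [mem_corootSpace]
  refine Submodule.subset_span ⟨π x, map_mem_rootSpace hx, π y, ?_, ?_⟩
  · refine weightSpace_le_genWeightSpace L _ ?_
    rw [mem_weightSpace]
    intro z
    obtain ⟨h, rfl⟩ := cartanMap_surjective z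
    exact (π.map_lie h y).symm.trans (by rw [mem_rootSubspace.1 hy h, map_smul]; rfl)
  · rw [← LieHom.map_lie, ← hxy]; rfl

lemma IsCorootOf.mem_derived {α : Dual ℂ H} {c : H} (hc : IsCorootOf H α c) :
    (c : g) ∈ Submodule.span ℂ {u : g | ∃ x y : g, ⁅x, y⁆ = u} := by
  obtain ⟨-, x, -, y, -, hxy⟩ := hc
  exact Submodule.subset_span ⟨x, y, hxy.symm⟩

end Transfer

/-! ### The root data of a reductive pair -/

section Reductive

variable {g : Type*} [LieRing g] [LieAlgebra ℂ g] [FiniteDimensional ℂ g]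
  [HasCentralRadical ℂ g] (H : LieSubalgebra ℂ g) [H.IsCartanSubalgebra]

instance : (H.map (modCenter g)).IsCartanSubalgebra :=
  isCartanSubalgebra_map modCenter_surjective fun _ => modCenter_eq_zero_iff

/-- The image of a Cartan subalgebra in the quotient by the centre. -/
abbrev cartanQuot : LieSubalgebra ℂ (g ⧸ center ℂ g) := H.map (modCenter g)

variable {H}

lemma cartan_lie {x y : g} (hx : x ∈ H) (hy : y ∈ H) : ⁅x, y⁆ = 0 :=
  lie_eq_zero_of_mem modCenter_surjective (fun _ => modCenter_eq_zero_iff) hx hy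

lemma exists_eq_smul_of_mem_rootSubspace {α : Dual ℂ H} (hα : α ∈ roots H) {e f : g}
    (he : e ∈ rootSubspace H α) (he0 : e ≠ 0) (hf : f ∈ rootSubspace H α) : ∃ c : ℂ, f = c • e :=
  exists_eq_smul_of_mem (fun _ => modCenter_eq_zero_iff) hα he he0 hf

variable (H) in
lemma cartan_sup_iSup_rootSubspace : H.toSubmodule ⊔ ⨆ α ∈ roots H, rootSubspace H α = ⊤ :=
  iSup_rootSubspace_eq_top modCenter_surjective fun _ => modCenter_eq_zero_iff

lemma exists_eq_pull_center {α : Dual ℂ H} (hα : α ∈ roots H) :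
    ∃ χ : Weight ℂ (cartanQuot H) (g ⧸ center ℂ g), χ.IsNonZero ∧ α = pull H (modCenter g) χ :=
  exists_eq_pull (fun _ => modCenter_eq_zero_iff) hα

/-- Two candidates have the same image in the quotient, and both are brackets, so their difference
is a central element of the derived algebra. -/
lemma IsCorootOf.unique {α : Dual ℂ H} (hα : α ∈ roots H) {c d : H} (hc : IsCorootOf H α c)
    (hd : IsCorootOf H α d) : c = d := by
  obtain ⟨χ, -, rfl⟩ := exists_eq_pull_center hα
  have h1 : cartanMap H (modCenter g) (c - d) = 0 := by
    rw [map_sub, hc.cartanMap_eq, hd.cartanMap_eq, sub_self]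
  have h2 := eq_zero_of_mem_derived modCenter_surjective (fun _ => modCenter_eq_zero_iff)
    (Submodule.sub_mem _ hc.mem_derived hd.mem_derived) (congrArg Subtype.val h1)
  exact Subtype.ext (sub_eq_zero.1 h2)

lemma exists_corootOf {α : Dual ℂ H} (hα : α ∈ roots H) : ∃ c, IsCorootOf H α c := by
  obtain ⟨χ, hχ, rfl⟩ := exists_eq_pull_center hα
  obtain ⟨c, hc, -⟩ := exists_isCorootOf modCenter_surjective (fun _ => modCenter_eq_zero_iff) hχ
  exact ⟨c, hc⟩

variable (H) in
open Classical in
/-- The coroot of a root. -/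
noncomputable def corootOf (α : Dual ℂ H) : H :=
  if h : ∃ c, IsCorootOf H α c then h.choose else 0

lemma isCorootOf_corootOf {α : Dual ℂ H} (hα : α ∈ roots H) : IsCorootOf H α (corootOf H α) := by
  have h := exists_corootOf hα
  rw [corootOf, dif_pos h]
  exact h.choose_spec

lemma apply_corootOf {χ ψ : Weight ℂ (cartanQuot H) (g ⧸ center ℂ g)} (hχ : χ.IsNonZero) :
    pull H (modCenter g) ψ (corootOf H (pull H (modCenter g) χ)) = ψ (IsKilling.coroot χ) := by
  rw [pull_apply, (isCorootOf_corootOf (pull_mem_roots modCenter_surjective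
    (fun _ => modCenter_eq_zero_iff) hχ)).cartanMap_eq]

variable (H) in
lemma roots_finite : (roots H).Finite := by
  have : Finite (Weight ℂ (cartanQuot H) (g ⧸ center ℂ g)) := inferInstance
  refine (Set.finite_range (pull H (modCenter g))).subset fun α hα => ?_
  obtain ⟨χ, -, rfl⟩ := exists_eq_pull_center hα
  exact ⟨χ, rfl⟩

lemma pull_mem {χ : Weight ℂ (cartanQuot H) (g ⧸ center ℂ g)} (hχ : χ.IsNonZero) :
    pull H (modCenter g) χ ∈ roots H :=
  pull_mem_roots modCenter_surjective (fun _ => modCenter_eq_zero_iff) hχ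

lemma pull_injective : Function.Injective (pull H (modCenter g)) := by
  intro χ ψ h
  ext y
  obtain ⟨x, rfl⟩ := cartanMap_surjective y
  exact LinearMap.congr_fun h x

lemma sum_roots_eq {M : Type*} [AddCommMonoid M] (F : Dual ℂ H → M) :
    ∑ γ ∈ (roots_finite H).toFinset, F γ =
      ∑ i : (cartanQuot H).root, F (pull H (modCenter g) i) := by
  refine (Finset.sum_nbij (fun i : (cartanQuot H).root => pull H (modCenter g) i) ?_ ?_ ?_ ?_).symm
  · intro i _
    rw [Set.Finite.mem_toFinset]
    exact pull_mem ((cartanQuot H).isNonZero_coe_root i)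
  · exact fun i _ j _ h => Subtype.ext (pull_injective h)
  · intro α hα
    obtain ⟨χ, hχ, rfl⟩ := exists_eq_pull_center ((Set.Finite.mem_toFinset _).1 hα)
    exact ⟨⟨χ, by simpa using hχ⟩, by simp, rfl⟩
  · exact fun _ _ => rfl

/-- Both sides lie in the derived algebra, so the identity can be tested in the semisimple quotient,
where it is the standard formula for the root form. -/
lemma sum_smul_corootOf {α : Dual ℂ H} (hα : α ∈ roots H) :
    (∑ γ ∈ (roots_finite H).toFinset, α (corootOf H γ) * α (corootOf H γ)) • corootOf H α =
      (2 : ℂ) • ∑ γ ∈ (roots_finite H).toFinset, α (corootOf H γ) • corootOf H γ := by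
  have hder : ∀ γ ∈ roots H, (corootOf H γ : g) ∈
      Submodule.span ℂ {u : g | ∃ x y : g, ⁅x, y⁆ = u} := fun γ hγ =>
    (isCorootOf_corootOf hγ).mem_derived
  rw [← sub_eq_zero]
  refine Subtype.ext (eq_zero_of_mem_derived modCenter_surjective
    (fun _ => modCenter_eq_zero_iff) ?_ ?_)
  · simp only [AddSubgroupClass.coe_sub, SetLike.val_smul, AddSubmonoidClass.coe_finsetSum]
    refine Submodule.sub_mem _ (Submodule.smul_mem _ _ (hder α hα))
      (Submodule.smul_mem _ _ (Submodule.sum_mem _ fun γ hγ => Submodule.smul_mem _ _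
        (hder γ ((Set.Finite.mem_toFinset _).1 hγ))))
  · refine congrArg Subtype.val (?_ : cartanMap H (modCenter g) _ = 0)
    obtain ⟨χ, hχ, rfl⟩ := exists_eq_pull_center hα
    have hc : ∀ i : (cartanQuot H).root, cartanMap H (modCenter g)
        (corootOf H (pull H (modCenter g) i)) = IsKilling.coroot i.1 := fun i =>
      (isCorootOf_corootOf (pull_mem ((cartanQuot H).isNonZero_coe_root i))).cartanMap_eq
    have hp : ∀ i : (cartanQuot H).root, pull H (modCenter g) χ
        (corootOf H (pull H (modCenter g) i)) = χ (IsKilling.coroot i.1) := fun i =>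
      apply_corootOf ((cartanQuot H).isNonZero_coe_root i)
    rw [sum_roots_eq, sum_roots_eq, map_sub, map_smul, map_smul, map_sum, sub_eq_zero,
      hc ⟨χ, by simpa using hχ⟩]
    simp only [map_smul, hc, hp]
    have := (IsKilling.rootSystem (cartanQuot H)).rootForm_self_smul_coroot ⟨χ, by simpa using hχ⟩
    rw [RootPairing.Polarization_apply, RootPairing.rootForm_apply_apply] at this
    rw [ofNat_smul_eq_nsmul]
    simpa using this

lemma smul_mem_roots_imp {α : Dual ℂ H} (hα : α ∈ roots H) {c : ℂ} (h : c • α ∈ roots H) :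
    c = 1 ∨ c = -1 := by
  obtain ⟨χ, hχ, rfl⟩ := exists_eq_pull_center hα
  obtain ⟨ψ, hψ, h'⟩ := exists_eq_pull_center h
  have h1 : (ψ : cartanQuot H → ℂ) = c • (χ : cartanQuot H → ℂ) := by
    funext y
    obtain ⟨x, rfl⟩ := cartanMap_surjective y
    exact (LinearMap.congr_fun h' x).symm
  have hc : ∀ d : ℂ, c • pull H (modCenter g) χ = d • pull H (modCenter g) χ → c = d := fun d hd => by
    rw [← sub_eq_zero, ← sub_smul] at hd
    exact sub_eq_zero.1 ((smul_eq_zero.1 hd).resolve_right hα.1)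
  rcases IsKilling.eq_neg_or_eq_of_eq_smul χ ψ hψ c h1 with rfl | rfl
  · right; apply hc; rw [h', neg_one_smul]; ext x; simp [pull_apply]
  · left; apply hc; rw [h', one_smul]

/-- The root system of a reductive pair. -/
noncomputable def rootData (x : H) (hx : ∀ α ∈ roots H, (α x).im = 0 ∧ (α x).re ≠ 0) :
    RootData (Dual ℂ H) where
  Φ := roots H
  finite := roots_finite H
  co α := Dual.eval ℂ H (corootOf H α)
  co_self α hα := (isCorootOf_corootOf hα).1
  exists_int α hα β hβ := by
    obtain ⟨χ, hχ, rfl⟩ := exists_eq_pull_center hα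
    obtain ⟨ψ, hψ, rfl⟩ := exists_eq_pull_center hβ
    rw [Dual.eval_apply, apply_corootOf hχ, IsKilling.apply_coroot_eq_cast]
    exact ⟨_, rfl⟩
  sub_smul_mem α hα β hβ := by
    obtain ⟨χ, hχ, rfl⟩ := exists_eq_pull_center hα
    obtain ⟨ψ, hψ, rfl⟩ := exists_eq_pull_center hβ
    rw [Dual.eval_apply, apply_corootOf hχ]
    have := pull_mem (H := H) (IsKilling.reflectRoot_isNonZero χ ψ hψ)
    have he : pull H (modCenter g) ψ - ψ (IsKilling.coroot χ) • pull H (modCenter g) χ =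
        pull H (modCenter g) (IsKilling.reflectRoot χ ψ) := by ext h; rfl
    rwa [he]
  eq_one_or_neg_one α hα c h := smul_mem_roots_imp hα h
  sub_mem α hα β hβ hne n hn hpos := by
    obtain ⟨χ, hχ, rfl⟩ := exists_eq_pull_center hα
    obtain ⟨ψ, hψ, rfl⟩ := exists_eq_pull_center hβ
    rw [Dual.eval_apply, apply_corootOf hχ, IsKilling.apply_coroot_eq_cast] at hn
    have hn' : (chainBotCoeff χ ψ : ℤ) - chainTopCoeff χ ψ = n := by exact_mod_cast hn
    -- The pairing is the bottom minus the top length of the `χ`-string through `ψ`. Being positive,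
    -- it leaves room for one step down.
    have h1 := (IsKilling.rootSpace_zsmul_add_ne_bot_iff χ ψ hχ (-1)).2 ⟨by omega, by omega⟩
    let ω : Weight ℂ (cartanQuot H) (g ⧸ center ℂ g) := ⟨_, h1⟩
    have h2 : pull H (modCenter g) ψ - pull H (modCenter g) χ = pull H (modCenter g) ω := by
      ext h
      change ψ _ - χ _ = ((-1 : ℤ) • (χ : cartanQuot H → ℂ) + ψ) _
      simp only [Int.reduceNeg, neg_smul, one_smul, Pi.add_apply, Pi.neg_apply]
      ring
    rw [h2]
    refine pull_mem fun h0 => hne ?_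
    rw [← sub_eq_zero, ← neg_eq_zero, neg_sub, h2, pull_eq_zero_iff]
    exact h0
  separating v hv h := by
    -- Elements of the span of the roots are pulled back from the quotient, where the coroots span
    -- the Cartan subalgebra.
    obtain ⟨u, rfl⟩ : ∃ u : Dual ℂ (cartanQuot H), v = u ∘ₗ cartanMap H (modCenter g) := by
      clear h
      induction hv using Submodule.span_induction with
      | mem v hv =>
        obtain ⟨χ, -, rfl⟩ := exists_eq_pull_center hv
        exact ⟨χ.toLinear, rfl⟩
      | zero => exact ⟨0, rfl⟩
      | add v w _ _ h1 h2 =>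
        obtain ⟨a, rfl⟩ := h1
        obtain ⟨b, rfl⟩ := h2
        exact ⟨a + b, rfl⟩
      | smul c v _ h1 =>
        obtain ⟨a, rfl⟩ := h1
        exact ⟨c • a, rfl⟩
    have hu : u = 0 := by
      ext y
      have hy : y ∈ Submodule.span ℂ (Set.range (IsKilling.rootSystem (cartanQuot H)).coroot) := by
        rw [RootPairing.IsRootSystem.span_coroot_eq_top]; trivial
      induction hy using Submodule.span_induction with
      | mem y hy =>
        obtain ⟨i, rfl⟩ := hy
        have hi := pull_mem (H := H) ((cartanQuot H).isNonZero_coe_root i)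
        have := h _ hi
        rw [Dual.eval_apply, LinearMap.comp_apply, (isCorootOf_corootOf hi).cartanMap_eq] at this
        exact this
      | zero => simp
      | add v w _ _ h1 h2 => simp_all
      | smul c v _ h1 => simp_all
    rw [hu, LinearMap.zero_comp]
  co_mul_form α hα v := by
    have := congrArg v (sum_smul_corootOf hα)
    simp only [map_smul, map_sum, smul_eq_mul] at this
    simp only [Dual.eval_apply]
    rw [mul_comm, this]
  ht := Complex.reLm ∘ₗ (Dual.eval ℂ H x).restrictScalars ℝ
  ht_ne_zero α hα := (hx α hα).2

end Reductive

end ReductivePair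


set_option linter.unusedSectionVars false

namespace ReductivePair

open Module LieAlgebra LieModule

/-! ### Translation to root data and the four equivalent conditions -/

section Dictionary

variable {g : Type*} [LieRing g] [LieAlgebra ℂ g] [FiniteDimensional ℂ g]
  [HasCentralRadical ℂ g] {H : LieSubalgebra ℂ g} [H.IsCartanSubalgebra]
  {x : H} {hx : ∀ α ∈ roots H, (α x).im = 0 ∧ (α x).re ≠ 0}

lemma isReflectionOf_iff {α : Dual ℂ H} (hα : α ∈ roots H) {s : Dual ℂ H ≃ₗ[ℂ] Dual ℂ H} :
    IsReflectionOf H α s ↔ s = (rootData x hx).refl α := by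
  have hα' : α ∈ (rootData x hx).Φ := hα
  constructor
  · rintro ⟨c, hc, h⟩
    ext1 μ
    rw [h, RootData.refl_apply hα', hc.unique hα (isCorootOf_corootOf hα)]
    rfl
  · rintro rfl
    exact ⟨_, isCorootOf_corootOf hα, fun μ => RootData.refl_apply hα' μ⟩

variable (hx) in
lemma reflections_eq {R : Set (Dual ℂ H)} (hR : R ⊆ roots H) :
    reflections H R = (rootData x hx).refl '' R := by
  ext s
  constructor
  · rintro ⟨α, hα, h⟩
    exact ⟨α, hα, ((isReflectionOf_iff (hR hα)).1 h).symm⟩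
  · rintro ⟨α, hα, rfl⟩
    exact ⟨α, hα, (isReflectionOf_iff (hR hα)).2 rfl⟩

variable (hx) in
lemma weylGroup_eq (A : AddSubgroup (Dual ℂ H)) :
    weylGroup H (roots H ∩ A) = (rootData x hx).W A := by
  rw [weylGroup, reflections_eq hx Set.inter_subset_left]; rfl

variable (hx) in
lemma weylGroup_roots : weylGroup H (roots H) = (rootData x hx).W ⊤ := by
  rw [← weylGroup_eq, AddSubgroup.coe_top, Set.inter_univ]

variable {Θ : Set (Dual ℂ H)}

/-- By definition `a_Θ` is the annihilator of the span of `Θ`, and in finite dimension the double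
annihilator returns the span. -/
lemma restrict_eq_zero_iff {v : Dual ℂ H} : restrict Θ v = 0 ↔ v ∈ Submodule.span ℂ Θ := by
  have h1 : centerLevi Θ = (Submodule.span ℂ Θ).dualCoannihilator := by
    ext y
    simp only [centerLevi, Submodule.mem_iInf, LinearMap.mem_ker, Submodule.mem_dualCoannihilator]
    constructor
    · intro h φ hφ
      induction hφ using Submodule.span_induction with
      | mem φ hφ => exact h φ hφ
      | zero => rfl
      | add a b _ _ ha hb => rw [LinearMap.add_apply, ha, hb, add_zero]
      | smul c a _ ha => rw [LinearMap.smul_apply, ha, smul_zero]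
    · exact fun h φ hφ => h φ (Submodule.subset_span hφ)
  rw [← Subspace.dualCoannihilator_dualAnnihilator_eq (W := Submodule.span ℂ Θ), ← h1,
    Submodule.mem_dualAnnihilator]
  exact ⟨fun h w hw => LinearMap.congr_fun h ⟨w, hw⟩, fun h => LinearMap.ext fun w => h w w.2⟩

lemma restrict_sub (v w : Dual ℂ H) : restrict Θ (v - w) = restrict Θ v - restrict Θ w := rfl

lemma rootsAlong_eq (α : Dual ℂ H) : rootsAlong H Θ α = roots H ∩ RootData.along Θ α := by
  ext β
  refine and_congr_right fun _ => exists_congr fun c => ?_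
  rw [← restrict_eq_zero_iff, restrict_sub, sub_eq_zero]
  rfl

/-- An element of maximal length exists and is unique, so the choice made by `Classical.epsilon` is
irrelevant. -/
lemma longestElement_eq (A : AddSubgroup (Dual ℂ H)) :
    longestElement H ((rootData x hx).pos ⊤) (roots H ∩ A) = (rootData x hx).longest A := by
  have h1 : roots H ∩ (A : Set (Dual ℂ H)) ∩ (rootData x hx).pos ⊤ = (rootData x hx).pos A := by
    ext β
    constructor
    · exact fun h => ⟨h.1, h.2.2⟩
    · exact fun h => ⟨h.1, ⟨h.1.1, trivial⟩, h.2⟩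
  have h2 : reflections H (simpleRoots (roots H ∩ (A : Set (Dual ℂ H)) ∩ (rootData x hx).pos ⊤)) =
      (rootData x hx).refl '' (rootData x hx).simple A := by
    rw [h1, reflections_eq hx (fun β hβ => hβ.1.1.1)]; rfl
  unfold longestElement
  rw [h2, weylGroup_eq hx]
  simp only [← RootData.isLongest_iff]
  exact (Classical.epsilon_spec ⟨_, RootData.isLongest_longest A⟩ :
    (rootData x hx).IsLongest A _).unique (RootData.isLongest_longest A)

lemma sigma_eq (α : Dual ℂ H) :
    sigma H ((rootData x hx).pos ⊤) Θ α = (rootData x hx).sig Θ α := by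
  have h : rootsOf H Θ = roots H ∩ (RootData.levi Θ : Set (Dual ℂ H)) := rfl
  rw [sigma, rootsAlong_eq, h, longestElement_eq, longestElement_eq]; rfl

lemma reflectionPart_eq :
    reflectionPart H ((rootData x hx).pos ⊤) Θ =
      Subgroup.closure ((rootData x hx).sig Θ '' {α | (rootData x hx).IsUsefulReduced Θ α}) := by
  have h1 : usefulReducedPosRoots H ((rootData x hx).pos ⊤) Θ =
      {α | (rootData x hx).IsUsefulReduced Θ α} := by
    ext α
    have hs : simpleRoots (rootsAlong H Θ α ∩ (rootData x hx).pos ⊤) =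
        (rootData x hx).simple (RootData.along Θ α) := by
      congr 1
      rw [rootsAlong_eq]
      ext β
      constructor
      · exact fun h => ⟨h.1, h.2.2⟩
      · exact fun h => ⟨h.1, ⟨h.1.1, trivial⟩, h.2⟩
    constructor
    · rintro ⟨⟨⟨-, h1⟩, h2⟩, h3, h4⟩
      rw [sigma_eq] at h1
      rw [hs] at h4
      exact ⟨h2, h1, fun h => h3 (restrict_eq_zero_iff.2 h), h4⟩
    · rintro ⟨h1, h2, h3, h4⟩
      refine ⟨⟨⟨h1.1.1, ?_⟩, h1⟩, fun h => h3 (restrict_eq_zero_iff.1 h), ?_⟩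
      · rwa [sigma_eq]
      · rwa [hs]
  rw [reflectionPart, h1]
  congr 1
  exact Set.image_congr fun α _ => sigma_eq α

lemma isNormal_iff : IsNormal H ((rootData x hx).pos ⊤) Θ ↔
    ∀ α ∈ (rootData x hx).simple ⊤, α ∉ Θ → orderOf ((rootData x hx).sig Θ α) = 2 := by
  constructor
  · intro h α hα hαΘ
    have := (h ⟨hα, hαΘ⟩).1.2
    rwa [sigma_eq] at this
  · rintro h α ⟨hα, hαΘ⟩
    refine ⟨⟨hα.1.1.1, ?_⟩, hα.1⟩
    rw [sigma_eq]
    exact h α hα hαΘ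

/-- The equivalence of the conditions on the Weyl group and on the restricted roots. -/
lemma tfae_isNormal (hΘ : Θ ⊆ (rootData x hx).simple ⊤) :
    List.TFAE
      [ IsNormal H ((rootData x hx).pos ⊤) Θ,
        simpleTransporter H ((rootData x hx).pos ⊤) Θ =
          (reflectionPart H ((rootData x hx).pos ⊤) Θ : Set _),
        simpleTransporter H ((rootData x hx).pos ⊤) Θ = stabilizerSet H Θ,
        usefulRestrictedRoots H ((rootData x hx).pos ⊤) Θ = restrictedRoots H Θ ] := by
  have hK : simpleTransporter H ((rootData x hx).pos ⊤) Θ =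
      {w | w ∈ (rootData x hx).W ⊤ ∧ w '' Θ ⊆ (rootData x hx).simple ⊤} := by
    rw [simpleTransporter, weylGroup_roots hx]; rfl
  have hS : stabilizerSet H Θ = {w | w ∈ (rootData x hx).W ⊤ ∧ w '' Θ = Θ} := by
    rw [stabilizerSet, weylGroup_roots hx]
  rw [hK, hS, reflectionPart_eq, isNormal_iff]
  tfae_have 1 → 2 := by
    intro h
    refine Set.Subset.antisymm (fun w hw => RootData.mem_closure_sig hΘ h hw.1 hw.2) ?_
    intro w hw
    obtain ⟨h1, h2⟩ := RootData.closure_sig_le hΘ hw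
    exact ⟨h1, h2.trans_subset hΘ⟩
  tfae_have 2 → 3 := by
    intro h
    refine Set.Subset.antisymm (fun w hw => ?_) (fun w hw => ⟨hw.1, hw.2.trans_subset hΘ⟩)
    rw [h] at hw
    exact RootData.closure_sig_le hΘ hw
  tfae_have 3 → 1 := by
    intro h α hα hαΘ
    refine RootData.orderOf_sig_of_transporter hΘ (fun w hw hwΘ => ?_) hα hαΘ
    exact (h.subset ⟨hw, hwΘ⟩).2
  tfae_have 1 → 4 := by
    intro h
    refine Set.Subset.antisymm ?_ ?_
    · rintro - ⟨α, ⟨hα, h2⟩, rfl⟩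
      refine ⟨⟨α, hα, rfl⟩, fun h0 => ?_⟩
      rw [sigma_eq, RootData.sig_eq_one hΘ (restrict_eq_zero_iff.1 h0), orderOf_one] at h2
      omega
    · rintro - ⟨⟨β, hβ, rfl⟩, h0⟩
      refine ⟨β, ⟨hβ, ?_⟩, rfl⟩
      rw [sigma_eq]
      exact RootData.orderOf_sig_of_normal hΘ h hβ fun h1 => h0 (restrict_eq_zero_iff.2 h1)
  tfae_have 4 → 1 := by
    intro h α hα hαΘ
    have h0 := RootData.notMem_span_of_simple hΘ hα hαΘ
    -- The useful root `β` that restricts to the same form need not be `α`, but `Δ(β) = Δ(α)` and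
    -- hence `σ_β = σ_α`.
    obtain ⟨β, ⟨hβ, hβ2⟩, hβα⟩ := h.symm.subset
      ⟨⟨α, hα.1.1.1, rfl⟩, fun h1 => h0 (restrict_eq_zero_iff.1 h1)⟩
    rw [sigma_eq] at hβ2
    have hsub : β - α ∈ Submodule.span ℂ Θ := by
      rw [← restrict_eq_zero_iff, restrict_sub, hβα, sub_self]
    have hβ0 : β ∉ Submodule.span ℂ Θ := fun h1 => h0 (by
      have := Submodule.sub_mem _ h1 hsub
      rwa [sub_sub_cancel] at this)
    rwa [RootData.sig_congr (RootData.along_eq_of_sub_mem hsub hβ0)] at hβ2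
  tfae_finish

end Dictionary

end ReductivePair


set_option linter.unusedSectionVars false

namespace ReductivePair

open Module LieAlgebra LieModule

/-! ### Sums of weight spaces and the Killing form -/

section WeightSpaces

variable {g : Type*} [LieRing g] [LieAlgebra ℂ g] [FiniteDimensional ℂ g]
  [HasCentralRadical ℂ g] {H : LieSubalgebra ℂ g} [H.IsCartanSubalgebra]

lemma rootSubspace_zero : rootSubspace H 0 = H.toSubmodule := by
  ext x
  rw [mem_rootSubspace]
  constructor
  · intro h
    change x ∈ H
    rw [← LieSubalgebra.IsCartanSubalgebra.self_normalizing (H := H),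
      LieSubalgebra.mem_normalizer_iff]
    intro y hy
    rw [← lie_skew, h ⟨y, hy⟩, LinearMap.zero_apply, zero_smul, neg_zero]
    exact H.zero_mem
  · intro hx h
    rw [LinearMap.zero_apply, zero_smul]
    exact cartan_lie h.2 hx

lemma rootSubspace_eq_bot {β : Dual ℂ H} (hβ : β ∉ insert 0 (roots H)) : rootSubspace H β = ⊥ := by
  by_contra h
  exact hβ (Or.inr ⟨fun h0 => hβ (Or.inl h0), h⟩)

variable (H) in
/-- The sum of the weight spaces of the weights in a set. -/
def weightSum (T : Set (Dual ℂ H)) : Submodule ℂ g := ⨆ β ∈ T, rootSubspace H β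

lemma rootSubspace_le_weightSum {T : Set (Dual ℂ H)} {β : Dual ℂ H} (hβ : β ∈ T) :
    rootSubspace H β ≤ weightSum H T := le_biSup (rootSubspace H) hβ

lemma weightSum_le_iff {T : Set (Dual ℂ H)} {N : Submodule ℂ g} :
    weightSum H T ≤ N ↔ ∀ β ∈ T, rootSubspace H β ≤ N := iSup₂_le_iff

lemma weightSum_mono {T U : Set (Dual ℂ H)} (h : T ⊆ U) : weightSum H T ≤ weightSum H U :=
  biSup_mono h

lemma weightSum_induction {T : Set (Dual ℂ H)} {p : g → Prop} {x : g} (hx : x ∈ weightSum H T)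
    (mem : ∀ β ∈ T, ∀ x ∈ rootSubspace H β, p x) (zero : p 0)
    (add : ∀ x y, p x → p y → p (x + y)) : p x := by
  refine Submodule.iSup_induction _ (motive := p) hx (fun β x hx => ?_) zero add
  exact Submodule.iSup_induction _ (motive := p) hx (fun h x hx => mem β h x hx) zero add

variable (H) in
lemma weightSum_insert_zero (T : Set (Dual ℂ H)) :
    weightSum H (insert 0 T) = H.toSubmodule ⊔ weightSum H T := by
  rw [weightSum, iSup_insert, rootSubspace_zero]; rfl

variable (H) in
lemma weightSum_roots : weightSum H (insert 0 (roots H)) = ⊤ := by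
  rw [weightSum_insert_zero]; exact cartan_sup_iSup_rootSubspace H

lemma rootSubspace_le_rootSpace (β : Dual ℂ H) :
    rootSubspace H β ≤ (rootSpace H (β : H → ℂ)).toSubmodule :=
  weightSpace_le_genWeightSpace g _

lemma iSupIndep_rootSubspace : iSupIndep (rootSubspace H) := by
  have h1 := LieSubmodule.iSupIndep_toSubmodule.2 (iSupIndep_genWeightSpace ℂ H g)
  have h2 := h1.comp (f := fun β : Dual ℂ H => (β : H → ℂ)) DFunLike.coe_injective
  exact h2.mono rootSubspace_le_rootSpace

lemma disjoint_weightSum {T U : Set (Dual ℂ H)} (h : Disjoint T U) :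
    Disjoint (weightSum H T) (weightSum H U) :=
  iSupIndep_rootSubspace.disjoint_biSup_biSup h

lemma disjoint_rootSubspace_weightSum {T : Set (Dual ℂ H)} {β : Dual ℂ H} (h : β ∉ T) :
    Disjoint (rootSubspace H β) (weightSum H T) :=
  iSupIndep_rootSubspace.disjoint_biSup h

lemma eq_zero_of_mem_weightSum {T : Set (Dual ℂ H)} {β : Dual ℂ H} {x : g}
    (hx : x ∈ rootSubspace H β) (hT : x ∈ weightSum H T) (h : β ∉ T) : x = 0 :=
  Submodule.disjoint_def.1 (disjoint_rootSubspace_weightSum h) x hx hT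

/-- The genuine weight spaces already span `g`, and the generalized ones are independent; so the two
kinds agree. -/
lemma exists_rootSubspace_of_mem_rootSpace {χ : H → ℂ} {x : g} (hx : x ∈ rootSpace H χ)
    (hx0 : x ≠ 0) : ∃ β : Dual ℂ H, (β : H → ℂ) = χ ∧ x ∈ rootSubspace H β := by
  have hle : (weightSpace g χ).toSubmodule ≤ (genWeightSpace g χ).toSubmodule :=
    weightSpace_le_genWeightSpace g χ
  have hd : Disjoint (genWeightSpace g χ).toSubmodule
      (⨆ β : {β : Dual ℂ H // (β : H → ℂ) ≠ χ}, rootSubspace H β) := by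
    have h1 := LieSubmodule.iSupIndep_toSubmodule.2 (iSupIndep_genWeightSpace ℂ H g)
    refine (h1 χ).mono_right (iSup_le fun β => ?_)
    exact le_iSup₂_of_le (β.1 : H → ℂ) β.2 (rootSubspace_le_rootSpace β.1)
  have htop : x ∈ (weightSpace g χ).toSubmodule ⊔
      ⨆ β : {β : Dual ℂ H // (β : H → ℂ) ≠ χ}, rootSubspace H β := by
    have : x ∈ weightSum H (insert 0 (roots H)) := by rw [weightSum_roots]; trivial
    refine (iSup₂_le fun β _ => ?_ : weightSum H _ ≤ _) this
    by_cases h : (β : H → ℂ) = χ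
    · refine le_sup_of_le_left ?_
      rw [← h]; exact le_rfl
    · exact le_sup_of_le_right (le_iSup (fun β : {β : Dual ℂ H // (β : H → ℂ) ≠ χ} =>
        rootSubspace H β) ⟨β, h⟩)
  obtain ⟨y, hy, z, hz, hyz⟩ := Submodule.mem_sup.1 htop
  have hz0 : z = 0 := by
    refine Submodule.disjoint_def.1 hd z ?_ hz
    have : z = x - y := by rw [← hyz]; abel
    rw [this]
    exact Submodule.sub_mem _ hx (hle hy)
  rw [hz0, add_zero] at hyz
  subst hyz
  let w : Weight ℂ H g := ⟨χ, fun h => hx0 ((LieSubmodule.eq_bot_iff _).1 h y hx)⟩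
  exact ⟨w.toLinear, rfl, hy⟩

/-- A subspace stable under the Cartan subalgebra is spanned by its weight vectors. -/
lemma le_of_stable {N X : Submodule ℂ g} (hN : ∀ h : H, ∀ x ∈ N, ⁅(h : g), x⁆ ∈ N)
    (h : ∀ β, ∀ x ∈ rootSubspace H β, x ∈ N → x ∈ X) : N ≤ X := by
  let N' : LieSubmodule ℂ H g := { N with lie_mem := fun {h x} hx => hN h x hx }
  intro x hx
  have hx' : x ∈ N' := hx
  clear hx
  rw [LieModule.eq_iSup_inf_genWeightSpace (K := ℂ) (N := N')] at hx'
  induction hx' using LieSubmodule.iSup_induction' with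
  | mem χ y hy =>
    by_cases hy0 : y = 0
    · rw [hy0]; exact X.zero_mem
    obtain ⟨h1, h2⟩ := (LieSubmodule.mem_inf _ _ _).1 hy
    obtain ⟨β, -, hβ⟩ := exists_rootSubspace_of_mem_rootSpace h2 hy0
    exact h β y hβ h1
  | zero => exact X.zero_mem
  | add y z _ _ h1 h2 => exact X.add_mem h1 h2

lemma rootSubspace_le_of_mem {α : Dual ℂ H} (hα : α ∈ roots H) {x : g}
    (hx : x ∈ rootSubspace H α) (hx0 : x ≠ 0) {N : Submodule ℂ g} (h : x ∈ N) :
    rootSubspace H α ≤ N := by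
  intro y hy
  obtain ⟨c, rfl⟩ := exists_eq_smul_of_mem_rootSubspace hα hx hx0 hy
  exact N.smul_mem c h

lemma killingForm_rootSubspace {α β : Dual ℂ H} {x y : g} (hx : x ∈ rootSubspace H α)
    (hy : y ∈ rootSubspace H β) (h : α + β ≠ 0) : killingForm ℂ g x y = 0 :=
  killingForm_apply_eq_zero_of_mem_rootSpace_of_add_ne_zero ℂ g H (rootSubspace_le_rootSpace α hx)
    (rootSubspace_le_rootSpace β hy) fun h0 => h (LinearMap.ext fun z => congrFun h0 z)

lemma killingForm_weightSum {T U : Set (Dual ℂ H)} (h : ∀ α ∈ T, ∀ β ∈ U, α + β ≠ 0) {x y : g}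
    (hx : x ∈ weightSum H T) (hy : y ∈ weightSum H U) : killingForm ℂ g x y = 0 := by
  refine weightSum_induction (p := fun x => killingForm ℂ g x y = 0) hx (fun α hα x hx => ?_)
    (by simp) fun a b ha hb => by simp [ha, hb]
  refine weightSum_induction (p := fun y => killingForm ℂ g x y = 0) hy (fun β hβ y hy => ?_) (by simp) fun a b ha hb => by simp [ha, hb]
  exact killingForm_rootSubspace hx hy (h α hα β hβ)

/-- The pair of weights `(0, 0)` may be left out of the hypothesis because `H` is abelian. -/
lemma lie_mem_weightSum {T U V : Set (Dual ℂ H)}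
    (h : ∀ α ∈ T, ∀ β ∈ U, α ≠ 0 ∨ β ≠ 0 → α + β ∈ insert 0 (roots H) → α + β ∈ V) {x y : g}
    (hx : x ∈ weightSum H T) (hy : y ∈ weightSum H U) : ⁅x, y⁆ ∈ weightSum H V := by
  refine weightSum_induction (p := fun x => ⁅x, y⁆ ∈ weightSum H V) hx (fun α hα x hx => ?_)
    (by simp) fun a b ha hb => by rw [add_lie]; exact Submodule.add_mem _ ha hb
  refine weightSum_induction (p := fun y => ⁅x, y⁆ ∈ weightSum H V) hy (fun β hβ y hy => ?_)
    (by simp) fun a b ha hb => by rw [lie_add]; exact Submodule.add_mem _ ha hb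
  have h1 := lie_mem_rootSubspace hx hy
  by_cases h2 : α + β ∈ insert 0 (roots H)
  · by_cases h3 : α ≠ 0 ∨ β ≠ 0
    · exact rootSubspace_le_weightSum (h α hα β hβ h3 h2) h1
    · push Not at h3
      rw [h3.1, rootSubspace_zero] at hx
      rw [h3.2, rootSubspace_zero] at hy
      rw [cartan_lie hx hy]; exact Submodule.zero_mem _
  · rw [rootSubspace_eq_bot h2, Submodule.mem_bot] at h1
    rw [h1]; exact Submodule.zero_mem _

/-- Otherwise `x` is in the kernel of the Killing form, hence in the radical, which is the centre;
but `H` acts on `x` through `α ≠ 0`. -/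
lemma exists_killingForm_ne_zero {α : Dual ℂ H} (hα : α ∈ roots H) {x : g}
    (hx : x ∈ rootSubspace H α) (hx0 : x ≠ 0) :
    ∃ y ∈ rootSubspace H (-α), killingForm ℂ g x y ≠ 0 := by
  by_contra! h
  have h1 := mem_ker_killingForm_of_mem_rootSpace_of_forall_rootSpace_neg ℂ g H
    (rootSubspace_le_rootSpace α hx) fun y hy => by
      by_cases hy0 : y = 0
      · rw [hy0, map_zero]
      obtain ⟨β, hβ, hy'⟩ := exists_rootSubspace_of_mem_rootSpace hy hy0
      have : β = -α := LinearMap.ext fun z => congrFun hβ z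
      exact h y (this ▸ hy')
  have h2 : x ∈ center ℂ g := by
    rw [← radical_eq_center]
    refine killingCompl_top_le_radical ℂ g ?_
    rw [LieIdeal.mem_killingCompl]
    intro y _
    rw [traceForm_comm]
    exact LinearMap.congr_fun h1 y
  obtain ⟨z, hz⟩ : ∃ z, α z ≠ 0 := by
    by_contra! h; exact hα.1 (LinearMap.ext h)
  have h3 := (mem_maxTrivSubmodule (R := ℂ) (L := g) (M := g) x).1 h2 z
  rw [mem_rootSubspace.1 hx z] at h3
  exact (smul_ne_zero hz hx0) h3

lemma killingForm_lie (x y z : g) : killingForm ℂ g ⁅x, y⁆ z = killingForm ℂ g x ⁅y, z⁆ :=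
  traceForm_apply_lie_apply ℂ g g x y z

lemma killingForm_comm (x y : g) : killingForm ℂ g x y = killingForm ℂ g y x :=
  traceForm_comm ℂ g g x y

lemma exists_isSl2Triple {α : Dual ℂ H} (hα : α ∈ roots H) :
    ∃ (e f : g), e ∈ rootSubspace H α ∧ f ∈ rootSubspace H (-α) ∧
      IsSl2Triple (corootOf H α : g) e f := by
  obtain ⟨h2, e, he, f, hf, hef⟩ := isCorootOf_corootOf hα
  refine ⟨e, f, he, hf, ⟨fun h0 => ?_, hef.symm, ?_, ?_⟩⟩
  · have : corootOf H α = 0 := Subtype.ext h0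
    rw [this, map_zero] at h2
    exact two_ne_zero h2.symm
  · rw [mem_rootSubspace.1 he, h2, ofNat_smul_eq_nsmul]
  · rw [mem_rootSubspace.1 hf, LinearMap.neg_apply, h2, neg_smul, ofNat_smul_eq_nsmul]

/-- Suppose `[e, y] = 0` and pick a nonzero `z` of weight `-(α + β)`. By invariance of the Killing
form `[e, z]` is orthogonal to `g_β`, so it vanishes. Then `y` and `z` are primitive vectors for the
`sl₂` of `α`, with nonnegative weights whose sum is `-2`. -/
lemma lie_ne_zero {α β : Dual ℂ H} (hα : α ∈ roots H) (hβ : β ∈ roots H) (hαβ : α + β ∈ roots H)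
    {x y : g} (hx : x ∈ rootSubspace H α) (hx0 : x ≠ 0) (hy : y ∈ rootSubspace H β)
    (hy0 : y ≠ 0) : ⁅x, y⁆ ≠ 0 := by
  intro h0
  obtain ⟨e, f, he, hf, t⟩ := exists_isSl2Triple hα
  obtain ⟨c, rfl⟩ := exists_eq_smul_of_mem_rootSubspace hα hx hx0 he
  have hey : ⁅c • x, y⁆ = 0 := by rw [smul_lie, h0, smul_zero]
  obtain ⟨w, hw, hw0⟩ := Submodule.exists_mem_ne_zero_of_ne_bot hαβ.2
  obtain ⟨z, hz, hwz⟩ := exists_killingForm_ne_zero hαβ hw hw0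
  have hz0 : z ≠ 0 := by rintro rfl; exact hwz (map_zero _)
  have hez : ⁅c • x, z⁆ = 0 := by
    by_contra hne
    have hmem : ⁅c • x, z⁆ ∈ rootSubspace H (-β) := by
      have := lie_mem_rootSubspace he hz
      rwa [neg_add, add_neg_cancel_left] at this
    have hβ' : -β ∈ roots H := ⟨neg_ne_zero.2 hβ.1, fun hb => hne (by
      rw [hb] at hmem; exact (Submodule.mem_bot ℂ).1 hmem)⟩
    obtain ⟨u, hu, hu0⟩ := exists_killingForm_ne_zero hβ' hmem hne
    rw [neg_neg] at hu
    obtain ⟨d, rfl⟩ := exists_eq_smul_of_mem_rootSubspace hβ hy hy0 hu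
    apply hu0
    rw [killingForm_comm, map_smul, LinearMap.smul_apply, ← killingForm_lie, ← lie_skew, hey]
    simp
  have hp1 : t.HasPrimitiveVectorWith y (β (corootOf H α)) := ⟨hy0, mem_rootSubspace.1 hy _, hey⟩
  have hp2 : t.HasPrimitiveVectorWith z ((-(α + β)) (corootOf H α)) :=
    ⟨hz0, mem_rootSubspace.1 hz _, hez⟩
  obtain ⟨n, hn⟩ := hp1.exists_nat
  obtain ⟨m, hm⟩ := hp2.exists_nat
  rw [LinearMap.neg_apply, LinearMap.add_apply, hn, (isCorootOf_corootOf hα).1] at hm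
  have : (m : ℂ) + n + 2 = 0 := by rw [← hm]; ring
  exact absurd (by exact_mod_cast this : m + n + 2 = 0) (by omega)

end WeightSpaces

end ReductivePair


set_option linter.unusedSectionVars false

namespace ReductivePair

open Module LieAlgebra LieModule

/-! ### Lie's theorem, Cartan's criterion and Borel subalgebras -/

section Solvable

/-- Induction along a common eigenvector, which brackets annihilate. The module is quantified inside
because the induction passes to quotients. The resulting vanishing trace is the easy half of
Cartan's criterion. -/
lemma isNilpotent_toEnd_mul_toEnd_lie {L : Type*} [LieRing L] [LieAlgebra ℂ L]
    [IsSolvable L] (x a b : L) (n : ℕ) :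
    ∀ (M : Type*) [AddCommGroup M] [Module ℂ M] [LieRingModule L M] [LieModule ℂ L M]
      [FiniteDimensional ℂ M], finrank ℂ M = n →
      _root_.IsNilpotent (toEnd ℂ L M x * toEnd ℂ L M ⁅a, b⁆) := by
  induction n with
  | zero =>
    intro M _ _ _ _ _ hn
    have : Subsingleton M := finrank_zero_iff.1 hn
    exact ⟨1, LinearMap.ext fun m => Subsingleton.elim _ _⟩
  | succ n ih =>
    intro M _ _ _ _ _ hn
    have : Nontrivial M := nontrivial_of_finrank_pos (R := ℂ) (by omega)
    obtain ⟨χ, hχ⟩ := exists_nontrivial_weightSpace_of_isSolvable ℂ L M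
    obtain ⟨⟨v, hv⟩, hv0⟩ := exists_ne (0 : weightSpace M χ)
    have hv0' : v ≠ 0 := fun h => hv0 (Subtype.ext h)
    rw [mem_weightSpace] at hv
    let N : LieSubmodule ℂ L M :=
      { Submodule.span ℂ {v} with
        lie_mem := fun {y m} hm => by
          obtain ⟨c, rfl⟩ := Submodule.mem_span_singleton.1 hm
          exact Submodule.mem_span_singleton.2 ⟨c * χ y, by rw [lie_smul, hv, smul_smul]⟩ }
    have hfin : finrank ℂ (M ⧸ N) = n := by
      have h1 := Submodule.finrank_quotient_add_finrank N.toSubmodule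
      have h2 : finrank ℂ N.toSubmodule = 1 := finrank_span_singleton hv0'
      have h3 : finrank ℂ (M ⧸ N) = finrank ℂ (M ⧸ N.toSubmodule) := rfl
      omega
    obtain ⟨k, hk⟩ := ih (M ⧸ N) hfin
    have hmk : ∀ (j : ℕ) (m : M), LieSubmodule.Quotient.mk' N
        (((toEnd ℂ L M x * toEnd ℂ L M ⁅a, b⁆) ^ j) m) =
        ((toEnd ℂ L (M ⧸ N) x * toEnd ℂ L (M ⧸ N) ⁅a, b⁆) ^ j) (LieSubmodule.Quotient.mk' N m) := by
      intro j
      induction j with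
      | zero => intro m; rfl
      | succ j ihj =>
        intro m
        rw [pow_succ, Module.End.mul_apply, ihj, pow_succ, Module.End.mul_apply]
        rfl
    refine ⟨k + 1, LinearMap.ext fun m => ?_⟩
    have h1 := hmk k m
    rw [hk, LinearMap.zero_apply, LieSubmodule.Quotient.mk_eq_zero] at h1
    obtain ⟨c, hc⟩ := Submodule.mem_span_singleton.1 h1
    rw [pow_succ', Module.End.mul_apply, ← hc, map_smul, Module.End.mul_apply, toEnd_apply_apply,
      toEnd_apply_apply, lie_lie, hv, hv, lie_smul, lie_smul, hv, hv, smul_comm, sub_self, lie_zero,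
      smul_zero, LinearMap.zero_apply]

variable {g : Type*} [LieRing g] [LieAlgebra ℂ g] [FiniteDimensional ℂ g]

lemma killingForm_lie_eq_zero (s : LieSubalgebra ℂ g) [IsSolvable s] {x y z : g} (hx : x ∈ s)
    (hy : y ∈ s) (hz : z ∈ s) : killingForm ℂ g x ⁅y, z⁆ = 0 := by
  have h := isNilpotent_toEnd_mul_toEnd_lie (⟨x, hx⟩ : s) ⟨y, hy⟩ ⟨z, hz⟩ _ g rfl
  exact (LinearMap.isNilpotent_trace_of_isNilpotent h).eq_zero

/-- Cartan's criterion for a subalgebra. -/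
lemma isSolvable_of_killingForm (s : LieSubalgebra ℂ g)
    (h : ∀ x ∈ s, ∀ y ∈ s, ∀ z ∈ s, killingForm ℂ g x ⁅y, z⁆ = 0) : IsSolvable s := by
  set DI : LieIdeal ℂ s := ⁅(⊤ : LieIdeal ℂ s), (⊤ : LieIdeal ℂ s)⁆
  set DDI : LieIdeal ℂ s := ⁅DI, DI⁆
  have hDI : ∀ x ∈ s, ∀ y ∈ DI, killingForm ℂ g x y = 0 := by
    intro x hx y hy
    change y ∈ ⁅(⊤ : LieIdeal ℂ s), (⊤ : LieIdeal ℂ s)⁆ at hy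
    rw [← LieSubmodule.mem_toSubmodule, LieSubmodule.lieIdeal_oper_eq_linear_span'] at hy
    induction hy using Submodule.span_induction with
    | mem y hy =>
      obtain ⟨a, -, b, -, rfl⟩ := hy
      exact h x hx a a.2 b b.2
    | zero => simp
    | add a b _ _ ha hb =>
      change killingForm ℂ g x (a + b) = 0
      rw [map_add, ha, hb, add_zero]
    | smul c a _ ha => 
      change killingForm ℂ g x (c • (a : g)) = 0
      rw [map_smul, ha, smul_zero]
  have tf_eq_zero : traceForm ℂ DI g = 0 := by
    ext ⟨x, hx⟩ ⟨y, hy⟩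
    change killingForm ℂ g x y = 0
    exact hDI x x.2 y hy
  -- The trace form of the action on all of `g` vanishes on the derived algebra of `s`, so the
  -- second derived ideal acts nilpotently on `g`; by Engel it is nilpotent.
  have module_nilp : LieModule.IsNilpotent (derivedSeries ℂ DI 1) g :=
    isNilpotent_derivedSeries_of_traceForm_eq_zero tf_eq_zero
  have ring_nilp : LieRing.IsNilpotent DDI := by
    rw [LieAlgebra.isNilpotent_iff_forall (R := ℂ)]
    rintro ⟨x, hx⟩
    apply LieSubalgebra.isNilpotent_ad_of_isNilpotent_ad (DDI : LieSubalgebra ℂ s) (x := ⟨x, hx⟩)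
    apply LieSubalgebra.isNilpotent_ad_of_isNilpotent_ad s
    refine (LieModule.isNilpotent_iff_forall' (R := ℂ)).mp module_nilp
      ⟨⟨x, LieSubmodule.lie_le_left DI DI hx⟩, ?_⟩
    rwa [LieIdeal.derivedSeries_eq_derivedSeriesOfIdeal_comap, LieIdeal.mem_comap]
  obtain ⟨k, hk⟩ := IsSolvable.solvable ℂ DDI
  rw [LieIdeal.derivedSeries_eq_bot_iff] at hk
  refine IsSolvable.mk (k := k + 2) (?_ : derivedSeries ℂ s (k + 2) = ⊥)
  rwa [derivedSeries_def, derivedSeriesOfIdeal_add, derivedSeriesOfIdeal_succ,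
    derivedSeriesOfIdeal_succ, derivedSeriesOfIdeal_zero]

/-- A maximal solvable subalgebra contains its orthogonal space. -/
lemma mem_of_maximal_isSolvable {b : LieSubalgebra ℂ g}
    (hb : Maximal (fun s : LieSubalgebra ℂ g => IsSolvable s) b) {y : g}
    (hy : ∀ x ∈ b, killingForm ℂ g y x = 0) : y ∈ b := by
  have hsol : IsSolvable b := hb.prop
  by_contra hyb
  have hinv : ∀ x y z : g, killingForm ℂ g ⁅x, y⁆ z = killingForm ℂ g x ⁅y, z⁆ :=
    traceForm_apply_lie_apply ℂ g g
  have hcomm : ∀ x y : g, killingForm ℂ g x y = killingForm ℂ g y x := traceForm_comm ℂ g g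
  let o : LieSubmodule ℂ b g :=
    { carrier := {y | ∀ x ∈ b, killingForm ℂ g y x = 0}
      add_mem' := fun {u v} hu hv x hx => by rw [map_add, LinearMap.add_apply, hu x hx, hv x hx, add_zero]
      zero_mem' := fun x _ => by simp
      smul_mem' := fun c u hu x hx => by rw [map_smul, LinearMap.smul_apply, hu x hx, smul_zero]
      lie_mem := fun {z u} hu x hx => by
        change killingForm ℂ g ⁅(z : g), u⁆ x = 0
        rw [← lie_skew, map_neg, LinearMap.neg_apply, hinv]
        rw [show killingForm ℂ g u ⁅(z : g), x⁆ = 0 from hu _ (b.lie_mem z.2 hx), neg_zero] }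
  -- If the orthogonal space were not contained in `b`, Lie's theorem on its image modulo `b` would
  -- give `w ∉ b`, orthogonal to `b`, with `b + ℂw` a subalgebra.
  let V : LieSubmodule ℂ b (g ⧸ b.toLieSubmodule) :=
    o.map (LieSubmodule.Quotient.mk' b.toLieSubmodule)
  have hV : Nontrivial V := by
    refine ⟨⟨⟨_, LieSubmodule.mem_map_of_mem (f := LieSubmodule.Quotient.mk' b.toLieSubmodule)
      (show y ∈ o from hy)⟩, 0, fun h => hyb ?_⟩⟩
    have h1 := congrArg Subtype.val h
    exact (LieSubmodule.Quotient.mk_eq_zero (N := b.toLieSubmodule)).1 h1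
  obtain ⟨χ, hχ⟩ := exists_nontrivial_weightSpace_of_isSolvable ℂ b V
  obtain ⟨⟨⟨v, hvV⟩, hv⟩, hv0⟩ := exists_ne (0 : weightSpace V χ)
  obtain ⟨w, hw, rfl⟩ := (LieSubmodule.mem_map _).1 hvV
  have hwb : w ∉ b := fun h => hv0 (Subtype.ext (Subtype.ext
    ((LieSubmodule.Quotient.mk_eq_zero (N := b.toLieSubmodule)).2 h)))
  have hlie : ∀ x ∈ b, ∃ c : ℂ, ⁅x, w⁆ - c • w ∈ b := by
    intro x hx
    have h1 := congrArg Subtype.val ((mem_weightSpace _ _).1 hv ⟨x, hx⟩)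
    refine ⟨χ ⟨x, hx⟩, (LieSubmodule.Quotient.mk_eq_zero (N := b.toLieSubmodule)).1 ?_⟩
    rw [map_sub, sub_eq_zero]
    exact h1
  have hwo : ∀ x ∈ b, killingForm ℂ g w x = 0 := hw
  have hmem : ∀ z, z ∈ b.toSubmodule ⊔ Submodule.span ℂ {w} ↔ ∃ u ∈ b, ∃ c : ℂ, u + c • w = z := by
    intro z
    rw [Submodule.mem_sup]
    refine exists_congr fun u => and_congr_right fun _ => ?_
    constructor
    · rintro ⟨t, ht, rfl⟩
      obtain ⟨c, rfl⟩ := Submodule.mem_span_singleton.1 ht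
      exact ⟨c, rfl⟩
    · rintro ⟨c, rfl⟩
      exact ⟨_, Submodule.mem_span_singleton.2 ⟨c, rfl⟩, rfl⟩
  have hbr : ∀ (u v : g) (c d : ℂ), ⁅u + c • w, v + d • w⁆ = ⁅u, v⁆ + d • ⁅u, w⁆ - c • ⁅v, w⁆ := by
    intro u v c d
    rw [add_lie, lie_add, lie_add, lie_smul, smul_lie, smul_lie, lie_smul, lie_self, smul_zero,
      smul_zero, ← lie_skew w v, smul_neg]
    abel
  let b' : LieSubalgebra ℂ g :=
    { b.toSubmodule ⊔ Submodule.span ℂ {w} with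
      lie_mem' := by
        intro z z' hz hz'
        obtain ⟨u, hu, c, rfl⟩ := (hmem z).1 hz
        obtain ⟨v, hv, d, rfl⟩ := (hmem z').1 hz'
        obtain ⟨k, hk⟩ := hlie u hu
        obtain ⟨l, hl⟩ := hlie v hv
        rw [hbr]
        refine (hmem _).2 ⟨⁅u, v⁆ + d • (⁅u, w⁆ - k • w) - c • (⁅v, w⁆ - l • w),
          b.sub_mem (b.add_mem (b.lie_mem hu hv) (b.smul_mem d hk)) (b.smul_mem c hl),
          d * k - c * l, ?_⟩
        module }
  have hb' : IsSolvable b' := by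
    refine isSolvable_of_killingForm b' fun x hx y hy z hz => ?_
    obtain ⟨u, hu, a, rfl⟩ := (hmem x).1 hx
    obtain ⟨v, hv, c, rfl⟩ := (hmem y).1 hy
    obtain ⟨t, ht, d, rfl⟩ := (hmem z).1 hz
    have h1 : ∀ p ∈ b, ∀ q ∈ b, killingForm ℂ g p ⁅q, w⁆ = 0 := fun p hp q hq => by
      rw [← hinv, hcomm]; exact hwo _ (b.lie_mem hp hq)
    -- Invariance and symmetry of the form make this value equal to its own negative.
    have h2 : ∀ q ∈ b, killingForm ℂ g w ⁅q, w⁆ = 0 := fun q hq => by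
      have h3 : killingForm ℂ g w ⁅q, w⁆ = - killingForm ℂ g w ⁅q, w⁆ := by
        conv_lhs => rw [← hinv, ← lie_skew, map_neg, LinearMap.neg_apply, hcomm]
      exact self_eq_neg.1 h3
    rw [hbr]
    simp only [map_sub, map_add, map_smul, LinearMap.add_apply, LinearMap.smul_apply,
      killingForm_lie_eq_zero b hu hv ht, h1 u hu v hv, h1 u hu t ht, h2 v hv, h2 t ht,
      hwo _ (b.lie_mem hv ht), smul_zero, add_zero, sub_zero]
  have hle : b ≤ b' := fun x hx => (hmem x).2 ⟨x, hx, 0, by simp⟩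
  exact hwb (hb.2 hb' hle ((hmem w).2 ⟨0, b.zero_mem, 1, by simp⟩))

end Solvable

end ReductivePair


set_option linter.unusedSectionVars false

namespace ReductivePair

open Module LieAlgebra LieModule

/-! ### Subalgebras that contain the Cartan subalgebra -/

section RootSubalgebras

variable {g : Type*} [LieRing g] [LieAlgebra ℂ g] [FiniteDimensional ℂ g]
  [HasCentralRadical ℂ g] {H : LieSubalgebra ℂ g} [H.IsCartanSubalgebra]

/-- The subalgebra spanned by the Cartan subalgebra and the root spaces of a closed set of roots. -/
def ofRoots (T : Set (Dual ℂ H)) (hT : ∀ β ∈ T, ∀ γ ∈ T, β + γ ∈ roots H → β + γ ∈ T) :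
    LieSubalgebra ℂ g :=
  { weightSum H (insert 0 T) with
    lie_mem' := by
      intro x y hx hy
      refine lie_mem_weightSum ?_ hx hy
      rintro β (rfl | hβ) γ (rfl | hγ) - h
      · exact Or.inl (zero_add 0)
      · rw [zero_add]; exact Or.inr hγ
      · rw [add_zero]; exact Or.inr hβ
      · exact h.imp id (hT β hβ γ hγ) }

lemma cartan_le_ofRoots {T : Set (Dual ℂ H)}
    {hT : ∀ β ∈ T, ∀ γ ∈ T, β + γ ∈ roots H → β + γ ∈ T} : H ≤ ofRoots T hT := by
  intro x hx
  change x ∈ weightSum H (insert 0 T)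
  rw [weightSum_insert_zero]
  exact Submodule.mem_sup_left hx

variable (H) in
/-- The roots whose root spaces are contained in a subspace. -/
def rootsIn (p : Submodule ℂ g) : Set (Dual ℂ H) := {α ∈ roots H | rootSubspace H α ≤ p}

lemma rootsIn_weightSum {T : Set (Dual ℂ H)} (hT : T ⊆ roots H) :
    rootsIn H (weightSum H (insert 0 T)) = T := by
  ext α
  constructor
  · rintro ⟨hα, hle⟩
    by_contra h
    obtain ⟨x, hx, hx0⟩ := Submodule.exists_mem_ne_zero_of_ne_bot hα.2
    exact hx0 (eq_zero_of_mem_weightSum hx (hle hx) fun h1 => h1.elim hα.1 h)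
  · exact fun h => ⟨hT h, rootSubspace_le_weightSum (Or.inr h)⟩

lemma toSubmodule_eq_weightSum {p : LieSubalgebra ℂ g} (hp : H ≤ p) :
    p.toSubmodule = weightSum H (insert 0 (rootsIn H p.toSubmodule)) := by
  refine le_antisymm (le_of_stable (fun h x hx => p.lie_mem (hp h.2) hx) ?_) ?_
  · intro β x hx hxp
    by_cases hx0 : x = 0
    · rw [hx0]; exact Submodule.zero_mem _
    by_cases hβ : β ∈ insert 0 (roots H)
    · refine rootSubspace_le_weightSum ?_ hx
      rcases hβ with rfl | hβ
      · exact Or.inl rfl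
      · exact Or.inr ⟨hβ, rootSubspace_le_of_mem hβ hx hx0 hxp⟩
    · rw [rootSubspace_eq_bot hβ] at hx
      exact absurd ((Submodule.mem_bot ℂ).1 hx) hx0
  · rw [weightSum_le_iff]
    rintro β (rfl | hβ)
    · rw [rootSubspace_zero]; exact hp
    · exact hβ.2

lemma rootsIn_add {p : LieSubalgebra ℂ g} {β γ : Dual ℂ H}
    (hβ : β ∈ rootsIn H p.toSubmodule) (hγ : γ ∈ rootsIn H p.toSubmodule)
    (h : β + γ ∈ roots H) : β + γ ∈ rootsIn H p.toSubmodule := by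
  refine ⟨h, ?_⟩
  obtain ⟨x, hx, hx0⟩ := Submodule.exists_mem_ne_zero_of_ne_bot hβ.1.2
  obtain ⟨y, hy, hy0⟩ := Submodule.exists_mem_ne_zero_of_ne_bot hγ.1.2
  exact rootSubspace_le_of_mem h (lie_mem_rootSubspace hx hy)
    (lie_ne_zero hβ.1 hγ.1 h hx hx0 hy hy0) (p.lie_mem (hβ.2 hx) (hγ.2 hy))

/-- If `κ(x, [y, z]) = 0` on a subspace, it does not contain a root space, its opposite and the
coroot. -/
lemma not_le_of_killingForm {N : Submodule ℂ g} {α : Dual ℂ H} (hα : α ∈ roots H)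
    (hN : ∀ x ∈ N, ∀ y ∈ N, ∀ z ∈ N, killingForm ℂ g x ⁅y, z⁆ = 0) (h1 : rootSubspace H α ≤ N)
    (h2 : rootSubspace H (-α) ≤ N) (h3 : (corootOf H α : g) ∈ N) : False := by
  obtain ⟨x, hx, hx0⟩ := Submodule.exists_mem_ne_zero_of_ne_bot hα.2
  obtain ⟨y, hy, hxy⟩ := exists_killingForm_ne_zero hα hx hx0
  have h := hN y (h2 hy) _ h3 x (h1 hx)
  rw [mem_rootSubspace.1 hx, (isCorootOf_corootOf hα).1, map_smul, killingForm_comm,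
    smul_eq_mul] at h
  exact hxy ((mul_eq_zero.1 h).resolve_left two_ne_zero)

lemma neg_notMem_rootsIn {s : LieSubalgebra ℂ g} (hs : IsSolvable s) (hH : H ≤ s) {α : Dual ℂ H}
    (hα : α ∈ rootsIn H s.toSubmodule) : -α ∉ rootsIn H s.toSubmodule := fun h =>
  not_le_of_killingForm hα.1 (fun _ hx _ hy _ hz => killingForm_lie_eq_zero s hx hy hz) hα.2 h.2
    (hH (corootOf H α).2)

lemma neg_mem_roots {α : Dual ℂ H} (hα : α ∈ roots H) : -α ∈ roots H := by
  obtain ⟨e, f, he, hf, t⟩ := exists_isSl2Triple hα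
  refine ⟨neg_ne_zero.2 hα.1, fun h => t.h_ne_zero ?_⟩
  rw [h, Submodule.mem_bot] at hf
  rw [← t.lie_e_f, hf, lie_zero]

/-- The subalgebra attached to a positive system is a Borel subalgebra. -/
lemma maximal_isSolvable_ofRoots {Q : Set (Dual ℂ H)} (hQ : Q ⊆ roots H)
    (hadd : ∀ β ∈ Q, ∀ γ ∈ Q, β + γ ∈ roots H → β + γ ∈ Q)
    (hor : ∀ α ∈ roots H, α ∈ Q ∨ -α ∈ Q) (hneg : ∀ α ∈ Q, -α ∉ Q) :
    Maximal (fun s : LieSubalgebra ℂ g => IsSolvable s) (ofRoots Q hadd) := by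
  refine ⟨isSolvable_of_killingForm _ fun x hx y hy z hz => ?_, fun s hs hle => ?_⟩
  · have h1 : ⁅y, z⁆ ∈ weightSum H Q := by
      refine lie_mem_weightSum ?_ hy hz
      rintro β (rfl | hβ) γ (rfl | hγ) h0 h
      · simp at h0
      · rwa [zero_add]
      · rwa [add_zero]
      · rcases h with h | h
        · exact absurd hγ (by rw [eq_neg_of_add_eq_zero_right h]; exact hneg β hβ)
        · exact hadd β hβ γ hγ h
    refine killingForm_weightSum ?_ hx h1
    rintro β (rfl | hβ) γ hγ h
    · rw [zero_add] at h; exact (hQ hγ).1 h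
    · exact hneg β hβ (by rwa [← eq_neg_of_add_eq_zero_right h])
  · have hH : H ≤ s := cartan_le_ofRoots.trans hle
    have h1 : s.toSubmodule ≤ weightSum H (insert 0 Q) := by
      rw [toSubmodule_eq_weightSum hH]
      refine weightSum_mono (Set.insert_subset_insert fun α hα => ?_)
      -- A solvable subalgebra containing `H` cannot contain two opposite root spaces.
      refine (hor α hα.1).resolve_right fun h => neg_notMem_rootsIn hs hH hα ⟨hQ h, ?_⟩
      exact (rootSubspace_le_weightSum (Or.inr h)).trans hle
    exact h1

/-- If `α` is not a root of `p`, then `g_{-α}` is orthogonal to `p`, hence to a Borel subalgebra `b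
≤ p`, and so lies in `b`. No relation between `b` and `H` is needed. -/
lemma mem_rootsIn_or {p : LieSubalgebra ℂ g} (hp : IsParabolic p) (hH : H ≤ p) {α : Dual ℂ H}
    (hα : α ∈ roots H) : α ∈ rootsIn H p.toSubmodule ∨ -α ∈ rootsIn H p.toSubmodule := by
  obtain ⟨b, hb, hbp⟩ := hp
  by_contra! h
  refine h.2 ⟨neg_mem_roots hα, fun y hy => hbp (mem_of_maximal_isSolvable hb fun x hx => ?_)⟩
  have hx' : x ∈ weightSum H (insert 0 (rootsIn H p.toSubmodule)) := by
    rw [← toSubmodule_eq_weightSum hH]; exact hbp hx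
  refine killingForm_weightSum (T := {-α}) (fun δ hδ γ hγ h0 => ?_)
    (rootSubspace_le_weightSum (Set.mem_singleton _) hy) hx'
  rw [Set.mem_singleton_iff.1 hδ] at h0
  rcases hγ with hγ | hγ
  · rw [hγ, add_zero, neg_eq_zero] at h0; exact hα.1 h0
  · rw [neg_add_eq_zero] at h0; rw [h0] at h; exact h.1 hγ

end RootSubalgebras

/-! ### The radical, the nilpotent radical and the Levi part -/

section NilpotentRadical

variable {g : Type*} [LieRing g] [LieAlgebra ℂ g] [FiniteDimensional ℂ g]
  [HasCentralRadical ℂ g] {H : LieSubalgebra ℂ g} [H.IsCartanSubalgebra]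
  {p : LieSubalgebra ℂ g} (hp : H ≤ p)

variable (H p) in
/-- The roots of the nilpotent radical. -/
def nilRoots : Set (Dual ℂ H) :=
  {α ∈ rootsIn H p.toSubmodule | -α ∉ rootsIn H p.toSubmodule}

variable (p) in
/-- The radical of a subalgebra, as a subspace. -/
def radicalSpace : Submodule ℂ g := (radical ℂ p).toSubmodule.map p.toSubmodule.subtype

lemma mem_radicalSpace {x : g} : x ∈ radicalSpace p ↔ ∃ h : x ∈ p, (⟨x, h⟩ : p) ∈ radical ℂ p := by
  constructor
  · rintro ⟨⟨y, hy⟩, h, rfl⟩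
    exact ⟨hy, h⟩
  · rintro ⟨hx, h⟩
    exact ⟨⟨x, hx⟩, h, rfl⟩

lemma lie_mem_radicalSpace {x y : g} (hx : x ∈ p) (hy : y ∈ radicalSpace p) :
    ⁅x, y⁆ ∈ radicalSpace p := by
  rw [mem_radicalSpace] at *
  obtain ⟨hyp, hy⟩ := hy
  exact ⟨p.lie_mem hx hyp, (radical ℂ p).lie_mem (x := ⟨x, hx⟩) hy⟩

lemma killingForm_radicalSpace {x y z : g} (hx : x ∈ radicalSpace p) (hy : y ∈ radicalSpace p)
    (hz : z ∈ radicalSpace p) : killingForm ℂ g x ⁅y, z⁆ = 0 := by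
  rw [mem_radicalSpace] at hx hy hz
  obtain ⟨hxp, hx⟩ := hx
  obtain ⟨hyp, hy⟩ := hy
  obtain ⟨hzp, hz⟩ := hz
  have h := isNilpotent_toEnd_mul_toEnd_lie (⟨⟨x, hxp⟩, hx⟩ : radical ℂ p) ⟨⟨y, hyp⟩, hy⟩
    ⟨⟨z, hzp⟩, hz⟩ _ g rfl
  exact (LinearMap.isNilpotent_trace_of_isNilpotent h).eq_zero

lemma nilRoots_add {β γ : Dual ℂ H} (hβ : β ∈ insert 0 (rootsIn H p.toSubmodule))
    (hγ : γ ∈ nilRoots H p) (h : β + γ ∈ insert 0 (roots H)) : β + γ ∈ nilRoots H p := by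
  rcases hβ with rfl | hβ
  · rwa [zero_add]
  rcases h with h | h
  · exact absurd hβ (by rw [eq_neg_of_add_eq_zero_left h]; exact hγ.2)
  · refine ⟨rootsIn_add hβ hγ.1 h, fun h1 => hγ.2 ?_⟩
    have h2 : -(β + γ) + β = -γ := by abel
    rw [← h2]
    exact rootsIn_add h1 hβ (by rw [h2]; exact neg_mem_roots hγ.1.1)

include hp in
-- The sum of these root spaces is an ideal of `p`, and no two of its roots are opposite, so
-- Cartan's criterion makes it solvable.
lemma weightSum_nilRoots_le : weightSum H (nilRoots H p) ≤ radicalSpace p := by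
  have hle : weightSum H (nilRoots H p) ≤ p.toSubmodule :=
    weightSum_le_iff.2 fun β hβ => hβ.1.2
  have hlie : ∀ x ∈ p, ∀ y ∈ weightSum H (nilRoots H p), ⁅x, y⁆ ∈ weightSum H (nilRoots H p) := by
    intro x hx y hy
    have hx' : x ∈ weightSum H (insert 0 (rootsIn H p.toSubmodule)) := by
      rw [← toSubmodule_eq_weightSum hp]; exact hx
    exact lie_mem_weightSum (fun β hβ γ hγ _ h => nilRoots_add hβ hγ h) hx' hy
  let U : LieIdeal ℂ p :=
    { (weightSum H (nilRoots H p)).comap p.toSubmodule.subtype with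
      lie_mem := fun {x y} hy => hlie x x.2 y hy }
  let u : LieSubalgebra ℂ g :=
    { weightSum H (nilRoots H p) with
      lie_mem' := fun {x y} hx hy => hlie x (hle hx) y hy }
  have hu : IsSolvable u := isSolvable_of_killingForm u fun x hx y hy z hz =>
    killingForm_weightSum (fun α hα β hβ h => hα.2 (by
      rw [← eq_neg_of_add_eq_zero_right h]; exact hβ.1)) hx (u.lie_mem hy hz)
  let f : U →ₗ⁅ℂ⁆ u :=
    { toFun := fun x => ⟨x.1.1, x.2⟩
      map_add' := fun _ _ => rfl
      map_smul' := fun _ _ => rfl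
      map_lie' := rfl }
  have hU : IsSolvable U := Function.Injective.lieAlgebra_isSolvable (f := f) fun x y h =>
    Subtype.ext (Subtype.ext (congrArg (Subtype.val : u → g) h))
  intro x hx
  exact mem_radicalSpace.2 ⟨hle hx, (LieIdeal.solvable_iff_le_radical ℂ p U).1 hU hx⟩

include hp in
-- The radical is stable under `H`. If it contained `g_β` with `-β` also a root of `p`, it would
-- contain a whole `sl₂`, against solvability.
lemma radicalSpace_le : radicalSpace p ≤ weightSum H (insert 0 (nilRoots H p)) := by
  refine le_of_stable (fun h x hx => lie_mem_radicalSpace (hp h.2) hx) fun β x hx hxr => ?_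
  by_cases hx0 : x = 0
  · rw [hx0]; exact Submodule.zero_mem _
  by_cases hβ : β ∈ insert 0 (roots H)
  swap
  · rw [rootSubspace_eq_bot hβ] at hx
    exact absurd ((Submodule.mem_bot ℂ).1 hx) hx0
  refine rootSubspace_le_weightSum ?_ hx
  rcases hβ with rfl | hβ
  · exact Or.inl rfl
  have hβr : rootSubspace H β ≤ radicalSpace p := rootSubspace_le_of_mem hβ hx hx0 hxr
  refine Or.inr ⟨⟨hβ, hβr.trans fun y hy => (mem_radicalSpace.1 hy).1⟩, fun hneg => ?_⟩
  obtain ⟨e, f, he, hf, t⟩ := exists_isSl2Triple hβ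
  have hc : (corootOf H β : g) ∈ radicalSpace p := by
    rw [← t.lie_e_f, ← lie_skew]
    exact Submodule.neg_mem _ (lie_mem_radicalSpace (hneg.2 hf) (hβr he))
  have hf0 : f ≠ 0 := fun h0 => t.h_ne_zero (by rw [← t.lie_e_f, h0, lie_zero])
  have hfr : (2 : ℕ) • f ∈ radicalSpace p := by
    have h1 : (2 : ℕ) • f = ⁅f, (corootOf H β : g)⁆ := by
      rw [← lie_skew, t.lie_h_f_nsmul, neg_neg]
    rw [h1]
    exact lie_mem_radicalSpace (hneg.2 hf) hc
  refine not_le_of_killingForm hβ (fun x hx y hy z hz => killingForm_radicalSpace hx hy hz) hβr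
    (rootSubspace_le_of_mem hneg.1 (Submodule.smul_of_tower_mem _ 2 hf) ?_ hfr) hc
  rw [← Nat.cast_smul_eq_nsmul ℂ]
  exact smul_ne_zero (by norm_num) hf0

include hp in
lemma nilpotentRadical_eq : nilpotentRadical p = weightSum H (nilRoots H p) := by
  apply le_antisymm
  · rw [nilpotentRadical, LieSubmodule.lieIdeal_oper_eq_linear_span', Submodule.map_span,
      Submodule.span_le]
    rintro - ⟨-, ⟨⟨x, hx⟩, -, ⟨y, hy⟩, hyr, rfl⟩, rfl⟩
    change ⁅x, y⁆ ∈ weightSum H (nilRoots H p)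
    have hyr' : y ∈ radicalSpace p := mem_radicalSpace.2 ⟨hy, hyr⟩
    have hx' : x ∈ weightSum H (insert 0 (rootsIn H p.toSubmodule)) := by
      rw [← toSubmodule_eq_weightSum hp]; exact hx
    have hlie : ∀ v ∈ weightSum H (nilRoots H p), ⁅x, v⁆ ∈ weightSum H (nilRoots H p) :=
      fun v hv => lie_mem_weightSum (fun β hβ γ hγ _ h => nilRoots_add hβ hγ h) hx' hv
    have h1 := radicalSpace_le hp hyr'
    rw [weightSum_insert_zero] at h1
    obtain ⟨h, hh, v, hv, rfl⟩ := Submodule.mem_sup.1 h1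
    rw [lie_add]
    refine Submodule.add_mem _ ?_ (hlie v hv)
    have hhr : h ∈ radicalSpace p := by
      simpa using Submodule.sub_mem _ hyr' (weightSum_nilRoots_le hp hv)
    refine weightSum_induction (p := fun x => ⁅x, h⁆ ∈ weightSum H (nilRoots H p)) hx' ?_
      (by simp) fun a b ha hb => by rw [add_lie]; exact Submodule.add_mem _ ha hb
    rintro β hβ x hx
    have hxh : ⁅h, x⁆ = β ⟨h, hh⟩ • x := mem_rootSubspace.1 hx ⟨h, hh⟩
    rw [← lie_skew, hxh]
    refine Submodule.neg_mem _ ?_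
    by_cases hβU : β ∈ nilRoots H p
    · exact Submodule.smul_mem _ _ (rootSubspace_le_weightSum hβU hx)
    rcases hβ with rfl | hβ
    · rw [LinearMap.zero_apply, zero_smul]; exact Submodule.zero_mem _
    have h2 : ⁅h, x⁆ ∈ radicalSpace p := by
      rw [← lie_skew]; exact Submodule.neg_mem _ (lie_mem_radicalSpace (hβ.2 hx) hhr)
    rw [hxh] at h2
    -- For a Levi root `β`, the multiple `β(h) x` lies in the radical, which has no weight `β`;
    -- hence it is zero.
    rw [eq_zero_of_mem_weightSum (Submodule.smul_mem _ _ hx) (radicalSpace_le hp h2)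
      fun h3 => h3.elim hβ.1.1 hβU]
    exact Submodule.zero_mem _
  · rw [weightSum_le_iff]
    intro β hβ x hx
    -- Conversely, every root vector `x` in the radical is a bracket `⁅h, x⁆` with `β h = 1`.
    obtain ⟨h, hh⟩ : ∃ h : H, β h = 1 := by
      obtain ⟨h, hh⟩ : ∃ h, β h ≠ 0 := by
        by_contra! h; exact hβ.1.1.1 (LinearMap.ext h)
      exact ⟨(β h)⁻¹ • h, by rw [map_smul, smul_eq_mul, inv_mul_cancel₀ hh]⟩
    obtain ⟨hxp, hxr⟩ := mem_radicalSpace.1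
      (weightSum_nilRoots_le hp (rootSubspace_le_weightSum hβ hx))
    refine ⟨⁅(⟨h, hp h.2⟩ : p), (⟨x, hxp⟩ : p)⁆,
      LieSubmodule.lie_mem_lie (LieSubmodule.mem_top _) hxr, ?_⟩
    change ⁅(h : g), x⁆ = x
    rw [mem_rootSubspace.1 hx, hh, one_smul]

lemma leviPart_eq (Θ : Set (Dual ℂ H)) : leviPart H Θ = weightSum H (insert 0 (rootsOf H Θ)) := by
  rw [weightSum_insert_zero]; rfl

lemma cartan_le_of_hasLeviPart {Θ : Set (Dual ℂ H)} (h : HasLeviPart p (leviPart H Θ)) : H ≤ p := by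
  intro x hx
  have h1 : x ∈ leviPart H Θ ⊔ nilpotentRadical p :=
    Submodule.mem_sup_left (Submodule.mem_sup_left hx)
  rw [h.1] at h1
  exact h1

include hp in
lemma hasLeviPart_iff {Θ : Set (Dual ℂ H)} : HasLeviPart p (leviPart H Θ) ↔
    ∀ α ∈ roots H, α ∈ rootsIn H p.toSubmodule ∧ -α ∈ rootsIn H p.toSubmodule ↔
      α ∈ AddSubgroup.closure Θ := by
  have hsup : leviPart H Θ ⊔ nilpotentRadical p =
      weightSum H (insert 0 (rootsOf H Θ) ∪ nilRoots H p) := by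
    rw [leviPart_eq, nilpotentRadical_eq hp, weightSum, weightSum, weightSum, iSup_union]
  constructor
  · rintro ⟨h1, h2⟩ α hα
    constructor
    · rintro ⟨h3, h4⟩
      have h5 : rootSubspace H α ≤ weightSum H (insert 0 (rootsOf H Θ) ∪ nilRoots H p) := by
        rw [← hsup, h1]; exact h3.2
      obtain ⟨x, hx, hx0⟩ := Submodule.exists_mem_ne_zero_of_ne_bot hα.2
      by_contra h
      refine hx0 (eq_zero_of_mem_weightSum hx (h5 hx) ?_)
      rintro ((h6 | h6) | h6)
      · exact hα.1 h6
      · exact h h6.2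
      · exact h6.2 h4
    · intro h
      have key : ∀ β ∈ rootsOf H Θ, β ∈ rootsIn H p.toSubmodule := fun β hβ => ⟨hβ.1, by
        rw [← h1, hsup]; exact rootSubspace_le_weightSum (Or.inl (Or.inr hβ))⟩
      exact ⟨key α ⟨hα, h⟩, key _ ⟨neg_mem_roots hα, neg_mem h⟩⟩
  · intro h
    have hU : ∀ β ∈ nilRoots H p, β ∉ rootsOf H Θ := fun β hβ h1 => hβ.2 ((h β h1.1).2 h1.2).2
    constructor
    · rw [hsup, toSubmodule_eq_weightSum hp]
      congr 1
      ext β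
      constructor
      · rintro ((h1 | h1) | h1)
        · exact Or.inl h1
        · exact Or.inr ((h β h1.1).2 h1.2).1
        · exact Or.inr h1.1
      · rintro (h1 | h1)
        · exact Or.inl (Or.inl h1)
        · by_cases h2 : -β ∈ rootsIn H p.toSubmodule
          · exact Or.inl (Or.inr ⟨h1.1, (h β h1.1).1 ⟨h1, h2⟩⟩)
          · exact Or.inr ⟨h1, h2⟩
    · rw [leviPart_eq, nilpotentRadical_eq hp]
      refine disjoint_weightSum (Set.disjoint_left.2 ?_)
      rintro β (rfl | h1) h2
      · exact h2.1.1.1 rfl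
      · exact hU β h2 h1

end NilpotentRadical

end ReductivePair


set_option linter.unusedSectionVars false

namespace ReductivePair

open Module LieAlgebra LieModule

/-! ### Exponentials of nilpotent inner derivations -/

section Exponential

variable {g : Type*} [LieRing g] [LieAlgebra ℂ g]

lemma exists_lieEquiv_exp (e : g) {n : ℕ} (hn : ad ℂ g e ^ n = 0) : ∃ φ : g ≃ₗ⁅ℂ⁆ g,
    ∀ x, φ x = ∑ i ∈ Finset.range n, (i.factorial : ℂ)⁻¹ • (ad ℂ g e ^ i) x := by
  let _ : LieAlgebra ℚ g :=
    { Module.compHom g (algebraMap ℚ ℂ) with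
      lie_smul := fun c x y => lie_smul ((c : ℂ)) x y }
  have h0 : (LieDerivation.ad ℂ g e).toLinearMap = ad ℂ g e := by
    ext x; exact LieDerivation.ad_apply_apply ..
  have h1 : IsNilpotent (LieDerivation.ad ℂ g e).toLinearMap := ⟨n, by rw [h0]; exact hn⟩
  refine ⟨LieDerivation.exp _ h1, fun x => ?_⟩
  rw [LieDerivation.exp_map_apply, h0, IsNilpotent.exp_eq_sum hn, LinearMap.sum_apply]
  refine Finset.sum_congr rfl fun i _ => ?_
  have h2 : ∀ (q : ℚ) (A : End ℂ g), (q • A) x = (q : ℂ) • A x := fun q A => rfl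
  rw [h2]
  push_cast
  rfl

lemma isExpAd_of_eq_sum {e : g} {n : ℕ} (hn : ad ℂ g e ^ n = 0) {φ : g ≃ₗ[ℂ] g}
    (h : ∀ x, φ x = ∑ i ∈ Finset.range n, (i.factorial : ℂ)⁻¹ • (ad ℂ g e ^ i) x) :
    IsExpAd e φ := by
  intro y f
  have h1 : f (φ y) = ∑ i ∈ Finset.range n, (i.factorial : ℂ)⁻¹ * f ((ad ℂ g e ^ i) y) := by
    rw [h, map_sum]
    simp only [map_smul, smul_eq_mul]
  rw [h1]
  refine hasSum_sum_of_ne_finset_zero fun i hi => ?_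
  rw [pow_eq_zero_of_le (by simpa using hi) hn, LinearMap.zero_apply, map_zero, mul_zero]

/-- The cut-off `k` may depend on `x`, so values on an `sl₂`-triple and on `H` are computed with at
most three terms. -/
lemma exists_exp_ad {e : g} (he : IsNilpotent (ad ℂ g e)) : ∃ φ : g ≃ₗ⁅ℂ⁆ g,
    φ.toLinearEquiv ∈ innerAutomorphisms g ∧ ∀ (k : ℕ) (x : g), (ad ℂ g e ^ k) x = 0 →
      φ x = ∑ i ∈ Finset.range k, (i.factorial : ℂ)⁻¹ • (ad ℂ g e ^ i) x := by
  obtain ⟨n, hn⟩ := he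
  obtain ⟨φ, hφ⟩ := exists_lieEquiv_exp e hn
  refine ⟨φ, Subgroup.subset_closure ⟨e, isExpAd_of_eq_sum hn hφ⟩, fun k x hk => ?_⟩
  have hz : ∀ m i, m ≤ i → (ad ℂ g e ^ m) x = 0 → (ad ℂ g e ^ i) x = 0 := fun m i hmi hm => by
    rw [← Nat.sub_add_cancel hmi, pow_add, Module.End.mul_apply, hm, map_zero]
  rw [hφ]
  rcases le_total k n with h | h
  · refine (Finset.sum_subset (Finset.range_mono h) fun i _ hi => ?_).symm
    rw [hz k i (by simpa using hi) hk, smul_zero]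
  · refine Finset.sum_subset (Finset.range_mono h) fun i _ hi => ?_
    rw [hz n i (by simpa using hi) (by rw [hn]; rfl), smul_zero]

end Exponential

/-! ### Lifting Weyl group elements to inner automorphisms -/

section Lifts

variable {g : Type*} [LieRing g] [LieAlgebra ℂ g] [FiniteDimensional ℂ g]
  [HasCentralRadical ℂ g] {H : LieSubalgebra ℂ g} [H.IsCartanSubalgebra]

/-- `φ` permutes the root spaces as `w` permutes the roots. -/
def IsLift (w : Dual ℂ H ≃ₗ[ℂ] Dual ℂ H) (φ : g ≃ₗ[ℂ] g) : Prop :=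
  ∀ β, (rootSubspace H β).map (φ : g →ₗ[ℂ] g) = rootSubspace H (w β)

lemma IsLift.mul {v w : Dual ℂ H ≃ₗ[ℂ] Dual ℂ H} {φ ψ : g ≃ₗ[ℂ] g} (h1 : IsLift v φ)
    (h2 : IsLift w ψ) : IsLift (v * w) (φ * ψ) := fun β => by
  change (rootSubspace H β).map ((φ : g →ₗ[ℂ] g) ∘ₗ (ψ : g →ₗ[ℂ] g)) = _
  rw [Submodule.map_comp, h2, h1]; rfl

lemma IsLift.map_weightSum {w : Dual ℂ H ≃ₗ[ℂ] Dual ℂ H} {φ : g ≃ₗ[ℂ] g} (h : IsLift w φ)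
    (T : Set (Dual ℂ H)) : (weightSum H (insert 0 T)).map (φ : g →ₗ[ℂ] g) =
      weightSum H (insert 0 (w '' T)) := by
  have h0 := h 0
  rw [map_zero] at h0
  simp only [weightSum, iSup_insert, iSup_image]
  rw [Submodule.map_sup, h0]
  simp only [Submodule.map_iSup, h _]

/-- The product `exp(ad e) exp(-ad f) exp(ad e)` acts on `H` by `h ↦ h - α(h) c`, the transpose of
the reflection; being a Lie algebra automorphism, it permutes the root spaces accordingly. -/
lemma exists_isLift_reflection {α : Dual ℂ H} (hα : α ∈ roots H)
    {s : Dual ℂ H ≃ₗ[ℂ] Dual ℂ H} (hs : ∀ β, s β = β - β (corootOf H α) • α) :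
    ∃ φ ∈ innerAutomorphisms g, IsLift s φ := by
  obtain ⟨e, f, he, hf, t⟩ := exists_isSl2Triple hα
  set c := corootOf H α
  have hc : α c = 2 := (isCorootOf_corootOf hα).1
  have nile : IsNilpotent (ad ℂ g e) :=
    LieAlgebra.isNilpotent_ad_of_mem_rootSpace H (fun h => hα.1 (DFunLike.coe_injective h))
      (rootSubspace_le_rootSpace α he)
  have nilf : IsNilpotent (ad ℂ g (-f)) :=
    LieAlgebra.isNilpotent_ad_of_mem_rootSpace H
      (fun h => (neg_mem_roots hα).1 (DFunLike.coe_injective h))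
      (rootSubspace_le_rootSpace (-α) (Submodule.neg_mem _ hf))
  obtain ⟨φ, hφ, hφe⟩ := exists_exp_ad nile
  obtain ⟨ψ, hψ, hψe⟩ := exists_exp_ad nilf
  have hhe : ∀ h : H, ⁅e, (h : g)⁆ = -(α h • e) := fun h => by
    rw [← lie_skew, mem_rootSubspace.1 he]
  have hhf : ∀ h : H, ⁅f, (h : g)⁆ = α h • f := fun h => by
    rw [← lie_skew, mem_rootSubspace.1 hf]; simp
  have hφh : ∀ h : H, φ h = h - α h • e := fun h => by
    rw [hφe 2 _ (by simp [pow_succ, hhe])]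
    simp [Finset.sum_range_succ, hhe, sub_eq_add_neg]
  have hφe' : φ e = e := by
    rw [hφe 1 _ (by simp)]; simp
  have hφf : φ f = f + c - e := by
    rw [hφe 3 _ (by simp [pow_succ, t.lie_e_f, hhe])]
    simp only [Finset.sum_range_succ, Finset.sum_range_zero, pow_succ, pow_zero, one_mul,
      Module.End.mul_apply, ad_apply, t.lie_e_f, hhe, hc, Module.End.one_apply]
    simp [Nat.factorial, sub_eq_add_neg]
  have hψh : ∀ h : H, ψ h = h - α h • f := fun h => by
    rw [hψe 2 _ (by simp [pow_succ, hhf])]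
    simp [Finset.sum_range_succ, hhf, sub_eq_add_neg]
  have hψee : ψ e = e + c - f := by
    have h1 : ⁅f, e⁆ = -(c : g) := by rw [← lie_skew, t.lie_e_f]
    rw [hψe 3 _ (by simp [pow_succ, h1, hhf])]
    simp only [Finset.sum_range_succ, Finset.sum_range_zero, pow_succ, pow_zero, one_mul,
      Module.End.mul_apply, ad_apply, neg_lie, h1, neg_neg, hhf, hc, Module.End.one_apply]
    simp [Nat.factorial, sub_eq_add_neg]
  let χ : g ≃ₗ⁅ℂ⁆ g := (φ.trans ψ).trans φ
  have hχh : ∀ h : H, χ h = (h - α h • c : H) := fun h => by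
    change φ (ψ (φ h)) = _
    simp only [map_sub, map_smul, map_add, hψh, hψee, hφh, hφe', hφf, hc]
    push_cast
    module
  refine ⟨φ.toLinearEquiv * (ψ.toLinearEquiv * φ.toLinearEquiv),
    mul_mem hφ (mul_mem hψ hφ), fun β => ?_⟩
  have key : ∀ x, χ x ∈ rootSubspace H (s β) ↔ x ∈ rootSubspace H β := fun x => by
    have h1 : ∀ h : H, s β (h - α h • c) = β h := fun h => by
      rw [hs]
      simp only [map_sub, map_smul, LinearMap.sub_apply, LinearMap.smul_apply, hc, smul_eq_mul]
      ring
    rw [mem_rootSubspace, mem_rootSubspace]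
    constructor
    · intro h k
      have h2 := h (k - α k • c)
      rw [← hχh, h1, ← LieEquiv.map_lie, ← map_smul] at h2
      exact χ.injective h2
    · intro h k
      have h2 : k = (k - α k • c) - α (k - α k • c) • c := by
        rw [map_sub, map_smul, hc, smul_eq_mul]; module
      rw [h2, h1, ← hχh, ← LieEquiv.map_lie, h, map_smul]
  ext y
  constructor
  · rintro ⟨x, hx, rfl⟩
    exact (key x).2 hx
  · intro hy
    refine ⟨χ.symm y, (key _).1 (by rwa [χ.apply_symm_apply]), χ.apply_symm_apply y⟩

lemma exists_isLift {x : H} {hx : ∀ α ∈ roots H, (α x).im = 0 ∧ (α x).re ≠ 0}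
    {w : Dual ℂ H ≃ₗ[ℂ] Dual ℂ H} (hw : w ∈ (rootData x hx).W ⊤) :
    ∃ φ ∈ innerAutomorphisms g, IsLift w φ := by
  refine RootData.W_induction (p := fun w => ∃ φ ∈ innerAutomorphisms g, IsLift w φ) ?_ ?_ hw
  · exact ⟨1, one_mem _, fun β => Submodule.map_id _⟩
  · rintro α hα - w ⟨φ, hφ, h⟩
    obtain ⟨ψ, hψ, h'⟩ := exists_isLift_reflection (s := (rootData x hx).refl α) hα
      fun β => RootData.refl_apply hα β
    exact ⟨ψ * φ, mul_mem hψ hφ, h'.mul h⟩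

end Lifts

end ReductivePair


set_option linter.unusedSectionVars false

namespace ReductivePair

open Module LieAlgebra LieModule

/-! ### Parabolic subalgebras with given Levi part: conjugacy under normality -/

section ParabolicSubalgebras

variable {g : Type*} [LieRing g] [LieAlgebra ℂ g] [FiniteDimensional ℂ g]
  [HasCentralRadical ℂ g] {H : LieSubalgebra ℂ g} [H.IsCartanSubalgebra]
  {x : H} {hx : ∀ α ∈ roots H, (α x).im = 0 ∧ (α x).re ≠ 0} {Θ S : Set (Dual ℂ H)}

/-- The parabolic subalgebra attached to a parabolic set of roots. -/
def ofParabolicSet (hS : (rootData x hx).IsParabolicSet S) : LieSubalgebra ℂ g :=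
  ofRoots S hS.add_mem

lemma isParabolic_ofParabolicSet (hS : (rootData x hx).IsParabolicSet S) :
    IsParabolic (ofParabolicSet hS) := by
  obtain ⟨hQ, -⟩ := hS.exists_pos
  obtain ⟨w, -, hwQ⟩ := hS.exists_pos_subset
  refine ⟨ofRoots _ hQ.add_mem, maximal_isSolvable_ofRoots hQ.subset hQ.add_mem hQ.mem_or ?_, ?_⟩
  · rw [← hwQ]
    rintro - ⟨α, hα, rfl⟩ ⟨β, hβ, hβα⟩
    rw [← map_neg] at hβα
    exact RootData.neg_notMem_pos hα (by rwa [← w.injective hβα])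
  · exact weightSum_mono (Set.insert_subset_insert fun β hβ => hβ.elim (fun h => h.1) fun h => h.2.1)

lemma hasLeviPart_ofParabolicSet_iff (hS : (rootData x hx).IsParabolicSet S) :
    HasLeviPart (ofParabolicSet hS) (leviPart H Θ) ↔
      ∀ α ∈ roots H, α ∈ S ∧ -α ∈ S ↔ α ∈ RootData.levi Θ := by
  have h : rootsIn H (ofParabolicSet hS).toSubmodule = S :=
    rootsIn_weightSum hS.subset
  have h' : H ≤ ofParabolicSet hS := cartan_le_ofRoots
  rw [hasLeviPart_iff h', h]
  rfl

lemma isParabolicSet_rootsIn {p : LieSubalgebra ℂ g} (hp : IsParabolic p) (hH : H ≤ p) :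
    (rootData x hx).IsParabolicSet (rootsIn H p.toSubmodule) where
  subset := fun _ h => h.1
  add_mem := fun _ hβ _ hγ h => rootsIn_add hβ hγ h
  mem_or := fun _ hα => mem_rootsIn_or hp hH hα

lemma exists_map_std_eq (hΘ : Θ ⊆ (rootData x hx).simple ⊤)
    (hn : IsNormal H ((rootData x hx).pos ⊤) Θ) {p : LieSubalgebra ℂ g} (hp : IsParabolic p)
    (hl : HasLeviPart p (leviPart H Θ)) : ∃ φ ∈ innerAutomorphisms g,
      (weightSum H (insert 0 ((rootData x hx).std Θ))).map (φ : g →ₗ[ℂ] g) = p.toSubmodule := by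
  have hH := cartan_le_of_hasLeviPart hl
  obtain ⟨w, hw, h⟩ := (isParabolicSet_rootsIn (hx := hx) hp hH).exists_eq_map_std hΘ
    (fun w hw h => (RootData.closure_sig_le hΘ
      (RootData.mem_closure_sig hΘ (isNormal_iff.1 hn) hw h)).2) ((hasLeviPart_iff hH).1 hl)
  obtain ⟨φ, hφ, hlift⟩ := exists_isLift hw
  exact ⟨φ, hφ, by rw [hlift.map_weightSum, ← h, ← toSubmodule_eq_weightSum hH]⟩

lemma exists_map_eq_of_isNormal (hΘ : Θ ⊆ (rootData x hx).simple ⊤)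
    (hn : IsNormal H ((rootData x hx).pos ⊤) Θ) {p q : LieSubalgebra ℂ g} (hp : IsParabolic p)
    (hpl : HasLeviPart p (leviPart H Θ)) (hq : IsParabolic q)
    (hql : HasLeviPart q (leviPart H Θ)) :
    ∃ φ ∈ innerAutomorphisms g, p.toSubmodule.map (φ : g →ₗ[ℂ] g) = q.toSubmodule := by
  obtain ⟨φ, hφ, h⟩ := exists_map_std_eq hΘ hn hp hpl
  obtain ⟨ψ, hψ, h'⟩ := exists_map_std_eq hΘ hn hq hql
  refine ⟨ψ * φ⁻¹, mul_mem hψ (inv_mem hφ), ?_⟩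
  rw [← h, ← h', ← Submodule.map_comp]
  congr 1
  ext v
  exact congrArg ψ (φ.symm_apply_apply v)

end ParabolicSubalgebras

end ReductivePair


set_option linter.unusedSectionVars false

namespace ReductivePair

open Module LieAlgebra LieModule

/-! ### Exponentials of endomorphisms -/

section EndExp

variable {V : Type*} [AddCommGroup V] [Module ℂ V] [FiniteDimensional ℂ V]
  {W : Type*} [AddCommGroup W] [Module ℂ W] [FiniteDimensional ℂ W]

/-- The exponential of an endomorphism of a finite-dimensional complex vector space. -/
noncomputable def endExp (A : End ℂ V) : End ℂ V :=
  (LinearMap.toMatrixAlgEquiv (finBasis ℂ V)).symm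
    (NormedSpace.exp (LinearMap.toMatrixAlgEquiv (finBasis ℂ V) A))

lemma endExp_zero : endExp (0 : End ℂ V) = 1 := by
  rw [endExp, map_zero, NormedSpace.exp_zero, map_one]

lemma endExp_add {A B : End ℂ V} (h : Commute A B) : endExp (A + B) = endExp A * endExp B := by
  rw [endExp, map_add, Matrix.exp_add_of_commute _ _ (h.map _), map_mul]
  rfl

open scoped Matrix.Norms.Operator in
lemma matrix_hasSum_exp {n : ℕ} (M : Matrix (Fin n) (Fin n) ℂ) :
    HasSum (fun k : ℕ => (k.factorial : ℂ)⁻¹ • M ^ k) (NormedSpace.exp M) :=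
  NormedSpace.exp_series_hasSum_exp' (𝕂 := ℂ) M

lemma hasSum_endExp (A : End ℂ V) (F : Dual ℂ (End ℂ V)) :
    HasSum (fun n : ℕ => (n.factorial : ℂ)⁻¹ * F (A ^ n)) (F (endExp A)) := by
  let e := LinearMap.toMatrixAlgEquiv (finBasis ℂ V)
  let G : Matrix (Fin (finrank ℂ V)) (Fin (finrank ℂ V)) ℂ →ₗ[ℂ] ℂ :=
    F ∘ₗ (e.symm.toLinearMap : _ →ₗ[ℂ] End ℂ V)
  have hG : Continuous G := LinearMap.continuous_of_finiteDimensional G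
  have h := (matrix_hasSum_exp (e A)).map G hG
  have h1 : G (NormedSpace.exp (e A)) = F (endExp A) := rfl
  rw [h1] at h
  refine h.congr_fun fun n => ?_
  change _ = G _
  rw [map_smul, ← map_pow, smul_eq_mul]
  exact congrArg (fun T => _ * F T) (e.symm_apply_apply _).symm

lemma eq_endExp {A B : End ℂ V}
    (h : ∀ F : Dual ℂ (End ℂ V), HasSum (fun n : ℕ => (n.factorial : ℂ)⁻¹ * F (A ^ n)) (F B)) :
    B = endExp A := by
  rw [← sub_eq_zero]
  by_contra hne
  obtain ⟨F, hF⟩ := Module.exists_dual_forall_apply_ne_zero (K := ℂ) (fun _ : Unit => B - endExp A)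
    (fun _ => hne)
  exact hF () (by rw [map_sub, (h F).unique (hasSum_endExp A F), sub_self])

/-- Only compatibility with powers of the one endomorphism `A` is assumed, so that `slot`, which
reverses products, is allowed. -/
lemma map_endExp (θ : End ℂ V →ₗ[ℂ] End ℂ W) {A : End ℂ V} (h : ∀ n : ℕ, θ (A ^ n) = θ A ^ n) :
    θ (endExp A) = endExp (θ A) :=
  eq_endExp fun F => by simpa only [h, LinearMap.comp_apply] using hasSum_endExp A (F ∘ₗ θ)

/-- A linear form that vanishes on `M` vanishes on every term of the series, hence on its sum. -/
lemma endExp_mem {A : End ℂ V} {M : Submodule ℂ V} (h : ∀ m ∈ M, A m ∈ M) {m : V} (hm : m ∈ M) :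
    endExp A m ∈ M := by
  by_contra hn
  obtain ⟨f, hf, hle⟩ := Submodule.exists_le_ker_of_notMem hn
  have hpow : ∀ n : ℕ, (A ^ n) m ∈ M := fun n => by
    induction n with
    | zero => exact hm
    | succ n ih => rw [pow_succ', Module.End.mul_apply]; exact h _ ih
  have hs := hasSum_endExp A (f ∘ₗ LinearMap.applyₗ m)
  refine hf (hs.unique ?_)
  convert hasSum_zero with n
  have : f ((A ^ n) m) = 0 := hle (hpow n)
  simp [this]

variable {g : Type*} [LieRing g] [LieAlgebra ℂ g] [FiniteDimensional ℂ g]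

lemma IsExpAd.eq_endExp {x : g} {φ : g ≃ₗ[ℂ] g} (h : IsExpAd x φ) :
    (φ : g →ₗ[ℂ] g) = endExp (ad ℂ g x) := by
  ext y
  rw [← sub_eq_zero]
  by_contra hne
  obtain ⟨f, hf⟩ := Module.exists_dual_forall_apply_ne_zero (K := ℂ)
    (fun _ : Unit => (φ : g →ₗ[ℂ] g) y - endExp (ad ℂ g x) y) (fun _ => hne)
  refine hf () ?_
  rw [map_sub, sub_eq_zero]
  exact (h y f).unique (hasSum_endExp (ad ℂ g x) (f ∘ₗ LinearMap.applyₗ y))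

lemma IsExpAd.inv_eq_endExp {x : g} {φ : g ≃ₗ[ℂ] g} (h : IsExpAd x φ) :
    ((φ⁻¹ : g ≃ₗ[ℂ] g) : g →ₗ[ℂ] g) = endExp (ad ℂ g (-x)) := by
  have h1 : endExp (ad ℂ g (-x)) * (φ : g →ₗ[ℂ] g) = 1 := by
    rw [h.eq_endExp, map_neg, ← endExp_add (Commute.neg_left (Commute.refl (ad ℂ g x))), neg_add_cancel, endExp_zero]
  ext y
  have h2 := LinearMap.congr_fun h1 (φ⁻¹ y)
  have h3 : φ (φ⁻¹ y) = y := φ.apply_symm_apply y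
  simpa [h3] using h2.symm

end EndExp

/-! ### Multilinear forms as a representation -/

section MultilinearForms

variable {g : Type*} [AddCommGroup g] [Module ℂ g] {ι : Type*} [Fintype ι] [DecidableEq ι]

/-- The action of an endomorphism on multilinear forms through one of the arguments. -/
noncomputable def slot (i : ι) : End ℂ g →ₗ[ℂ] End ℂ (MultilinearMap ℂ (fun _ : ι => g) ℂ) :=
  (MultilinearMap.compLinearMapMultilinear (R := ℂ) (M₁ := fun _ : ι => g) (M₁' := fun _ => g)
    (M₂ := ℂ)).toLinearMap (fun _ => LinearMap.id) i

lemma slot_apply (i : ι) (A : End ℂ g) (m : MultilinearMap ℂ (fun _ : ι => g) ℂ) (v : ι → g) :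
    slot i A m v = m (Function.update v i (A (v i))) := by
  change m (fun j => (Function.update (fun _ => LinearMap.id) i A : ι → End ℂ g) j (v j)) = _
  congr 1
  ext j
  by_cases h : j = i
  · subst h; simp
  · simp [h]

lemma slot_mul (i : ι) (A B : End ℂ g) : slot i A * slot i B = slot i (B * A) := by
  ext m v
  simp [slot_apply]

lemma slot_one (i : ι) : slot i (1 : End ℂ g) = 1 := by
  ext m v
  simp [slot_apply]

lemma slot_pow (i : ι) (A : End ℂ g) (n : ℕ) : slot i (A ^ n) = slot i A ^ n := by
  induction n with
  | zero => rw [pow_zero, pow_zero, slot_one]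
  | succ n ih => rw [pow_succ', ← slot_mul, ih, pow_succ]

lemma slot_commute {i j : ι} (h : i ≠ j) (A B : End ℂ g) : Commute (slot i A) (slot j B) := by
  ext m v
  simp [slot_apply, h, h.symm, Function.update_comm h]

/-- The action of an endomorphism on multilinear forms by derivations. -/
noncomputable def derivAct : End ℂ g →ₗ[ℂ] End ℂ (MultilinearMap ℂ (fun _ : ι => g) ℂ) :=
  ∑ i, slot i

lemma derivAct_apply (A : End ℂ g) (m : MultilinearMap ℂ (fun _ : ι => g) ℂ) (v : ι → g) :
    derivAct A m v = ∑ i, m (Function.update v i (A (v i))) := by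
  simp [derivAct, slot_apply]

lemma derivAct_mul_sub (A B : End ℂ g) : derivAct A * derivAct B - derivAct B * derivAct A =
    derivAct (ι := ι) (B * A - A * B) := by
  simp only [derivAct, LinearMap.sum_apply, Finset.sum_mul_sum]
  rw [Finset.sum_comm (f := fun i j => slot i B * slot j A), ← Finset.sum_sub_distrib]
  refine Finset.sum_congr rfl fun i _ => ?_
  rw [← Finset.sum_sub_distrib, Finset.sum_eq_single i]
  · rw [slot_mul, slot_mul, ← map_sub]
  · intro j _ hj
    rw [sub_eq_zero]
    exact slot_commute hj.symm A B
  · exact fun h => absurd (Finset.mem_univ i) h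

variable [FiniteDimensional ℂ g]

/-- The actions on different arguments commute, so the exponential of their sum is the product of
the exponentials, taken one argument at a time. -/
lemma compLinearMap_endExp (A : End ℂ g) (m : MultilinearMap ℂ (fun _ : ι => g) ℂ) :
    m.compLinearMap (fun _ => endExp A) = endExp (derivAct A) m := by
  have key : ∀ s : Finset ι, ∀ m : MultilinearMap ℂ (fun _ : ι => g) ℂ,
      m.compLinearMap (fun i => if i ∈ s then endExp A else LinearMap.id) =
        endExp (∑ i ∈ s, slot i A) m := by
    intro s
    induction s using Finset.induction_on with
    | empty =>
      intro m
      rw [Finset.sum_empty, endExp_zero]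
      ext v
      simp
    | insert i s hi ih =>
      intro m
      have hc : Commute (slot i A) (∑ j ∈ s, slot j A) :=
        Commute.sum_right _ _ _ fun j hj => slot_commute (ne_of_mem_of_not_mem hj hi).symm A A
      rw [Finset.sum_insert hi, endExp_add hc, Module.End.mul_apply, ← ih,
        ← map_endExp (slot i) fun n => slot_pow i A n]
      ext v
      rw [slot_apply]
      simp only [MultilinearMap.compLinearMap_apply]
      congr 1
      ext j
      by_cases h : j = i
      · subst h; simp [hi]
      · simp [h]
  have h := key Finset.univ m
  simp only [Finset.mem_univ, if_true] at h
  rw [h, derivAct, LinearMap.sum_apply]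

end MultilinearForms

end ReductivePair


set_option linter.unusedSectionVars false

namespace ReductivePair

open Module LieAlgebra LieModule

/-! ### Subspaces encoded by determinants of linear forms -/

section DeterminantForms

variable {g : Type*} [AddCommGroup g] [Module ℂ g] {d : ℕ} {F F' : g →ₗ[ℂ] (Fin d → ℂ)}

/-- The determinant of `d` linear forms, as a multilinear form. -/
noncomputable def detForm (F : g →ₗ[ℂ] (Fin d → ℂ)) : MultilinearMap ℂ (fun _ : Fin d => g) ℂ :=
  (Matrix.detRowAlternating (n := Fin d) (R := ℂ)).toMultilinearMap.compLinearMap fun _ => F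

lemma detForm_apply (v : Fin d → g) : detForm F v = (Matrix.of fun i => F (v i)).det := rfl

lemma detForm_update (v : Fin d → g) (i : Fin d) (u : g) :
    detForm F (Function.update v i u) = ((Matrix.of fun i => F (v i)).updateRow i (F u)).det := by
  rw [detForm_apply]
  congr 1
  ext j k
  by_cases h : j = i
  · subst h; simp
  · simp [h]

/-- This is the derivative of a determinant: expanding along the altered rows gives the trace of
`adj(Mᵀ) C Mᵀ`, which is `tr C · det M`. -/
lemma derivAct_detForm {A : End ℂ g} {C : Matrix (Fin d) (Fin d) ℂ}
    (h : ∀ v, F (A v) = C.mulVec (F v)) : derivAct A (detForm F) = C.trace • detForm F := by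
  ext v
  rw [derivAct_apply, smul_apply, detForm_apply]
  set M : Matrix (Fin d) (Fin d) ℂ := Matrix.of fun i => F (v i)
  have h1 : ∀ i, detForm F (Function.update v i (A (v i))) = (M.transpose.adjugate * (C * M.transpose)) i i := by
    intro i
    rw [detForm_update, ← Matrix.cramer_transpose_apply, Matrix.cramer_eq_adjugate_mulVec, h]
    rfl
  simp only [h1]
  change (M.transpose.adjugate * (C * M.transpose)).trace = _
  rw [Matrix.trace_mul_comm, Matrix.mul_assoc, Matrix.mul_adjugate, Matrix.det_transpose,
    Matrix.mul_smul, Matrix.mul_one, Matrix.trace_smul, smul_eq_mul, smul_eq_mul, mul_comm]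

lemma exists_derivAct_detForm (hF : Function.Surjective F) {A : End ℂ g}
    (hA : ∀ v, F v = 0 → F (A v) = 0) : ∃ c : ℂ, derivAct A (detForm F) = c • detForm F := by
  obtain ⟨s, hs⟩ := F.exists_rightInverse_of_surjective (LinearMap.range_eq_top.2 hF)
  refine ⟨_, derivAct_detForm (C := LinearMap.toMatrix' (F ∘ₗ A ∘ₗ s)) fun v => ?_⟩
  rw [LinearMap.toMatrix'_mulVec, LinearMap.comp_apply, LinearMap.comp_apply, ← sub_eq_zero,
    ← map_sub, ← map_sub]
  refine hA _ ?_
  have : F (s (F v)) = F v := LinearMap.congr_fun hs (F v)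
  rw [map_sub, this, sub_self]

lemma detForm_ne_zero (hF : Function.Surjective F) : detForm F ≠ 0 := by
  intro h
  choose v hv using fun i => hF (Pi.single i 1)
  have h1 : detForm F v = 1 := by
    rw [detForm_apply, ← Matrix.det_one (n := Fin d)]
    congr 1
    ext i j
    simp [hv, Matrix.one_apply, Pi.single_apply, eq_comm]
  rw [h] at h1
  simp at h1

/-- The determinant form remembers the common kernel of its linear forms: complete `u` by preimages
of the standard basis to read off each coordinate of `F u`. -/
lemma apply_eq_zero_iff (hF : Function.Surjective F) (u : g) :
    F u = 0 ↔ ∀ v i, detForm F (Function.update v i u) = 0 := by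
  constructor
  · intro h v i
    rw [detForm_update, h]
    exact Matrix.det_eq_zero_of_row_eq_zero i (by simp)
  · intro h
    ext i
    choose v hv using fun i => hF (Pi.single i 1)
    have h1 := h v i
    have h2 : (Matrix.of fun i => F (v i)) = (1 : Matrix (Fin d) (Fin d) ℂ) := by
      ext i j
      simp [hv, Matrix.one_apply, Pi.single_apply, eq_comm]
    rwa [detForm_update, h2, ← Matrix.cramer_transpose_apply, Matrix.transpose_one,
      Matrix.cramer_one] at h1

lemma ker_eq_of_detForm_eq_smul (hF : Function.Surjective F) (hF' : Function.Surjective F') {c : ℂ}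
    (h : detForm F' = c • detForm F) : LinearMap.ker F' = LinearMap.ker F := by
  have hc : c ≠ 0 := by
    rintro rfl
    exact detForm_ne_zero hF' (by rw [h, zero_smul])
  ext u
  rw [LinearMap.mem_ker, LinearMap.mem_ker, apply_eq_zero_iff hF', apply_eq_zero_iff hF, h]
  simp [hc]

end DeterminantForms

/-! ### Highest weight argument for multilinear forms -/

section HighestWeight

variable {g : Type*} [LieRing g] [LieAlgebra ℂ g] [FiniteDimensional ℂ g] {ι : Type*} [Fintype ι]
  [DecidableEq ι]

lemma derivAct_ad_comm (a b : g) (m : MultilinearMap ℂ (fun _ : ι => g) ℂ) :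
    derivAct (ad ℂ g a) (derivAct (ad ℂ g b) m) =
      derivAct (ad ℂ g b) (derivAct (ad ℂ g a) m) + derivAct (ad ℂ g ⁅b, a⁆) m := by
  have h : ad ℂ g ⁅b, a⁆ = ad ℂ g b * ad ℂ g a - ad ℂ g a * ad ℂ g b := by
    ext v
    exact lie_lie b a v
  rw [h, ← derivAct_mul_sub]
  simp

/-- A space of multilinear forms that is stable under `g` is stable under the inner
automorphisms. -/
lemma compLinearMap_mem_of_stable {M : Submodule ℂ (MultilinearMap ℂ (fun _ : ι => g) ℂ)}
    (hM : ∀ y : g, ∀ m ∈ M, derivAct (ad ℂ g y) m ∈ M) {φ : g ≃ₗ[ℂ] g}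
    (hφ : φ ∈ innerAutomorphisms g) :
    ∀ m ∈ M, m.compLinearMap (fun _ => (φ : g →ₗ[ℂ] g)) ∈ M ∧
      m.compLinearMap (fun _ => ((φ⁻¹ : g ≃ₗ[ℂ] g) : g →ₗ[ℂ] g)) ∈ M := by
  induction hφ using Subgroup.closure_induction with
  | mem φ h =>
    obtain ⟨x, hx⟩ := h
    intro m hm
    rw [hx.eq_endExp, hx.inv_eq_endExp, compLinearMap_endExp, compLinearMap_endExp]
    exact ⟨endExp_mem (hM x) hm, endExp_mem (hM (-x)) hm⟩
  | one => exact fun m hm => ⟨hm, hm⟩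
  | mul φ ψ _ _ h1 h2 =>
    intro m hm
    rw [mul_inv_rev]
    exact ⟨(h2 _ (h1 m hm).1).1, (h1 _ (h2 m hm).2).2⟩
  | inv φ _ h =>
    intro m hm
    rw [inv_inv]
    exact (h m hm).symm

variable [HasCentralRadical ℂ g] {H : LieSubalgebra ℂ g} [H.IsCartanSubalgebra]
  {x : H} (hx : ∀ α ∈ roots H, (α x).im = 0 ∧ (α x).re ≠ 0)

/-- The smallest space that contains `η` and is stable under the negative root spaces. -/
def lowerSpan (η : MultilinearMap ℂ (fun _ : ι => g) ℂ) :
    Submodule ℂ (MultilinearMap ℂ (fun _ : ι => g) ℂ) :=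
  sInf {U | η ∈ U ∧ ∀ β ∈ (rootData x hx).pos ⊤, ∀ y ∈ rootSubspace H (-β), ∀ m ∈ U,
    derivAct (ad ℂ g y) m ∈ U}

variable {hx}

lemma lowerSpan_le {η : MultilinearMap ℂ (fun _ : ι => g) ℂ}
    {U : Submodule ℂ (MultilinearMap ℂ (fun _ : ι => g) ℂ)} (hη : η ∈ U)
    (hU : ∀ β ∈ (rootData x hx).pos ⊤, ∀ y ∈ rootSubspace H (-β), ∀ m ∈ U,
      derivAct (ad ℂ g y) m ∈ U) : lowerSpan hx η ≤ U :=
  sInf_le ⟨hη, hU⟩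

lemma self_mem_lowerSpan (η : MultilinearMap ℂ (fun _ : ι => g) ℂ) : η ∈ lowerSpan hx η :=
  Submodule.mem_sInf.2 fun _ h => h.1

lemma derivAct_mem_lowerSpan {η m : MultilinearMap ℂ (fun _ : ι => g) ℂ}
    (hm : m ∈ lowerSpan hx η) {β : Dual ℂ H} (hβ : β ∈ (rootData x hx).pos ⊤) {y : g}
    (hy : y ∈ rootSubspace H (-β)) : derivAct (ad ℂ g y) m ∈ lowerSpan hx η :=
  Submodule.mem_sInf.2 fun U hU => hU.2 β hβ y hy m (Submodule.mem_sInf.1 hm U hU)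

/-- The forms in `lowerSpan` that all of `g` keeps inside it form a subspace. It contains `η`, an
eigenvector of the Borel subalgebra, and the commutation rule makes it stable under the negative
root spaces; by minimality it is everything. -/
lemma lowerSpan_stable {η : MultilinearMap ℂ (fun _ : ι => g) ℂ}
    (hη : ∀ y ∈ weightSum H (insert 0 ((rootData x hx).pos ⊤)),
      ∃ c : ℂ, derivAct (ad ℂ g y) η = c • η) (y : g) :
    ∀ m ∈ lowerSpan hx η, derivAct (ad ℂ g y) m ∈ lowerSpan hx η := by
  let U : Submodule ℂ (MultilinearMap ℂ (fun _ : ι => g) ℂ) :=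
    lowerSpan hx η ⊓ ⨅ y : g, (lowerSpan hx η).comap (derivAct (ad ℂ g y))
  have hU : ∀ m, m ∈ U ↔ m ∈ lowerSpan hx η ∧ ∀ y, derivAct (ad ℂ g y) m ∈ lowerSpan hx η :=
    fun m => by simp [U]
  have hle : lowerSpan hx η ≤ U := by
    refine lowerSpan_le ((hU _).2 ⟨self_mem_lowerSpan η, fun z => ?_⟩) fun β hβ z hz m hm => ?_
    · have hz : z ∈ weightSum H (insert 0 (roots H)) := by rw [weightSum_roots]; trivial
      refine weightSum_induction (p := fun z => derivAct (ad ℂ g z) η ∈ lowerSpan hx η) hz ?_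
        (by simp) fun a b ha hb => by
          rw [map_add, map_add, LinearMap.add_apply]; exact Submodule.add_mem _ ha hb
      have hpos : ∀ β ∈ insert 0 ((rootData x hx).pos ⊤), ∀ z ∈ rootSubspace H β,
          derivAct (ad ℂ g z) η ∈ lowerSpan hx η := fun β hβ z hz => by
        obtain ⟨c, hc⟩ := hη z (rootSubspace_le_weightSum hβ hz)
        rw [hc]
        exact Submodule.smul_mem _ _ (self_mem_lowerSpan η)
      rintro β (rfl | hβ) z hz
      · exact hpos 0 (Or.inl rfl) z hz
      · rcases RootData.mem_pos_or (D := rootData x hx) hβ (A := ⊤) trivial with h | h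
        · exact hpos β (Or.inr h) z hz
        · exact derivAct_mem_lowerSpan (self_mem_lowerSpan η) h (by rwa [neg_neg])
    · obtain ⟨h1, h2⟩ := (hU m).1 hm
      refine (hU _).2 ⟨h2 z, fun a => ?_⟩
      rw [derivAct_ad_comm]
      exact Submodule.add_mem _ (derivAct_mem_lowerSpan (h2 a) hβ hz) (h2 _)
  exact fun m hm => ((hU m).1 (hle hm)).2 y

/-- The action on forms reverses products, so the root space of `-β` adds `β x` to eigenvalues of
`x`, and `β x` has positive real part. -/
lemma lowerSpan_le_eigenspaces {η : MultilinearMap ℂ (fun _ : ι => g) ℂ} {c : ℂ}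
    (hη : derivAct (ad ℂ g (x : g)) η = c • η) :
    lowerSpan hx η ≤ Submodule.span ℂ {η} ⊔ ⨆ μ ∈ {μ : ℂ | c.re < μ.re},
      End.eigenspace (derivAct (ι := ι) (ad ℂ g (x : g))) μ := by
  refine lowerSpan_le (Submodule.mem_sup_left (Submodule.mem_span_singleton_self η)) ?_
  intro β hβ y hy
  have hlie : ⁅y, (x : g)⁆ = β x • y := by
    rw [← lie_skew, mem_rootSubspace.1 hy, LinearMap.neg_apply, neg_smul, neg_neg]
  have hre : 0 < (β x).re := hβ.2
  have key : ∀ (μ : ℂ) (m : MultilinearMap ℂ (fun _ : ι => g) ℂ), c.re ≤ μ.re →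
      derivAct (ad ℂ g (x : g)) m = μ • m →
      derivAct (ad ℂ g y) m ∈ ⨆ μ ∈ {μ : ℂ | c.re < μ.re},
        End.eigenspace (derivAct (ι := ι) (ad ℂ g (x : g))) μ := by
    intro μ m hμ hm
    refine Submodule.mem_iSup_of_mem (μ + β x) (Submodule.mem_iSup_of_mem ?_ ?_)
    · rw [Set.mem_ofPred_eq, Complex.add_re]; linarith
    · rw [End.mem_eigenspace_iff, derivAct_ad_comm, hm, hlie, map_smul, map_smul, map_smul,
        LinearMap.smul_apply, add_smul]
  intro m hm
  obtain ⟨a, ha, b, hb, rfl⟩ := Submodule.mem_sup.1 hm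
  obtain ⟨t, rfl⟩ := Submodule.mem_span_singleton.1 ha
  rw [map_add, map_smul]
  refine Submodule.mem_sup_right (Submodule.add_mem _ (Submodule.smul_mem _ _ (key c η le_rfl hη)) ?_)
  refine Submodule.iSup_induction _ (motive := fun b => derivAct (ad ℂ g y) b ∈ _) hb ?_
    (by rw [map_zero]; exact Submodule.zero_mem _)
    fun a b ha hb => by rw [map_add]; exact Submodule.add_mem _ ha hb
  intro μ b hb
  refine Submodule.iSup_induction _ (motive := fun b => derivAct (ad ℂ g y) b ∈ _) hb ?_
    (by rw [map_zero]; exact Submodule.zero_mem _)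
    fun a b ha hb => by rw [map_add]; exact Submodule.add_mem _ ha hb
  intro hμ b hb
  exact key μ b (le_of_lt hμ) (End.mem_eigenspace_iff.1 hb)

/-- By independence of eigenspaces, an eigenvector in `lowerSpan` whose eigenvalue has no larger
real part can only come from the line of `η`. -/
lemma exists_eq_smul_of_mem_lowerSpan {η η' : MultilinearMap ℂ (fun _ : ι => g) ℂ} {c c' : ℂ}
    (hη : derivAct (ad ℂ g (x : g)) η = c • η) (hη' : derivAct (ad ℂ g (x : g)) η' = c' • η')
    (hre : c'.re ≤ c.re) (h0 : η' ≠ 0) (h : η' ∈ lowerSpan hx η) : ∃ t : ℂ, η' = t • η := by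
  set E := End.eigenspace (derivAct (ι := ι) (ad ℂ g (x : g)))
  have hind : iSupIndep E := End.eigenspaces_iSupIndep _
  obtain ⟨a, ha, u, hu, hau⟩ := Submodule.mem_sup.1 (lowerSpan_le_eigenspaces hη h)
  obtain ⟨t, rfl⟩ := Submodule.mem_span_singleton.1 ha
  have hηE : η ∈ E c := End.mem_eigenspace_iff.2 hη
  have hηE' : η' ∈ E c' := End.mem_eigenspace_iff.2 hη'
  by_cases hcc : c' = c
  · subst hcc
    refine ⟨t, ?_⟩
    have hd := hind.disjoint_biSup (x := c') (y := {μ : ℂ | c'.re < μ.re}) (fun h => lt_irrefl c'.re h)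
    have hu' : u = η' - t • η := by rw [← hau]; abel
    have := Submodule.disjoint_def.1 hd u
      (by rw [hu']; exact Submodule.sub_mem _ hηE' (Submodule.smul_mem _ _ hηE)) hu
    rw [← hau, this, add_zero]
  · have hd := hind.disjoint_biSup (x := c') (y := insert c {μ : ℂ | c.re < μ.re})
      (fun h => h.elim hcc fun h => absurd h (not_lt.2 hre))
    refine absurd (Submodule.disjoint_def.1 hd η' hηE' ?_) h0
    rw [iSup_insert, ← hau]
    exact Submodule.add_mem_sup (Submodule.smul_mem _ _ hηE) hu

end HighestWeight

end ReductivePair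


set_option linter.unusedSectionVars false

namespace ReductivePair

open Module LieAlgebra LieModule

/-! ### Conjugate standard parabolics are equal; conjugacy implies normality -/

section Conjugacy

variable {g : Type*} [LieRing g] [LieAlgebra ℂ g] [FiniteDimensional ℂ g]
  [HasCentralRadical ℂ g] {H : LieSubalgebra ℂ g} [H.IsCartanSubalgebra]
  {x : H} {hx : ∀ α ∈ roots H, (α x).im = 0 ∧ (α x).re ≠ 0} {Θ S T : Set (Dual ℂ H)}

lemma exists_smul_of_derivAct (hS : (rootData x hx).IsParabolicSet S)
    (hpS : (rootData x hx).pos ⊤ ⊆ S) {d : ℕ} {F : g →ₗ[ℂ] (Fin d → ℂ)}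
    (hF : Function.Surjective F) (hker : LinearMap.ker F = weightSum H (insert 0 S)) :
    ∀ y ∈ weightSum H (insert 0 ((rootData x hx).pos ⊤)),
      ∃ c : ℂ, derivAct (ad ℂ g y) (detForm F) = c • detForm F := by
  intro y hy
  refine exists_derivAct_detForm hF fun v hv => ?_
  rw [← LinearMap.mem_ker, hker] at hv ⊢
  exact (ofParabolicSet hS).lie_mem (weightSum_mono (Set.insert_subset_insert hpS) hy) hv

lemma mem_weightSum_insert_zero (T : Set (Dual ℂ H)) : (x : g) ∈ weightSum H (insert 0 T) :=
  rootSubspace_le_weightSum (Or.inl rfl) (by rw [rootSubspace_zero]; exact x.2)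

/-- Standard parabolic subalgebras that are conjugate under inner automorphisms are equal. -/
lemma eq_of_map_eq (hS : (rootData x hx).IsParabolicSet S) (hpS : (rootData x hx).pos ⊤ ⊆ S)
    (hT : (rootData x hx).IsParabolicSet T) (hpT : (rootData x hx).pos ⊤ ⊆ T) {φ : g ≃ₗ[ℂ] g}
    (hφ : φ ∈ innerAutomorphisms g) (h : (weightSum H (insert 0 S)).map (φ : g →ₗ[ℂ] g) =
      weightSum H (insert 0 T)) : S = T := by
  set N := weightSum H (insert 0 S)
  let F : g →ₗ[ℂ] (Fin (finrank ℂ (g ⧸ N)) → ℂ) :=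
    (finBasis ℂ (g ⧸ N)).equivFun.toLinearMap ∘ₗ N.mkQ
  -- The kernel of `F` is the first parabolic and that of `F'` is its image under `φ`, the second
  -- one.
  let F' : g →ₗ[ℂ] (Fin (finrank ℂ (g ⧸ N)) → ℂ) := F ∘ₗ ((φ⁻¹ : g ≃ₗ[ℂ] g) : g →ₗ[ℂ] g)
  have hF : Function.Surjective F :=
    (finBasis ℂ (g ⧸ N)).equivFun.surjective.comp N.mkQ_surjective
  have hF' : Function.Surjective F' := hF.comp (φ⁻¹).surjective
  have hker : LinearMap.ker F = N := by
    rw [LinearEquiv.ker_comp, Submodule.ker_mkQ]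
  have hker' : LinearMap.ker F' = weightSum H (insert 0 T) := by
    rw [LinearMap.ker_comp, hker, ← h, Submodule.map_equiv_eq_comap_symm]
    rfl
  have hη := exists_smul_of_derivAct hS hpS hF hker
  have hη' := exists_smul_of_derivAct hT hpT hF' hker'
  obtain ⟨c, hc⟩ := hη x (mem_weightSum_insert_zero _)
  obtain ⟨c', hc'⟩ := hη' x (mem_weightSum_insert_zero _)
  have hmem : detForm F' ∈ lowerSpan hx (detForm F) :=
    (compLinearMap_mem_of_stable (lowerSpan_stable hη) hφ _ (self_mem_lowerSpan _)).2
  have hmem' : detForm F ∈ lowerSpan hx (detForm F') := by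
    have h1 : detForm F = (detForm F').compLinearMap (fun _ => (φ : g →ₗ[ℂ] g)) := by
      ext v
      change _ = detForm F fun i => φ⁻¹ (φ (v i))
      congr 1
      ext i
      exact (φ.symm_apply_apply (v i)).symm
    nth_rewrite 1 [h1]
    exact (compLinearMap_mem_of_stable (lowerSpan_stable hη') hφ _ (self_mem_lowerSpan _)).1
  have hkk : LinearMap.ker F' = LinearMap.ker F := by
    -- Each form lies in the stable space generated by the other, so the argument can start from
    -- whichever eigenvalue has the larger real part.
    rcases le_total c'.re c.re with hre | hre
    · obtain ⟨t, ht⟩ := exists_eq_smul_of_mem_lowerSpan hc hc' hre (detForm_ne_zero hF') hmem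
      exact ker_eq_of_detForm_eq_smul hF hF' ht
    · obtain ⟨t, ht⟩ := exists_eq_smul_of_mem_lowerSpan hc' hc hre (detForm_ne_zero hF) hmem'
      exact (ker_eq_of_detForm_eq_smul hF' hF ht).symm
  rw [hker, hker'] at hkk
  rw [← rootsIn_weightSum (H := H) hS.subset, ← rootsIn_weightSum (H := H) hT.subset, hkk]

lemma levi_image (w : Dual ℂ H ≃ₗ[ℂ] Dual ℂ H) (α : Dual ℂ H) :
    w α ∈ RootData.levi (w '' Θ) ↔ α ∈ RootData.levi Θ := by
  have h1 : RootData.levi (w '' Θ) = (RootData.levi Θ).map (w : Dual ℂ H →+ Dual ℂ H) :=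
    (AddMonoidHom.map_closure (w : Dual ℂ H →+ Dual ℂ H) Θ).symm
  rw [h1, AddSubgroup.mem_map]
  constructor
  · rintro ⟨β, hβ, h⟩
    rwa [← w.injective h]
  · exact fun h => ⟨α, h, rfl⟩

/-- The standard parabolic of `Θ` and the `σ⁻¹`-translate of that of `σΘ` share the Levi part `l_Θ`.
Composing their conjugation with a lift of `σ` makes two standard parabolics conjugate, hence equal.
Their Levi roots then agree, and so do the simple roots `σΘ` and `Θ` of these. -/
lemma isNormal_of_conjugate (hΘ : Θ ⊆ (rootData x hx).simple ⊤)
    (hconj : ∀ p q : LieSubalgebra ℂ g,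
        IsParabolic p → HasLeviPart p (leviPart H Θ) →
        IsParabolic q → HasLeviPart q (leviPart H Θ) →
        ∃ φ ∈ innerAutomorphisms g,
          p.toSubmodule.map (φ : g →ₗ[ℂ] g) = q.toSubmodule) :
    IsNormal H ((rootData x hx).pos ⊤) Θ := by
  rw [isNormal_iff]
  intro α hα hαΘ
  set D := rootData x hx
  rw [RootData.orderOf_sig_eq_two_iff hΘ hα.1.1.1 (RootData.notMem_span_of_simple hΘ hα hαΘ)]
  set σ := D.sig Θ α
  have hσ : σ ∈ D.W ⊤ := RootData.W_le_top (RootData.sig_mem α)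
  have hΘ' : σ '' Θ ⊆ D.simple ⊤ := by
    rintro - ⟨θ, hθ, rfl⟩
    have h := RootData.sig_mem_simple hΘ (α := α) hθ
    rw [RootData.simple_along_of_simple hΘ hα hαΘ] at h
    exact Set.insert_subset hα hΘ h
  have hp := RootData.isParabolicSet_std hΘ
  have hp' := RootData.isParabolicSet_std hΘ'
  have hq := hp'.map (inv_mem hσ)
  obtain ⟨φ, hφ, h⟩ := hconj _ _ (isParabolic_ofParabolicSet hp)
    ((hasLeviPart_ofParabolicSet_iff hp).2 fun β hβ => RootData.mem_std_and_neg_mem_iff hβ)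
    (isParabolic_ofParabolicSet hq) ((hasLeviPart_ofParabolicSet_iff hq).2 fun β hβ => by
      have hmem : ∀ γ, γ ∈ (σ⁻¹ : Dual ℂ H ≃ₗ[ℂ] Dual ℂ H) '' D.std (σ '' Θ) ↔
          σ γ ∈ D.std (σ '' Θ) := fun γ => by
        constructor
        · rintro ⟨δ, hδ, rfl⟩
          have : σ (σ⁻¹ δ) = δ := σ.apply_symm_apply δ
          rwa [this]
        · exact fun h => ⟨_, h, σ.symm_apply_apply γ⟩
      rw [hmem, hmem, map_neg, RootData.mem_std_and_neg_mem_iff (RootData.map_mem hσ hβ),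
        levi_image])
  obtain ⟨ψ, hψ, hlift⟩ := exists_isLift hσ
  have h1 : D.std Θ = D.std (σ '' Θ) := by
    refine eq_of_map_eq hp RootData.pos_subset_std hp' RootData.pos_subset_std (mul_mem hψ hφ) ?_
    change (weightSum H _).map ((ψ : g →ₗ[ℂ] g) ∘ₗ (φ : g →ₗ[ℂ] g)) = _
    change (weightSum H _).map (φ : g →ₗ[ℂ] g) = weightSum H _ at h
    rw [Submodule.map_comp, h, hlift.map_weightSum, ← Set.image_comp]
    have hid : (σ : Dual ℂ H → Dual ℂ H) ∘ (σ⁻¹ : Dual ℂ H ≃ₗ[ℂ] Dual ℂ H) = id :=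
      funext fun v => σ.apply_symm_apply v
    rw [hid, Set.image_id]
  have h2 : D.pos (RootData.levi (σ '' Θ)) = D.pos (RootData.levi Θ) := by
    have h3 : D.Φ ∩ RootData.levi (σ '' Θ) = D.Φ ∩ RootData.levi Θ := by
      ext β
      refine and_congr_right fun hβ => ?_
      rw [SetLike.mem_coe, SetLike.mem_coe, ← RootData.mem_std_and_neg_mem_iff hβ, ← h1,
        RootData.mem_std_and_neg_mem_iff hβ]
    simp only [RootData.pos, h3]
  rw [← RootData.simple_levi hΘ', RootData.simple, h2]
  exact RootData.simple_levi hΘ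

end Conjugacy

end ReductivePair

theorem proposition3p3p4 {g : Type*} [LieRing g] [LieAlgebra ℂ g] [FiniteDimensional ℂ g]
    [LieAlgebra.HasCentralRadical ℂ g]
    (H : LieSubalgebra ℂ g) [H.IsCartanSubalgebra]
    (P : Set (Module.Dual ℂ H)) (hP : IsPositiveSystem (roots H) P)
    (Θ : Set (Module.Dual ℂ H)) (hΘ : Θ ⊂ simpleRoots P) :
    List.TFAE
      [ IsNormal H P Θ,
        simpleTransporter H P Θ = (reflectionPart H P Θ : Set _),
        simpleTransporter H P Θ = stabilizerSet H Θ,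
        usefulRestrictedRoots H P Θ = restrictedRoots H Θ ] ∧
    (IsNormal H P Θ ↔
      ∀ p q : LieSubalgebra ℂ g,
        IsParabolic p → HasLeviPart p (leviPart H Θ) →
        IsParabolic q → HasLeviPart q (leviPart H Θ) →
        ∃ φ ∈ innerAutomorphisms g,
          p.toSubmodule.map (φ : g →ₗ[ℂ] g) = q.toSubmodule) := by
  obtain ⟨x, hx, hPx⟩ := hP
  have hP' : P = (rootData x hx).pos ⊤ := by
    rw [hPx]
    ext α
    exact ⟨fun h => ⟨⟨h.1, trivial⟩, h.2⟩, fun h => ⟨h.1.1, h.2⟩⟩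
  subst hP'
  have hΘ' : Θ ⊆ (rootData x hx).simple ⊤ := hΘ.subset
  exact ⟨tfae_isNormal hΘ', fun hn _ _ hp hpl hq hql =>
    exists_map_eq_of_isNormal hΘ' hn hp hpl hq hql, isNormal_of_conjugate hΘ'⟩
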